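/- Conventions. All graphs are finite, undirected and simple, and a graph class is closed under isomorphism. For $d\ge 1$, a \emph{$d$-coc set} of a graph $G$ is a set $S\subseteq V(G)$ such that every connected component of $G-S$ has at most $d$ vertices. The problem \emph{$d$-COC} asks, for a given graph $G$ and integer $k\in\mathbb{Z}$ (negative values are allowed), whether $G$ has a $d$-coc set of size at most $k$. A set $X\subseteq V(G)$ is a \emph{$d$-blocking set} of $G$ if no minimum $d$-coc set of $G$ contains $X$; it is \emph{minimal} if no proper subset of $X$ is a $d$-blocking set of $G$. A class $\mathcal{G}$ has minimal $d$-blocking sets of size at most $b$ if every minimal $d$-blocking set of every graph in $\mathcal{G}$ has at most $b$ elements. $\mathcal{G}+d$ is the class of all graphs $G$ that have a set $M\subseteq V(G)$ with $|M|=d$ and $G-M\in\mathcal{G}$. A class is \emph{hereditary} if it is closed under induced subgraphs. That $d$-COC can be solved in polynomial time on a class $\mathcal{H}$ means that some algorithm gives the correct answer in polynomial time on all instances $(G,k)$ with $G\in\mathcal{H}$ (nothing is required of other inputs). Integers are encoded in binary. Theorem. Let $d\ge 1$ and $b\ge 0$ be integers and let $\mathcal{G}$ be a graph class that has minimal $d$-blocking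 sets of size at most $b$. Assume that (1) $d$-COC can be solved in polynomial time on $\mathcal{G}+d$, or (2) $d$-COC can be solved in polynomial time on $\mathcal{G}$, and $\mathcal{G}$ is hereditary. Then there is a polynomial-time algorithm that, given a graph $G$, an integer $k$ and a set $M\subseteq V(G)$ with $G-M\in\mathcal{G}$, outputs a graph $G'$ and an integer $k'$ such that (a) $G$ has a $d$-coc set of size at most $k$ if and only if $G'$ has a $d$-coc set of size at most $k'$; (b) $G'$ is obtained from $G$ by deleting the vertices of some connected components of $G-M$ (so that $M\subseteq V(G')$); (c) $G'-M$ has at most $((d-1)\cdot b+1)\cdot|M|^{b}$ connected components; (d) $k'\le k$. -/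

import Mathlib

namespace COC

/-! ### The model of computation

Programs compute on binary trees (S-expressions). They are the point-free form of while programs
over trees. Every operation is charged the full size of the tree that it is applied to, so that
all intermediate trees, including the result, are no larger than the time used: a Turing machine
that keeps the trees as strings simulates a run with polynomial overhead, a run simulates a Turing
machine with polynomial overhead, and "polynomial time" below is the usual notion. -/

/-- Binary trees, the data on which programs work. -/
inductive Data : Type
  | nil : Data
  | cons : Data → Data → Data

namespace Data

/-- The number of nodes of a tree, leaves included. -/
def size : Data → ℕ
  | nil => 1
  | cons a b => a.size + b.size + 1

def head : Data → Data
  | nil => nil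
  | cons a _ => a

def tail : Data → Data
  | nil => nil
  | cons _ b => b

end Data

/-- Programs. -/
inductive Code : Type
  | id : Code
  | nil : Code
  | head : Code
  | tail : Code
  /-- evaluate both programs on the input and pair the results -/
  | cons (f g : Code) : Code
  /-- first `g`, then `f` -/
  | comp (f g : Code) : Code
  /-- if `c` does not return `nil`, then `f`, else `g` -/
  | cond (c f g : Code) : Code
  /-- while `c` does not return `nil`, replace the current tree by its image under `f` -/
  | loop (c f : Code) : Code

/-- `Runs p x y t`: the program `p` halts on input `x` with output `y` after time exactly `t`. -/
inductive Runs : Code → Data → Data → ℕ → Prop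
  | id (x : Data) : Runs .id x x x.size
  | nil (x : Data) : Runs .nil x .nil x.size
  | head (x : Data) : Runs .head x x.head x.size
  | tail (x : Data) : Runs .tail x x.tail x.size
  | cons {f g : Code} {x y z : Data} {s t : ℕ} :
      Runs f x y s → Runs g x z t → Runs (.cons f g) x (.cons y z) (s + t + x.size)
  | comp {f g : Code} {x y z : Data} {s t : ℕ} :
      Runs g x y s → Runs f y z t → Runs (.comp f g) x z (s + t + x.size)
  | cond_true {c f g : Code} {x a b y : Data} {s t : ℕ} :
      Runs c x (.cons a b) s → Runs f x y t → Runs (.cond c f g) x y (s + t + x.size)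
  | cond_false {c f g : Code} {x y : Data} {s t : ℕ} :
      Runs c x .nil s → Runs g x y t → Runs (.cond c f g) x y (s + t + x.size)
  | loop_step {c f : Code} {x a b y z : Data} {s t u : ℕ} :
      Runs c x (.cons a b) s → Runs f x y t → Runs (.loop c f) y z u →
      Runs (.loop c f) x z (s + t + u + x.size)
  | loop_stop {c f : Code} {x : Data} {s : ℕ} :
      Runs c x .nil s → Runs (.loop c f) x x (s + x.size)

/-- Programs are deterministic: output and running time are determined by the input. -/
theorem Runs.deterministic {p : Code} {x y : Data} {t : ℕ} (h : Runs p x y t) :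
    ∀ {y' : Data} {t' : ℕ}, Runs p x y' t' → y = y' ∧ t = t' := by
  induction h with
  | id x => intro _ _ h; cases h; exact ⟨rfl, rfl⟩
  | nil x => intro _ _ h; cases h; exact ⟨rfl, rfl⟩
  | head x => intro _ _ h; cases h; exact ⟨rfl, rfl⟩
  | tail x => intro _ _ h; cases h; exact ⟨rfl, rfl⟩
  | cons _ _ ih₁ ih₂ =>
    intro _ _ h
    cases h with
    | cons h₁ h₂ =>
      obtain ⟨rfl, rfl⟩ := ih₁ h₁
      obtain ⟨rfl, rfl⟩ := ih₂ h₂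
      exact ⟨rfl, rfl⟩
  | comp _ _ ih₁ ih₂ =>
    intro _ _ h
    cases h with
    | comp h₁ h₂ =>
      obtain ⟨rfl, rfl⟩ := ih₁ h₁
      obtain ⟨rfl, rfl⟩ := ih₂ h₂
      exact ⟨rfl, rfl⟩
  | cond_true _ _ ih₁ ih₂ =>
    intro _ _ h
    cases h with
    | cond_true h₁ h₂ =>
      obtain ⟨_, rfl⟩ := ih₁ h₁
      obtain ⟨rfl, rfl⟩ := ih₂ h₂
      exact ⟨rfl, rfl⟩
    | cond_false h₁ h₂ => cases (ih₁ h₁).1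
  | cond_false _ _ ih₁ ih₂ =>
    intro _ _ h
    cases h with
    | cond_true h₁ h₂ => cases (ih₁ h₁).1
    | cond_false h₁ h₂ =>
      obtain ⟨_, rfl⟩ := ih₁ h₁
      obtain ⟨rfl, rfl⟩ := ih₂ h₂
      exact ⟨rfl, rfl⟩
  | loop_step _ _ _ ih₁ ih₂ ih₃ =>
    intro _ _ h
    cases h with
    | loop_step h₁ h₂ h₃ =>
      obtain ⟨_, rfl⟩ := ih₁ h₁
      obtain ⟨rfl, rfl⟩ := ih₂ h₂
      obtain ⟨rfl, rfl⟩ := ih₃ h₃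
      exact ⟨rfl, rfl⟩
    | loop_stop h₁ => cases (ih₁ h₁).1
  | loop_stop _ ih₁ =>
    intro _ _ h
    cases h with
    | loop_step h₁ h₂ h₃ => cases (ih₁ h₁).1
    | loop_stop h₁ =>
      obtain ⟨_, rfl⟩ := ih₁ h₁
      exact ⟨rfl, rfl⟩

/-- The time bounds the size of the input and of the output. -/
theorem Runs.size_le {p : Code} {x y : Data} {t : ℕ} (h : Runs p x y t) :
    x.size ≤ t ∧ y.size ≤ t := by
  have h1 : ∀ x : Data, 1 ≤ x.size := by intro x; cases x <;> simp [Data.size]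
  induction h with
  | id x => simp
  | nil x => exact ⟨le_rfl, h1 x⟩
  | head x => cases x <;> simp [Data.size, Data.head]; omega
  | tail x => cases x <;> simp [Data.size, Data.tail]; omega
  | @cons f g x y z s t _ _ _ _ => have := h1 x; simp only [Data.size]; omega
  | _ => omega

/-! ### Encodings

Lists are nested pairs, integers are written in binary with a sign, a graph on `{0, …, n - 1}` is
given by its adjacency matrix and a vertex set by its characteristic vector. -/

namespace Data

def ofBool : Bool → Data
  | false => nil
  | true => cons nil nil

def ofList : List Data → Data
  | [] => nil
  | a :: l => cons a (ofList l)

/-- Binary representation, least significant bit first. -/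
def ofNat (n : ℕ) : Data := ofList (n.bits.map ofBool)

def ofInt (k : ℤ) : Data := cons (ofBool (decide (k < 0))) (ofNat k.natAbs)

open Classical in
noncomputable def ofVertexSet {n : ℕ} (M : Set (Fin n)) : Data :=
  ofList (List.ofFn fun i => ofBool (decide (i ∈ M)))

noncomputable def ofGraph {n : ℕ} (G : SimpleGraph (Fin n)) : Data :=
  ofList (List.ofFn fun i => ofVertexSet (G.neighborSet i))

/-- An instance `(G, k)`. -/
noncomputable def ofInstance {n : ℕ} (G : SimpleGraph (Fin n)) (k : ℤ) : Data :=
  cons (ofGraph G) (ofInt k)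

/-- An instance `(G, k, M)`. -/
noncomputable def ofModInstance {n : ℕ} (G : SimpleGraph (Fin n)) (k : ℤ) (M : Set (Fin n)) :
    Data :=
  cons (ofGraph G) (cons (ofInt k) (ofVertexSet M))

end Data

/-! ### Component order connectivity and blocking sets -/

section Graphs

variable {V : Type}

/-- The graph `G - X`. -/
abbrev del (G : SimpleGraph V) (X : Set V) : SimpleGraph ↥(Xᶜ) := G.induce Xᶜ

/-- `S` is a `d`-coc set of the (finite) graph `G`: every connected component of `G - S` has at
most `d` vertices. -/
def IsCocSet (d : ℕ) (G : SimpleGraph V) (S : Set V) : Prop :=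
  ∀ C : (del G S).ConnectedComponent, C.supp.ncard ≤ d

/-- `S` is a `d`-coc set of `G` of minimum size. -/
def IsMinCocSet (d : ℕ) (G : SimpleGraph V) (S : Set V) : Prop :=
  IsCocSet d G S ∧ ∀ T : Set V, IsCocSet d G T → S.ncard ≤ T.ncard

/-- `(G, k)` is a yes-instance of `d`-component order connectivity. -/
def IsYes (d : ℕ) (G : SimpleGraph V) (k : ℤ) : Prop :=
  ∃ S : Set V, IsCocSet d G S ∧ (S.ncard : ℤ) ≤ k

/-- `X` is a `d`-blocking set of `G`. -/
def IsBlocking (d : ℕ) (G : SimpleGraph V) (X : Set V) : Prop :=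
  ¬ ∃ S : Set V, IsMinCocSet d G S ∧ X ⊆ S

/-- `X` is a minimal `d`-blocking set of `G`. -/
def IsMinimalBlocking (d : ℕ) (G : SimpleGraph V) (X : Set V) : Prop :=
  IsBlocking d G X ∧ ∀ Y : Set V, Y ⊂ X → ¬ IsBlocking d G Y

/-- `H` is, when each vertex `w` of `H` is identified with the vertex `φ w` of `G`, the graph
obtained from `G` by deleting (the vertices of) some connected components of `G - M`. -/
def DeletesComponents {W : Type} (G : SimpleGraph V) (M : Set V) (H : SimpleGraph W) (φ : W → V) :
    Prop :=
  Function.Injective φ ∧ H = G.comap φ ∧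
    ∃ D : Set (del G M).ConnectedComponent,
      Set.range φ = {v | ∀ C ∈ D, v ∉ Subtype.val '' C.supp}

end Graphs

/-! ### Graph classes -/

/-- A class of finite graphs, closed under isomorphism. -/
structure GraphClass where
  Mem : ∀ {V : Type} [Finite V], SimpleGraph V → Prop
  iso : ∀ {V W : Type} [Finite V] [Finite W] {G : SimpleGraph V} {H : SimpleGraph W},
    G ≃g H → Mem G → Mem H

namespace GraphClass

/-- Closed under induced subgraphs. -/
def Hereditary (𝒢 : GraphClass) : Prop :=
  ∀ (V : Type) [Finite V] (G : SimpleGraph V), 𝒢.Mem G → ∀ X : Set V, 𝒢.Mem (G.induce X)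

/-- `𝒢` has minimal `d`-blocking sets of size at most `b`. -/
def BlockingSetsBounded (𝒢 : GraphClass) (d b : ℕ) : Prop :=
  ∀ (V : Type) [Finite V] (G : SimpleGraph V), 𝒢.Mem G →
    ∀ X : Set V, IsMinimalBlocking d G X → X.ncard ≤ b

/-- The class `𝒢 + c` of the graphs that have a modulator to `𝒢` of size exactly `c`. -/
def plus (𝒢 : GraphClass) (c : ℕ) : GraphClass where
  Mem {V} _ G := ∃ M : Set V, M.ncard = c ∧ 𝒢.Mem (del G M)
  iso {V W} _ _ {G H} e := by
    rintro ⟨M, hM, h⟩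
    refine ⟨e '' M, by rw [Set.ncard_image_of_injective _ e.injective, hM], 𝒢.iso ?_ h⟩
    exact
      { toEquiv := (e.toEquiv.image Mᶜ).trans
          (Equiv.setCongr (Set.image_compl_eq e.bijective))
        map_rel_iff' := by
          rintro ⟨a, ha⟩ ⟨b, hb⟩
          exact e.map_rel_iff' }

/-- `d`-component order connectivity can be solved in polynomial time on the graphs of `𝒢`: some
program, run on an instance `(G, k)` with `G` in `𝒢` and `k` an integer, halts with the right
answer in time polynomial in the size of the instance. -/
def PolyTimeSolvable (𝒢 : GraphClass) (d : ℕ) : Prop :=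
  ∃ (p : Code) (T : Polynomial ℕ), ∀ (n : ℕ) (G : SimpleGraph (Fin n)) (k : ℤ), 𝒢.Mem G →
    ∃ (answer : Bool) (t : ℕ),
      Runs p (Data.ofInstance G k) (Data.ofBool answer) t ∧
      t ≤ T.eval (Data.ofInstance G k).size ∧
      (answer = true ↔ IsYes d G k)

end GraphClass

end COC

/-!
The reduction rests on conflicts between a modulator `M` and the components of `H = G - M`. Given
which vertices `X` of `M` a solution spares, a component `C` can be solved optimally and separated
from `X` exactly if some minimum solution of `H` contains the neighbors of `X` in `C`, that is, if
these neighbors are not a blocking set. If they are one, then they contain a blocking set of at most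
`b` vertices, and this is already caused by a *chunk* of `b` vertices of `X` (`exists_chunk`; chunks
are lists, so there are `|M| ^ b` of them). Conversely, if a solution spares a chunk that conflicts
with `(d - 1) * b + 1` components, then in one of these components it contains all neighbors of the
chunk, since otherwise a vertex of the chunk would lie in a connected set of `d + 1` vertices
(`exists_nbhd_subset`); there it is not optimal, and the excess vertex pays for adding a vertex of
the chunk to the solution. So components can be deleted, and the budget decreased by the cost of an
optimal solution of them, as soon as each chunk that conflicts with a deleted component has
`(d - 1) * b + 1` remaining components of its own, which conflict only with chunks of the same kind
(`cocOn_delete_iff`).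

Such a structure is found by an auction. The slots are `(d - 1) * b + 1` copies of each chunk. A
component takes a cheapest slot with which it conflicts, raises its price by one and displaces the
previous holder; it gives up if these prices exceed the number of slots. In the end, some price
among `0, …, n`, for `n` slots, does not occur. The slots above this gap are those of the chunks
above; their holders are the components of their own, as the price that a component pays exceeds
the price of each other slot with which it conflicts by at most one (`auction_spec`). The components
that have given up are deleted, and the others are no more than there are slots.

Both hypotheses on the class provide a decision procedure (`IsOracle`) that finds the minimum
solution size of `H` and recognizes the blocking sets: either a clique of `d` new vertices is joined
to the set in question, or this set is deleted. A minimum solution of `H`, found greedily, then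
tells the cost of each component.

The programs are not written down explicitly. `PolyTime` is closed under composition and under
folds over lists with results of polynomial size, and all functions of the reduction, on lists of
truth values, are built in this way.
-/

namespace COC

open Data

/-! ### Functions that are computable in polynomial time -/

/-- Types whose elements are encoded as trees. The encoding need not be injective. -/
class Enc (α : Type) where
  enc : α → Data

open Enc

instance : Enc Data := ⟨fun x => x⟩
instance : Enc Unit := ⟨fun _ => .nil⟩
instance : Enc Bool := ⟨ofBool⟩
instance : Enc ℤ := ⟨ofInt⟩
instance {α β : Type} [Enc α] [Enc β] : Enc (α × β) := ⟨fun x => .cons (enc x.1) (enc x.2)⟩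
instance {α : Type} [Enc α] : Enc (List α) := ⟨fun l => ofList (l.map enc)⟩
instance {α : Type} [Enc α] {P : α → Prop} : Enc {a // P a} := ⟨fun a => enc a.1⟩

variable {α β γ δ σ : Type} [Enc α] [Enc β] [Enc γ] [Enc δ] [Enc σ]

/-- The size of the encoding. -/
def sz {α : Type} [Enc α] (a : α) : ℕ := (enc a).size

theorem sz_pos (a : α) : 1 ≤ sz a := by
  unfold sz; cases enc a <;> simp [Data.size]

@[simp] theorem sz_pair (x : α × β) : sz x = sz x.1 + sz x.2 + 1 := rfl
@[simp] theorem sz_nil : sz ([] : List α) = 1 := rfl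
@[simp] theorem sz_cons (a : α) (l : List α) : sz (a :: l) = sz a + sz l + 1 := rfl
@[simp] theorem enc_pair (x : α × β) : enc x = .cons (enc x.1) (enc x.2) := rfl
@[simp] theorem enc_nil : enc ([] : List α) = .nil := rfl
@[simp] theorem enc_cons (a : α) (l : List α) : enc (a :: l) = .cons (enc a) (enc l) := rfl

theorem eval_mono (T : Polynomial ℕ) {m n : ℕ} (h : m ≤ n) : T.eval m ≤ T.eval n := by
  induction T using Polynomial.induction_on' with
  | add p q hp hq => simpa using add_le_add hp hq
  | monomial k a => simpa using Nat.mul_le_mul_left a (Nat.pow_le_pow_left h k)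

/-- `f` is computed by a program in polynomial time. The type `α` is the set of promised inputs:
nothing is required of the program on trees that do not encode an element of `α`. -/
@[fun_prop]
def PolyTime (f : α → β) : Prop :=
  ∃ (p : Code) (T : Polynomial ℕ), ∀ a, ∃ t, Runs p (enc a) (enc (f a)) t ∧ t ≤ T.eval (sz a)

namespace PolyTime

/-- The running time bounds the size of the output. -/
theorem size_le {f : α → β} (hf : PolyTime f) : ∃ T : Polynomial ℕ, ∀ a, sz (f a) ≤ T.eval (sz a) := by
  obtain ⟨p, T, h⟩ := hf
  refine ⟨T, fun a => ?_⟩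
  obtain ⟨t, h1, h2⟩ := h a
  exact h1.size_le.2.trans h2

/-- Only the encodings of the values matter, not their type. -/
theorem congr_enc {β' : Type} [Enc β'] {f : α → β} {g : α → β'} (hg : PolyTime g)
    (h : ∀ a, enc (f a) = enc (g a)) : PolyTime f := by
  obtain ⟨p, T, hp⟩ := hg
  exact ⟨p, T, fun a => by rw [h]; exact hp a⟩

@[fun_prop]
theorem id' : PolyTime (fun a : α => a) :=
  ⟨.id, .X, fun a => ⟨_, .id _, by simp [sz]⟩⟩

@[fun_prop]
theorem comp {g : β → γ} {f : α → β} (hg : PolyTime g) (hf : PolyTime f) :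
    PolyTime (fun a => g (f a)) := by
  obtain ⟨p, T, hp⟩ := hf
  obtain ⟨q, U, hq⟩ := hg
  refine ⟨.comp q p, T + U.comp T + .X, fun a => ?_⟩
  obtain ⟨t, h1, h2⟩ := hp a
  obtain ⟨u, h3, h4⟩ := hq (f a)
  refine ⟨_, .comp h1 h3, ?_⟩
  have := eval_mono U (h1.size_le.2.trans h2)
  simp only [Polynomial.eval_add, Polynomial.eval_comp, Polynomial.eval_X]
  unfold sz at *
  omega

@[fun_prop]
theorem pair {f : α → β} {g : α → γ} (hf : PolyTime f) (hg : PolyTime g) :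
    PolyTime (fun a => (f a, g a)) := by
  obtain ⟨p, T, hp⟩ := hf
  obtain ⟨q, U, hq⟩ := hg
  refine ⟨.cons p q, T + U + .X, fun a => ?_⟩
  obtain ⟨t, h1, h2⟩ := hp a
  obtain ⟨u, h3, h4⟩ := hq a
  refine ⟨_, .cons h1 h3, ?_⟩
  simp only [Polynomial.eval_add, Polynomial.eval_X]
  unfold sz at *
  omega

theorem const_data (y : Data) : PolyTime (fun _ : α => y) := by
  induction y with
  | nil => exact ⟨.nil, .X, fun a => ⟨_, .nil _, by simp [sz]⟩⟩
  | cons y z hy hz => exact congr_enc (hy.pair hz) fun _ => rfl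

@[fun_prop]
theorem const (b : β) : PolyTime (fun _ : α => b) := congr_enc (const_data (enc b)) fun _ => rfl

theorem head_data : PolyTime Data.head := ⟨.head, .X, fun a => ⟨_, .head _, by simp [sz]⟩⟩
theorem tail_data : PolyTime Data.tail := ⟨.tail, .X, fun a => ⟨_, .tail _, by simp [sz]⟩⟩

theorem fst' : PolyTime (Prod.fst : α × β → α) := by
  obtain ⟨p, T, hp⟩ := head_data
  exact ⟨p, T, fun a => hp (enc a)⟩

theorem snd' : PolyTime (Prod.snd : α × β → β) := by
  obtain ⟨p, T, hp⟩ := tail_data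
  exact ⟨p, T, fun a => hp (enc a)⟩

@[fun_prop]
theorem fst {f : α → β × γ} (hf : PolyTime f) : PolyTime (fun a => (f a).1) := fst'.comp hf

@[fun_prop]
theorem snd {f : α → β × γ} (hf : PolyTime f) : PolyTime (fun a => (f a).2) := snd'.comp hf

@[fun_prop]
theorem list_cons {f : α → β} {g : α → List β} (hf : PolyTime f) (hg : PolyTime g) :
    PolyTime (fun a => f a :: g a) := congr_enc (hf.pair hg) fun _ => rfl

theorem tail' : PolyTime (List.tail : List α → List α) := by
  obtain ⟨p, T, hp⟩ := tail_data
  refine ⟨p, T, fun a => ?_⟩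
  have := hp (enc a)
  cases a <;> exact this

@[fun_prop]
theorem tail {f : α → List β} (hf : PolyTime f) : PolyTime (fun a => (f a).tail) := tail'.comp hf

/-- Case distinction on whether the data that `c` returns are `nil`; the positive case has to be
computed on the inputs of this case only. -/
theorem dite_nil {P : α → Prop} [DecidablePred P] {c : α → β} {f : {a // P a} → γ} {g : α → γ}
    (hc : PolyTime c) (hf : PolyTime f) (hg : PolyTime g) (hP : ∀ a, P a ↔ enc (c a) ≠ .nil) :
    PolyTime (fun a => if h : P a then f ⟨a, h⟩ else g a) := by
  obtain ⟨r, S, hr⟩ := hc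
  obtain ⟨p, T, hp⟩ := hf
  obtain ⟨q, U, hq⟩ := hg
  refine ⟨.cond r p q, S + T + U + .X, fun a => ?_⟩
  obtain ⟨s, h5, h6⟩ := hr a
  obtain ⟨u, h3, h4⟩ := hq a
  simp only [Polynomial.eval_add, Polynomial.eval_X]
  by_cases h : P a
  · rw [dif_pos h]
    obtain ⟨t, h1, h2⟩ := hp ⟨a, h⟩
    rw [hP] at h
    obtain ⟨x, y, hxy⟩ : ∃ x y, enc (c a) = .cons x y := by
      cases hx : enc (c a) with
      | nil => exact absurd hx h
      | cons x y => exact ⟨x, y, rfl⟩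
    rw [hxy] at h5
    refine ⟨_, .cond_true h5 h1, ?_⟩
    change t ≤ T.eval (sz a) at h2
    unfold sz at *
    omega
  · rw [dif_neg h]
    rw [hP, not_not] at h
    rw [h] at h5
    refine ⟨_, .cond_false h5 h3, ?_⟩
    unfold sz at *
    omega

theorem subtype_mk {P : β → Prop} {f : α → β} (hf : PolyTime f) (h : ∀ a, P (f a)) :
    PolyTime (fun a => (⟨f a, h a⟩ : {b // P b})) := congr_enc hf fun _ => rfl

@[fun_prop]
theorem subtype_val {P : β → Prop} {f : α → {b // P b}} (hf : PolyTime f)  :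
    PolyTime (fun a => (f a).1) := congr_enc hf fun _ => rfl

theorem ite_nil {P : α → Prop} [DecidablePred P] {c : α → β} {f g : α → γ} (hc : PolyTime c)
    (hf : PolyTime f) (hg : PolyTime g) (hP : ∀ a, P a ↔ enc (c a) ≠ .nil) :
    PolyTime (fun a => if P a then f a else g a) :=
  dite_nil (f := fun a => f a.1) hc (hf.comp (subtype_val id')) hg hP

@[fun_prop]
theorem cond {c : α → Bool} {f g : α → γ} (hc : PolyTime c) (hf : PolyTime f) (hg : PolyTime g) :
    PolyTime (fun a => bif c a then f a else g a) := by
  have := ite_nil (P := fun a => c a = true) hc hf hg (fun a => by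
    cases h : c a <;> simp [enc, ofBool])
  refine congr_enc this fun a => ?_
  cases h : c a <;> simp

@[fun_prop]
theorem not {c : α → Bool} (hc : PolyTime c) : PolyTime (fun a => !c a) := by
  refine congr_enc (hc.cond (const false) (const true)) fun a => ?_
  cases c a <;> rfl

@[fun_prop]
theorem and {c e : α → Bool} (hc : PolyTime c) (he : PolyTime e) : PolyTime (fun a => c a && e a) := by
  refine congr_enc (hc.cond he (const false)) fun a => ?_
  cases c a <;> rfl

@[fun_prop]
theorem or {c e : α → Bool} (hc : PolyTime c) (he : PolyTime e) : PolyTime (fun a => c a || e a) := by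
  refine congr_enc (hc.cond (const true) he) fun a => ?_
  cases c a <;> rfl

@[fun_prop]
theorem isEmpty {f : α → List β} (hf : PolyTime f) : PolyTime (fun a => (f a).isEmpty) := by
  have := ite_nil (P := fun a => f a ≠ []) hf (const false) (const true) (fun a => by
    cases f a <;> simp)
  refine congr_enc this fun a => ?_
  cases f a <;> simp

/-- The head of a list that is known to be nonempty. -/
theorem head_subtype : PolyTime (fun x : {l : List α // l ≠ []} => x.1.head x.2) := by
  obtain ⟨p, T, hp⟩ := head_data
  refine ⟨p, T, fun a => ?_⟩
  have := hp (enc a)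
  rcases a with ⟨_ | ⟨a, l⟩, h⟩
  · exact absurd rfl h
  · exact this

/-- Case distinction on a list. -/
theorem list_cases {f : α → List β} {g : α → γ} {h : α → β → List β → γ} (hf : PolyTime f)
    (hg : PolyTime g) (hh : PolyTime fun x : α × β × List β => h x.1 x.2.1 x.2.2) :
    PolyTime (fun a => match f a with | [] => g a | b :: l => h a b l) := by
  let F : {a // f a ≠ []} → γ := fun a => h a.1 ((f a.1).head a.2) (f a.1).tail
  have hF : PolyTime F := by
    have h1 : PolyTime fun a : {a // f a ≠ []} => (f a.1).head a.2 :=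
      head_subtype.comp (subtype_mk (f := fun a : {a // f a ≠ []} => f a.1) (by fun_prop)
        fun a => a.2)
    exact hh.comp (f := fun a : {a // f a ≠ []} => (a.1, (f a.1).head a.2, (f a.1).tail))
      (by fun_prop)
  refine congr_enc (dite_nil hf hF hg (fun a => by cases f a <;> simp)) fun a => ?_
  congr 1
  by_cases h0 : f a = []
  · rw [dif_neg (not_not.2 h0)]
    simp only [h0]
  · rw [dif_pos h0]
    obtain ⟨b, l, hl⟩ := List.exists_cons_of_ne_nil h0
    simp only [F, hl, List.head_cons, List.tail_cons]

end PolyTime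

/-- A loop that runs through the trees `s 0, …, s N`, with cost at most `B` for each test and each
step. -/
theorem Runs.loop_of_sequence {c b : Code} {B : ℕ} (N : ℕ) (s : ℕ → Data)
    (hc : ∀ i < N, ∃ x y t, Runs c (s i) (.cons x y) t ∧ t ≤ B)
    (hnil : ∃ t, Runs c (s N) .nil t ∧ t ≤ B)
    (hb : ∀ i < N, ∃ t, Runs b (s i) (s (i + 1)) t ∧ t ≤ B) :
    ∃ t, Runs (.loop c b) (s 0) (s N) t ∧ t ≤ (N + 1) * (3 * B) := by
  induction N generalizing s with
  | zero =>
    obtain ⟨t, h1, h2⟩ := hnil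
    have := h1.size_le.1
    exact ⟨_, Runs.loop_stop h1, by omega⟩
  | succ N ih =>
    obtain ⟨u, h1, h2⟩ := ih (fun i => s (i + 1)) (fun i hi => hc (i + 1) (by omega)) hnil
      (fun i hi => hb (i + 1) (by omega))
    obtain ⟨x, y, v, h3, h4⟩ := hc 0 (by omega)
    obtain ⟨w, h5, h6⟩ := hb 0 (by omega)
    have := h3.size_le.1
    refine ⟨_, .loop_step h3 h5 h1, ?_⟩
    rw [Nat.succ_mul]
    omega

theorem length_lt_sz (l : List α) : l.length < sz l := by
  induction l with
  | nil => simp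
  | cons a l ih => simp; omega

theorem sz_le_of_mem {a : α} {l : List α} (h : a ∈ l) : sz a ≤ sz l := by
  induction l with
  | nil => simp at h
  | cons b l ih =>
    rcases List.mem_cons.1 h with rfl | h
    · simp; omega
    · have := ih h; simp; omega

theorem sz_append (l l' : List α) : sz (l ++ l') + 1 = sz l + sz l' := by
  induction l with
  | nil => simp; omega
  | cons a l ih => simp; omega

theorem sz_le_of_suffix {l l' : List α} (h : l <:+ l') : sz l ≤ sz l' := by
  obtain ⟨k, rfl⟩ := h
  have := sz_append k l
  have := sz_pos k
  omega

theorem sz_reverse (l : List α) : sz l.reverse = sz l := by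
  induction l with
  | nil => rfl
  | cons a l ih =>
    have := sz_append l.reverse [a]
    simp at *; omega

namespace PolyTime

/-- The basic recursion principle: a fold over a list whose intermediate results have polynomial size. -/
theorem foldl_of_take {f : α → List γ} {init : α → σ} {step : α → σ → γ → σ} (hf : PolyTime f)
    (hinit : PolyTime init) (hstep : PolyTime fun x : α × σ × γ => step x.1 x.2.1 x.2.2)
    (P : Polynomial ℕ)
    (hP : ∀ a l, l <+: f a → sz (l.foldl (step a) (init a)) ≤ P.eval (sz a)) :
    PolyTime fun a => (f a).foldl (step a) (init a) := by
  let S := {x : α × σ × List γ // x.2.2 ≠ []}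
  let body : S → α × σ × List γ := fun x =>
    (x.1.1, step x.1.1 x.1.2.1 (x.1.2.2.head x.2), x.1.2.2.tail)
  have hbody : PolyTime body := by
    have h1 : PolyTime fun x : S => x.1.2.2.head x.2 :=
      head_subtype.comp (subtype_mk (f := fun x : S => x.1.2.2) (by fun_prop) fun x => x.2)
    have h2 : PolyTime fun x : S => step x.1.1 x.1.2.1 (x.1.2.2.head x.2) :=
      hstep.comp (f := fun x : S => (x.1.1, x.1.2.1, x.1.2.2.head x.2)) (by fun_prop)
    unfold body
    fun_prop
  have hcont : PolyTime fun x : α × σ × List γ => x.2.2 := by fun_prop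
  have hend : PolyTime fun x : α × σ × List γ => x.2.1 := by fun_prop
  have hstart : PolyTime fun a => (a, init a, f a) := by fun_prop
  obtain ⟨F, hF⟩ := hf.size_le
  obtain ⟨c, Tc, hc⟩ := hcont
  obtain ⟨b, Tb, hb⟩ := hbody
  -- the loop as a function that is defined on its inputs only
  suffices hloop : ∃ (p : Code) (T : Polynomial ℕ), ∀ a, ∃ t,
      Runs p (enc (a, init a, f a)) (enc (a, (f a).foldl (step a) (init a), ([] : List γ))) t ∧
        t ≤ T.eval (sz a) by
    obtain ⟨p, T, hp⟩ := hloop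
    obtain ⟨q, U, hq⟩ := hstart
    have h1 : PolyTime fun a => (a, (f a).foldl (step a) (init a), ([] : List γ)) := by
      refine ⟨.comp p q, U + T + .X, fun a => ?_⟩
      obtain ⟨t, h1, h2⟩ := hp a
      obtain ⟨u, h3, h4⟩ := hq a
      refine ⟨_, .comp h3 h1, ?_⟩
      simp only [Polynomial.eval_add, Polynomial.eval_X]
      unfold sz at *
      omega
    exact hend.comp h1
  refine ⟨.loop c b, F * (3 * ((Tb + Tc).comp (.X + P + F + 2))), fun a => ?_⟩
  let x : ℕ → α × σ × List γ := fun i => (a, ((f a).take i).foldl (step a) (init a), (f a).drop i)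
  have hx : ∀ i, sz (x i) ≤ (Polynomial.X + P + F + 2 : Polynomial ℕ).eval (sz a) := by
    intro i
    have h1 := hP a _ (List.take_prefix i (f a))
    have h2 := sz_le_of_suffix (List.drop_suffix i (f a))
    have h3 := hF a
    simp only [x, sz_pair, Polynomial.eval_add, Polynomial.eval_X, Polynomial.eval_ofNat]
    omega
  have key := Runs.loop_of_sequence (c := c) (b := b)
    (B := ((Tb + Tc).comp (.X + P + F + 2)).eval (sz a)) (f a).length (fun i => enc (x i)) ?_ ?_ ?_
  · obtain ⟨t, h1, h2⟩ := key
    refine ⟨t, ?_, h2.trans ?_⟩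
    · simpa [x] using h1
    · simp only [Polynomial.eval_mul, Polynomial.eval_ofNat]
      exact Nat.mul_le_mul_right _ ((length_lt_sz _).trans_le (hF a))
  · intro i hi
    obtain ⟨t, h1, h2⟩ := hc (x i)
    have h3 : enc (x i).2.2 = .cons (enc (f a)[i]) (enc ((f a).drop (i + 1))) := by
      simp only [x]
      rw [List.drop_eq_getElem_cons hi]
      rfl
    rw [h3] at h1
    refine ⟨_, _, t, h1, h2.trans ?_⟩
    have := eval_mono Tc (hx i)
    simp only [Polynomial.eval_comp, Polynomial.eval_add] at *
    omega
  · obtain ⟨t, h1, h2⟩ := hc (x (f a).length)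
    have h3 : enc (x (f a).length).2.2 = .nil := by simp [x]
    rw [h3] at h1
    refine ⟨t, h1, h2.trans ?_⟩
    have := eval_mono Tc (hx (f a).length)
    simp only [Polynomial.eval_comp, Polynomial.eval_add] at *
    omega
  · intro i hi
    have hne : (x i).2.2 ≠ [] := by simp [x]; omega
    obtain ⟨t, h1, h2⟩ := hb ⟨x i, hne⟩
    have h3 : body ⟨x i, hne⟩ = x (i + 1) := by
      simp only [body, x, List.head_drop, List.tail_drop]
      rw [← List.take_concat_get' _ _ hi, List.foldl_append]
      rfl
    rw [h3] at h1
    refine ⟨t, h1, h2.trans ?_⟩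
    have := eval_mono Tb (hx i)
    simp only [Polynomial.eval_comp, Polynomial.eval_add] at *
    change Tb.eval (sz (x i)) ≤ _
    omega

theorem reverse' : PolyTime (List.reverse : List α → List α) := by
  have h := foldl_of_take (α := List α) (f := fun l => l) (init := fun _ => ([] : List α))
    (step := fun _ s c => c :: s) (by fun_prop) (by fun_prop) (by fun_prop) .X ?_
  · refine congr_enc h fun a => ?_
    simp
  · rintro a l ⟨k, rfl⟩
    have h1 : l.foldl (fun s c => c :: s) [] = l.reverse := by simp
    have := sz_append l k
    have := sz_pos k
    simp [h1, sz_reverse]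
    omega

@[fun_prop]
theorem reverse {f : α → List β} (hf : PolyTime f) : PolyTime fun a => (f a).reverse :=
  reverse'.comp hf

/-- A fold over a list each step of which adds at most a polynomial to a measure `μ` of the
intermediate result that is linearly related to its size. -/
theorem foldl_of_measure {f : α → List γ} {init : α → σ} {step : α → σ → γ → σ} (μ : σ → ℕ) (C : ℕ)
    (hC : ∀ s, sz s ≤ C * μ s + C) (hμ : ∀ s, μ s ≤ sz s) (hf : PolyTime f)
    (hinit : PolyTime init) (hstep : PolyTime fun x : α × σ × γ => step x.1 x.2.1 x.2.2)
    (P : Polynomial ℕ) (hP : ∀ a s c, μ (step a s c) ≤ μ s + P.eval (sz a + sz c)) :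
    PolyTime fun a => (f a).foldl (step a) (init a) := by
  obtain ⟨F, hF⟩ := hf.size_le
  obtain ⟨I, hI⟩ := hinit.size_le
  refine foldl_of_take hf hinit hstep (C * (I + F * P.comp (.X + F)) + C) fun a l hl => ?_
  have hlen : l.length ≤ F.eval (sz a) :=
    hl.length_le.trans ((length_lt_sz _).le.trans (hF a))
  have hmem : ∀ c ∈ l, sz c ≤ F.eval (sz a) := fun c hc => (sz_le_of_mem (hl.subset hc)).trans (hF a)
  have key : ∀ (l : List γ) (s : σ), (∀ c ∈ l, sz c ≤ F.eval (sz a)) →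
      μ (l.foldl (step a) s) ≤ μ s + l.length * P.eval (sz a + F.eval (sz a)) := by
    intro l
    induction l with
    | nil => simp
    | cons c l ih =>
      intro s h
      have h1 := ih (step a s c) fun c hc => h c (List.mem_cons_of_mem _ hc)
      have h2 := hP a s c
      have h3 := eval_mono P (Nat.add_le_add_left (h c (List.mem_cons_self)) (sz a))
      simp only [List.foldl_cons, List.length_cons, Nat.succ_mul]
      omega
  have h1 := key l (init a) hmem
  have h2 := Nat.mul_le_mul_right (P.eval (sz a + F.eval (sz a))) hlen
  have h3 := (hμ (init a)).trans (hI a)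
  refine (hC _).trans ?_
  simp only [Polynomial.eval_add, Polynomial.eval_mul, Polynomial.eval_comp, Polynomial.eval_X,
    Polynomial.eval_natCast, Nat.cast_id]
  gcongr
  omega

/-- Each step of the fold adds at most a polynomial to the size of the result. -/
theorem foldl {f : α → List γ} {init : α → σ} {step : α → σ → γ → σ} (hf : PolyTime f)
    (hinit : PolyTime init) (hstep : PolyTime fun x : α × σ × γ => step x.1 x.2.1 x.2.2)
    (P : Polynomial ℕ) (hP : ∀ a s c, sz (step a s c) ≤ sz s + P.eval (sz a + sz c)) :
    PolyTime fun a => (f a).foldl (step a) (init a) :=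
  foldl_of_measure sz 1 (by intro s; omega) (fun _ => le_rfl) hf hinit hstep P hP

theorem foldr_of_drop {f : α → List γ} {init : α → σ} {step : α → γ → σ → σ} (hf : PolyTime f)
    (hinit : PolyTime init) (hstep : PolyTime fun x : α × γ × σ => step x.1 x.2.1 x.2.2)
    (P : Polynomial ℕ)
    (hP : ∀ a l, l <:+ f a → sz (l.foldr (step a) (init a)) ≤ P.eval (sz a)) :
    PolyTime fun a => (f a).foldr (step a) (init a) := by
  have h := foldl_of_take (f := fun a => (f a).reverse) (init := init)
    (step := fun a s c => step a c s) (by fun_prop) hinit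
    (hstep.comp (f := fun x : α × σ × γ => (x.1, x.2.2, x.2.1)) (by fun_prop)) P ?_
  · simpa only [List.foldl_reverse] using h
  · intro a l hl
    have := hP a l.reverse (by rwa [← List.reverse_prefix, List.reverse_reverse])
    rwa [List.foldr_reverse] at this

theorem foldr_of_measure {f : α → List γ} {init : α → σ} {step : α → γ → σ → σ} (μ : σ → ℕ) (C : ℕ)
    (hC : ∀ s, sz s ≤ C * μ s + C) (hμ : ∀ s, μ s ≤ sz s) (hf : PolyTime f)
    (hinit : PolyTime init) (hstep : PolyTime fun x : α × γ × σ => step x.1 x.2.1 x.2.2)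
    (P : Polynomial ℕ) (hP : ∀ a c s, μ (step a c s) ≤ μ s + P.eval (sz a + sz c)) :
    PolyTime fun a => (f a).foldr (step a) (init a) := by
  have h := foldl_of_measure (f := fun a => (f a).reverse) (init := init)
    (step := fun a s c => step a c s) μ C hC hμ (by fun_prop) hinit
    (hstep.comp (f := fun x : α × σ × γ => (x.1, x.2.2, x.2.1)) (by fun_prop)) P
    (fun a s c => hP a c s)
  simpa only [List.foldl_reverse] using h

theorem foldr {f : α → List γ} {init : α → σ} {step : α → γ → σ → σ} (hf : PolyTime f)
    (hinit : PolyTime init) (hstep : PolyTime fun x : α × γ × σ => step x.1 x.2.1 x.2.2)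
    (P : Polynomial ℕ) (hP : ∀ a c s, sz (step a c s) ≤ sz s + P.eval (sz a + sz c)) :
    PolyTime fun a => (f a).foldr (step a) (init a) :=
  foldr_of_measure sz 1 (by intro s; omega) (fun _ => le_rfl) hf hinit hstep P hP

@[fun_prop]
theorem append {f g : α → List β} (hf : PolyTime f) (hg : PolyTime g) :
    PolyTime fun a => f a ++ g a := by
  have := foldr (step := fun _ c s => c :: s) hf hg (by fun_prop) (.X + 1) ?_
  · simpa using this
  · intro a c s
    simp; omega

@[fun_prop]
theorem map {f : α → List γ} {g : α → γ → δ} (hf : PolyTime f)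
    (hg : PolyTime fun x : α × γ => g x.1 x.2) : PolyTime fun a => (f a).map (g a) := by
  obtain ⟨T, hT⟩ := hg.size_le
  have := foldr (step := fun a c s => g a c :: s) hf (const ([] : List δ)) ?_
    (T.comp (.X + 1) + 1) ?_
  · simpa [List.foldr_cons_eq_append] using this
  · have := hg.comp (f := fun x : α × γ × List δ => (x.1, x.2.1)) (by fun_prop)
    fun_prop
  · intro a c s
    have := hT (a, c)
    simp at *; omega

@[fun_prop]
theorem flatten {f : α → List (List β)} (hf : PolyTime f) : PolyTime fun a => (f a).flatten := by
  have := foldr (step := fun _ c s => c ++ s) hf (const ([] : List β)) (by fun_prop) .X ?_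
  · refine congr_enc this fun a => ?_
    congr 1
    induction f a <;> simp_all
  · intro a c s
    have := sz_append c s
    simp; omega

@[fun_prop]
theorem flatMap {f : α → List γ} {g : α → γ → List δ} (hf : PolyTime f)
    (hg : PolyTime fun x : α × γ => g x.1 x.2) : PolyTime fun a => (f a).flatMap (g a) :=
  flatten (map hf hg)

@[fun_prop]
theorem any {f : α → List γ} {g : α → γ → Bool} (hf : PolyTime f)
    (hg : PolyTime fun x : α × γ => g x.1 x.2) : PolyTime fun a => (f a).any (g a) := by
  have := foldr (step := fun a c s => g a c || s) hf (const false) ?_ 3 ?_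
  · refine congr_enc this fun a => ?_
    congr 1
    induction f a <;> simp_all
  · have := hg.comp (f := fun x : α × γ × Bool => (x.1, x.2.1)) (by fun_prop)
    fun_prop
  · intro a c s
    have : ∀ b : Bool, sz b ≤ 3 := by decide
    have := this (g a c || s)
    simp; omega

theorem zip' : PolyTime fun x : List α × List β => x.1.zip x.2 := by
  let step : List (α × β) × List β → α → List (α × β) × List β := fun s c =>
    match s.2 with
    | [] => s
    | b :: l => ((c, b) :: s.1, l)
  have key : ∀ (l : List α) (l' : List β) (acc : List (α × β)),
      l.foldl step (acc, l') = ((l.zip l').reverse ++ acc, l'.drop l.length) := by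
    intro l
    induction l with
    | nil => simp
    | cons a l ih => intro l' acc; cases l' <;> simp [step, ih]
  have hstep : PolyTime fun x : (List α × List β) × (List (α × β) × List β) × α =>
      step x.2.1 x.2.2 :=
    list_cases (f := fun x : (List α × List β) × (List (α × β) × List β) × α => x.2.1.2)
      (g := fun x => x.2.1) (h := fun x b l => ((x.2.2, b) :: x.2.1.1, l))
      (by fun_prop) (by fun_prop) (by fun_prop)
  have := foldl (f := fun x : List α × List β => x.1) (init := fun x => ([], x.2))
    (step := fun _ => step) (by fun_prop) (by fun_prop) hstep (.X + 2) ?_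
  · have h : PolyTime fun x : List α × List β => (x.1.foldl step ([], x.2)).1.reverse := by fun_prop
    refine congr_enc h fun x => ?_
    simp [key]
  · rintro a ⟨s, _ | ⟨b, l⟩⟩ c
    · simp [step]
    · simp [step]; omega

@[fun_prop]
theorem zip {f : α → List β} {g : α → List γ} (hf : PolyTime f) (hg : PolyTime g) :
    PolyTime fun a => (f a).zip (g a) := zip'.comp (hf.pair hg)

end PolyTime

/-! ### Arithmetic in binary -/

theorem sz_bool (b : Bool) : sz b ≤ 3 := by revert b; decide

theorem sz_bools_le (l : List Bool) : sz l ≤ 4 * l.length + 1 := by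
  induction l with
  | nil => simp
  | cons b l ih => have := sz_bool b; simp; omega

instance : Enc ℕ := ⟨ofNat⟩

/-- The successor of a number that is given by its binary digits. -/
def incBits : List Bool → List Bool
  | [] => [true]
  | false :: l => true :: l
  | true :: l => false :: incBits l

/-- The predecessor of a number that is given by its binary digits, without leading zeros. -/
def decBits : List Bool → List Bool
  | [] => []
  | false :: l => true :: decBits l
  | true :: l => bif l.isEmpty then [] else false :: l

theorem length_incBits_le (l : List Bool) : (incBits l).length ≤ l.length + 1 := by
  fun_induction incBits l <;> simp_all

theorem length_decBits_le (l : List Bool) : (decBits l).length ≤ l.length := by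
  induction l with
  | nil => simp [decBits]
  | cons b l ih =>
    cases b
    · simpa [decBits]
    · cases l <;> simp [decBits]

theorem bits_succ (n : ℕ) : (n + 1).bits = incBits n.bits := by
  induction n using Nat.binaryRec' with
  | zero => rfl
  | bit b n h ih =>
    rw [Nat.bits_append_bit n b h]
    cases b with
    | false =>
      have : Nat.bit false n + 1 = Nat.bit true n := by simp [Nat.bit]
      rw [this, Nat.bits_append_bit n true (by simp)]
      rfl
    | true =>
      have : Nat.bit true n + 1 = Nat.bit false (n + 1) := by simp [Nat.bit]; omega
      rw [this, Nat.bits_append_bit (n + 1) false (by simp), ih]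
      rfl

theorem decBits_bits (n : ℕ) : decBits (n + 1).bits = n.bits := by
  induction n using Nat.binaryRec' with
  | zero => rfl
  | bit b n h ih =>
    cases b with
    | false =>
      have h1 : Nat.bit false n + 1 = Nat.bit true n := by simp [Nat.bit]
      rw [h1, Nat.bits_append_bit n true (by simp)]
      rw [Nat.bits_append_bit n false h]
      have : n.bits.isEmpty = false := by
        cases n with
        | zero => simp at h
        | succ n => rw [bits_succ]; cases n.bits with
          | nil => rfl
          | cons b l => cases b <;> rfl
      simp [decBits, this]
    | true =>
      have : Nat.bit true n + 1 = Nat.bit false (n + 1) := by simp [Nat.bit]; omega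
      rw [this, Nat.bits_append_bit (n + 1) false (by simp), Nat.bits_append_bit n true h, decBits, ih]

namespace PolyTime

/-- A recursion over the digits whose step depends on the value for the remaining digits and on
these digits themselves. -/
theorem bits_fold (step : Bool → List Bool × List Bool → List Bool) (init : List Bool)
    (hstep : PolyTime fun x : List Bool × Bool × (List Bool × List Bool) => step x.2.1 x.2.2)
    (h : ∀ b s, (step b s).length ≤ max s.1.length s.2.length + 1) :
    PolyTime fun l : List Bool =>
      l.foldr (fun b s => (step b s, b :: s.2)) (init, ([] : List Bool)) := by
  refine foldr_of_measure (f := fun l => l) (init := fun _ => (init, []))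
    (step := fun _ b s => (step b s, b :: s.2)) (fun s => max s.1.length s.2.length) 8 ?_ ?_
    id' (const _) (hstep.pair (by fun_prop)) 1 ?_
  · rintro ⟨s, t⟩
    have := sz_bools_le s
    have := sz_bools_le t
    simp only [sz_pair]
    omega
  · rintro ⟨s, t⟩
    have := length_lt_sz s
    have := length_lt_sz t
    simp only [sz_pair]
    omega
  · intro a b s
    have := h b s
    simp; omega

theorem incBits' : PolyTime incBits := by
  have h := bits_fold (fun b s => bif b then false :: s.1 else true :: s.2) [true]
    (by fun_prop) (by rintro (_ | _) s <;> simp)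
  refine congr_enc (fst'.comp h) fun l => ?_
  congr 1
  have : l.foldr (fun b s => (bif b then false :: s.1 else true :: s.2, b :: s.2)) ([true], [])
      = (incBits l, l) := by
    induction l with
    | nil => rfl
    | cons b l ih => rw [List.foldr_cons, ih]; cases b <;> rfl
  rw [this]

theorem decBits' : PolyTime decBits := by
  have h := bits_fold
    (fun b s => bif b then (bif s.2.isEmpty then [] else false :: s.2) else true :: s.1) []
    (by fun_prop) (by
      rintro (_ | _) ⟨s, t⟩
      · simp
      · cases t <;> simp)
  refine congr_enc (fst'.comp h) fun l => ?_
  congr 1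
  have : l.foldr (fun b s => ((bif b then (bif s.2.isEmpty then [] else false :: s.2)
      else true :: s.1 : List Bool), b :: s.2)) ([], []) = (decBits l, l) := by
    induction l with
    | nil => rfl
    | cons b l ih => rw [List.foldr_cons, ih]; cases b <;> rfl
  rw [this]

@[fun_prop]
theorem nat_succ {f : α → ℕ} (hf : PolyTime f) : PolyTime fun a => f a + 1 := by
  have h1 : PolyTime Nat.bits := congr_enc id' fun _ => rfl
  refine congr_enc (incBits'.comp (h1.comp hf)) fun a => ?_
  change ofList _ = ofList _
  rw [bits_succ]
  rfl

@[fun_prop]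
theorem int_cast {f : α → ℕ} (hf : PolyTime f) : PolyTime fun a => (f a : ℤ) :=
  congr_enc ((const false).pair hf) fun _ => rfl

@[fun_prop]
theorem int_pred {f : α → ℤ} (hf : PolyTime f) : PolyTime fun a => f a - 1 := by
  have h0 : PolyTime fun k : ℤ => (decide (k < 0), k.natAbs.bits) := congr_enc id' fun _ => rfl
  have h1 : PolyTime fun k : ℤ => bif decide (k < 0) then (true, incBits k.natAbs.bits) else
      bif k.natAbs.bits.isEmpty then (true, [true]) else (false, decBits k.natAbs.bits) := by
    have h2 : PolyTime fun x : Bool × List Bool => bif x.1 then (true, incBits x.2) else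
        bif x.2.isEmpty then (true, [true]) else (false, decBits x.2) := by
      have := incBits'
      have := decBits'
      fun_prop
    exact h2.comp h0
  refine congr_enc (h1.comp hf) fun a => ?_
  generalize f a = k
  have key : ∀ (b : Bool) (m : ℕ), decide (k - 1 < 0) = b → (k - 1).natAbs = m →
      enc (k - 1) = enc (b, m.bits) := by
    rintro _ _ rfl rfl
    rfl
  rcases lt_trichotomy k 0 with h | rfl | h
  · rw [key true (k.natAbs + 1) (by simp; omega) (by omega), bits_succ]
    simp [h]
  · rfl
  · obtain ⟨n, rfl⟩ : ∃ n : ℕ, k = n + 1 := ⟨(k - 1).toNat, by omega⟩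
    have h3 : ((n : ℤ) + 1).natAbs = n + 1 := by omega
    rw [key false n (by simp) (by simp), h3, decBits_bits, decide_eq_false (by omega)]
    have : (n + 1).bits.isEmpty = false := by
      rw [bits_succ]; cases n.bits with
        | nil => rfl
        | cons b l => cases b <;> rfl
    simp [this]

theorem length_bits_succ_le (n : ℕ) : (n + 1).bits.length ≤ n.bits.length + 1 := by
  rw [bits_succ]; exact length_incBits_le _

/-- Counting down once for every `true` in a list. -/
@[fun_prop]
theorem int_sub_count {f : α → ℤ} {g : α → List Bool} (hf : PolyTime f) (hg : PolyTime g) :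
    PolyTime fun a => f a - (g a).count true := by
  have h := foldl_of_measure (f := g) (init := f) (step := fun _ k b => bif b then k - 1 else k)
    (fun k => k.natAbs.bits.length) 5 ?_ ?_ hg hf (by fun_prop) 1 ?_
  · refine congr_enc h fun a => ?_
    congr 1
    generalize f a = k
    generalize g a = l
    induction l generalizing k with
    | nil => simp
    | cons b l ih =>
      cases b
      · simp [← ih]
      · simp [← ih]; ring
  · intro k
    have h1 : sz k = sz (decide (k < 0)) + sz k.natAbs.bits + 1 := rfl
    have := sz_bools_le k.natAbs.bits
    have := sz_bool (decide (k < 0))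
    omega
  · intro k
    have h1 : sz k = sz (decide (k < 0)) + sz k.natAbs.bits + 1 := rfl
    have := length_lt_sz k.natAbs.bits
    omega
  · rintro a k (_ | _)
    · simp
    · simp only [cond_true, Polynomial.eval_one]
      by_cases h : k ≤ 0
      · have : (k - 1).natAbs = k.natAbs + 1 := by omega
        rw [this]
        exact length_bits_succ_le _
      · have : k.natAbs = (k - 1).natAbs + 1 := by omega
        rw [this, ← decBits_bits (k - 1).natAbs]
        exact (length_decBits_le _).trans (by omega)

/-- A fold whose intermediate results are lists of truth values that do not become longer. -/
theorem foldl_bools {f : α → List γ} {init : α → List Bool} {step : α → List Bool → γ → List Bool}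
    (hf : PolyTime f) (hinit : PolyTime init)
    (hstep : PolyTime fun x : α × List Bool × γ => step x.1 x.2.1 x.2.2)
    (h : ∀ a s c, (step a s c).length ≤ s.length) :
    PolyTime fun a => (f a).foldl (step a) (init a) :=
  foldl_of_measure List.length 4 (fun s => (sz_bools_le s).trans (by omega))
    (fun s => (length_lt_sz s).le) hf hinit hstep 0 (by simpa using h)

end PolyTime

/-! ### Connected sets and component order connectivity -/

section ConnectedSets

variable {V W : Type}

/-- `P` is connected in `G` (or empty), stated by cuts: a set that meets `P` and that no edge of
`G[P]` leaves contains `P`. -/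
def ConnOn (G : SimpleGraph V) (P : Set V) : Prop :=
  ∀ Q : Set V, (P ∩ Q).Nonempty → (∀ x ∈ P ∩ Q, ∀ y ∈ P, G.Adj x y → y ∈ Q) → P ⊆ Q

theorem connOn_image (G : SimpleGraph V) {φ : W → V} (hφ : φ.Injective) (P : Set W) :
    ConnOn G (φ '' P) ↔ ConnOn (G.comap φ) P := by
  constructor
  · rintro h Q ⟨x, hx, hxQ⟩ hQ y hy
    have := h (φ '' Q) ⟨φ x, ⟨x, hx, rfl⟩, ⟨x, hxQ, rfl⟩⟩ ?_ ⟨y, hy, rfl⟩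
    · obtain ⟨z, hz, hzy⟩ := this
      rwa [← hφ hzy]
    · rintro _ ⟨⟨u, hu, rfl⟩, ⟨u', hu', he⟩⟩ _ ⟨w, hw, rfl⟩ hadj
      rw [hφ he] at hu'
      exact ⟨w, hQ u ⟨hu, hu'⟩ w hw hadj, rfl⟩
  · rintro h Q ⟨_, ⟨x, hx, rfl⟩, hxQ⟩ hQ _ ⟨y, hy, rfl⟩
    exact h (φ ⁻¹' Q) ⟨x, hx, hxQ⟩ (fun u hu w hw hadj => hQ (φ u) ⟨⟨u, hu.1, rfl⟩, hu.2⟩ (φ w)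
      ⟨w, hw, rfl⟩ hadj) hy

/-- The vertex set of a connected component of `G - M`, as a set of vertices of `G`. -/
def compSet {G : SimpleGraph V} {M : Set V} (c : (del G M).ConnectedComponent) : Set V :=
  Subtype.val '' c.supp

variable {G : SimpleGraph V} {M : Set V}

theorem mem_compSet {c : (del G M).ConnectedComponent} {v : V} :
    v ∈ compSet c ↔ ∃ h : v ∈ Mᶜ, (del G M).connectedComponentMk ⟨v, h⟩ = c := by
  simp [compSet, SimpleGraph.ConnectedComponent.supp]

theorem compSet_nonempty (c : (del G M).ConnectedComponent) : (compSet c).Nonempty := by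
  induction c using SimpleGraph.ConnectedComponent.ind with
  | h v => exact ⟨v, mem_compSet.2 ⟨v.2, rfl⟩⟩

theorem compSet_subset (c : (del G M).ConnectedComponent) : compSet c ⊆ Mᶜ := by
  intro v hv
  exact (mem_compSet.1 hv).1

theorem eq_of_mem_compSet {c c' : (del G M).ConnectedComponent} {v : V} (h : v ∈ compSet c)
    (h' : v ∈ compSet c') : c = c' := by
  obtain ⟨_, rfl⟩ := mem_compSet.1 h
  obtain ⟨_, rfl⟩ := mem_compSet.1 h'
  rfl

theorem compSet_closed {c : (del G M).ConnectedComponent} {v w : V} (h : v ∈ compSet c)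
    (hw : w ∉ M) (hadj : G.Adj v w) : w ∈ compSet c := by
  obtain ⟨hv, rfl⟩ := mem_compSet.1 h
  refine mem_compSet.2 ⟨hw, ?_⟩
  apply SimpleGraph.ConnectedComponent.connectedComponentMk_eq_of_adj
  exact hadj.symm

theorem connOn_compSet (c : (del G M).ConnectedComponent) : ConnOn G (compSet c) := by
  rintro Q ⟨x, hx, hxQ⟩ hQ y hy
  obtain ⟨hxM, rfl⟩ := mem_compSet.1 hx
  obtain ⟨hyM, hyc⟩ := mem_compSet.1 hy
  have hr : (del G M).Reachable ⟨x, hxM⟩ ⟨y, hyM⟩ :=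
    (SimpleGraph.ConnectedComponent.exact hyc).symm
  rw [SimpleGraph.reachable_iff_reflTransGen] at hr
  suffices ∀ z : ↥(Mᶜ), Relation.ReflTransGen (del G M).Adj ⟨x, hxM⟩ z →
      z.1 ∈ compSet ((del G M).connectedComponentMk ⟨x, hxM⟩) ∩ Q from (this _ hr).2
  intro z hz
  induction hz with
  | refl => exact ⟨hx, hxQ⟩
  | @tail u w _ huw ih =>
    have hw := compSet_closed ih.1 w.2 huw
    exact ⟨hw, hQ _ ih _ hw huw⟩

/-- A connected set of `G - M` lies in the component of each of its vertices. -/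
theorem ConnOn.subset_compSet {P : Set V} (hP : ConnOn G P) (hPM : P ⊆ Mᶜ)
    {c : (del G M).ConnectedComponent} {v : V} (hvP : v ∈ P) (hv : v ∈ compSet c) :
    P ⊆ compSet c :=
  hP _ ⟨v, hvP, hv⟩ fun _ hx _ hy hadj => compSet_closed hx.2 (hPM hy) hadj

end ConnectedSets

section Regions

variable {V W : Type} {d : ℕ} {G : SimpleGraph V}

/-- `S` is a `d`-coc set of `G[A]`; elements of `S` outside `A` are ignored. -/
def CocOn (d : ℕ) (G : SimpleGraph V) (A S : Set V) : Prop :=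
  ∀ P ⊆ A \ S, ConnOn G P → P.ncard ≤ d

/-- The solutions in terms of connected sets instead of components, which carries over to induced
subgraphs without further ado. -/
theorem isCocSet_iff [Finite V] {S : Set V} : IsCocSet d G S ↔ CocOn d G Set.univ S := by
  constructor
  · intro h P hP hconn
    obtain rfl | ⟨v, hv⟩ := P.eq_empty_or_nonempty
    · simp
    · have hPS : P ⊆ Sᶜ := fun x hx => (hP hx).2
      let c := (del G S).connectedComponentMk ⟨v, hPS hv⟩
      have := hconn.subset_compSet (c := c) hPS hv (mem_compSet.2 ⟨hPS hv, rfl⟩)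
      calc P.ncard ≤ (compSet c).ncard := Set.ncard_le_ncard this
        _ = c.supp.ncard := Set.ncard_image_of_injective _ Subtype.val_injective
        _ ≤ d := h c
  · intro h c
    have := h (compSet c) (fun v hv => ⟨trivial, compSet_subset c hv⟩) (connOn_compSet c)
    rwa [compSet, Set.ncard_image_of_injective _ Subtype.val_injective] at this

theorem cocOn_comap {φ : W → V} (hφ : φ.Injective) {A S : Set W} :
    CocOn d (G.comap φ) A S ↔ CocOn d G (φ '' A) (φ '' S) := by
  constructor
  · intro h P hP hconn
    obtain ⟨P, rfl⟩ : ∃ P', P = φ '' P' := by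
      refine ⟨φ ⁻¹' P, (Set.image_preimage_eq_of_subset ?_).symm⟩
      intro x hx
      obtain ⟨y, _, rfl⟩ := (hP hx).1
      exact ⟨y, rfl⟩
    rw [← Set.image_sdiff hφ, Set.image_subset_image_iff hφ] at hP
    rw [Set.ncard_image_of_injective _ hφ]
    exact h P hP ((connOn_image G hφ P).1 hconn)
  · intro h P hP hconn
    rw [← Set.ncard_image_of_injective P hφ]
    refine h _ ?_ ((connOn_image G hφ P).2 hconn)
    rw [← Set.image_sdiff hφ]
    exact Set.image_mono hP

theorem CocOn.mono {A A' S S' : Set V} (h : CocOn d G A S) (h' : A' \ S' ⊆ A \ S) :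
    CocOn d G A' S' := fun P hP hc => h P (hP.trans h') hc

theorem isYes_comap [Finite W] {φ : W → V} (hφ : φ.Injective) {k : ℤ} :
    IsYes d (G.comap φ) k ↔
      ∃ S ⊆ Set.range φ, CocOn d G (Set.range φ) S ∧ (S.ncard : ℤ) ≤ k := by
  constructor
  · rintro ⟨S, hS, hk⟩
    refine ⟨φ '' S, Set.image_subset_range _ _, ?_, ?_⟩
    · rw [← Set.image_univ, ← cocOn_comap hφ]
      exact isCocSet_iff.1 hS
    · rwa [Set.ncard_image_of_injective _ hφ]
  · rintro ⟨S, hSφ, hS, hk⟩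
    obtain ⟨S, rfl⟩ := Set.subset_range_iff_exists_image_eq.1 hSφ
    refine ⟨S, ?_, ?_⟩
    · rwa [isCocSet_iff, cocOn_comap hφ, Set.image_univ]
    · rwa [Set.ncard_image_of_injective _ hφ] at hk

theorem isYes_iff [Finite V] {k : ℤ} :
    IsYes d G k ↔ ∃ S : Set V, CocOn d G Set.univ S ∧ (S.ncard : ℤ) ≤ k := by
  simp only [IsYes, isCocSet_iff]

/-- `S` is a `d`-coc set of `G[A]` of minimum size. -/
def MinCocOn (d : ℕ) (G : SimpleGraph V) (A S : Set V) : Prop :=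
  S ⊆ A ∧ CocOn d G A S ∧ ∀ T ⊆ A, CocOn d G A T → S.ncard ≤ T.ncard

theorem minCocOn_comap [Finite W] {φ : W → V} (hφ : φ.Injective) {S : Set W} :
    IsMinCocSet d (G.comap φ) S ↔ MinCocOn d G (Set.range φ) (φ '' S) := by
  simp only [IsMinCocSet, MinCocOn, isCocSet_iff, cocOn_comap hφ, Set.image_univ,
    Set.image_subset_range, true_and, Set.forall_subset_range_iff,
    Set.ncard_image_of_injective _ hφ]

theorem exists_minCocOn [Finite V] (A : Set V) : ∃ S, MinCocOn d G A S := by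
  let 𝒮 : Set (Set V) := {S | S ⊆ A ∧ CocOn d G A S}
  have hne : 𝒮.Nonempty := ⟨A, subset_rfl, fun P hP _ => by
    rw [sdiff_self] at hP
    rw [Set.subset_empty_iff.1 hP]
    simp⟩
  obtain ⟨S, hS, hmin⟩ := Set.exists_min_image 𝒮 Set.ncard 𝒮.toFinite hne
  exact ⟨S, hS.1, hS.2, fun T hT hT' => hmin T ⟨hT, hT'⟩⟩

/-- Some minimum `d`-coc set of `G[A]` contains `X`. -/
def Extendable (d : ℕ) (G : SimpleGraph V) (A X : Set V) : Prop :=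
  ∃ S, MinCocOn d G A S ∧ X ⊆ S

theorem Extendable.mono {A X Y : Set V} (h : Extendable d G A X) (hYX : Y ⊆ X) :
    Extendable d G A Y := by
  obtain ⟨S, hS, hX⟩ := h
  exact ⟨S, hS, hYX.trans hX⟩

theorem isBlocking_comap [Finite W] {φ : W → V} (hφ : φ.Injective) {X : Set W} :
    IsBlocking d (G.comap φ) X ↔ ¬ Extendable d G (Set.range φ) (φ '' X) := by
  unfold IsBlocking Extendable
  rw [not_iff_not]
  constructor
  · rintro ⟨S, hS, hX⟩
    exact ⟨φ '' S, (minCocOn_comap hφ).1 hS, Set.image_mono hX⟩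
  · rintro ⟨S, hS, hX⟩
    obtain ⟨S, rfl⟩ := Set.subset_range_iff_exists_image_eq.1 hS.1
    exact ⟨S, (minCocOn_comap hφ).2 hS, (Set.image_subset_image_iff hφ).1 hX⟩

/-- A bound on the minimal blocking sets of `G - M` gives small blocking subsets. -/
theorem exists_small_blocking [Finite V] {M : Set V} {b : ℕ}
    (h : ∀ X : Set ↥(Mᶜ), IsMinimalBlocking d (del G M) X → X.ncard ≤ b) {X : Set V} (hXM : X ⊆ Mᶜ)
    (hX : ¬ Extendable d G Mᶜ X) : ∃ Y ⊆ X, ¬ Extendable d G Mᶜ Y ∧ Y.ncard ≤ b := by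
  have key : ∀ Y : Set ↥(Mᶜ), IsBlocking d (del G M) Y ↔
      ¬ Extendable d G Mᶜ (Subtype.val '' Y) := fun Y => by
    have := isBlocking_comap (d := d) (G := G) (X := Y) Subtype.val_injective
    rwa [Subtype.range_val] at this
  obtain ⟨X, rfl⟩ : ∃ X' : Set ↥(Mᶜ), Subtype.val '' X' = X :=
    Set.subset_range_iff_exists_image_eq.1 (by rwa [Subtype.range_val])
  obtain ⟨Y, ⟨hYX, hY⟩, hmin⟩ := Set.exists_min_image
    {Y : Set ↥(Mᶜ) | Y ⊆ X ∧ IsBlocking d (del G M) Y} Set.ncard (Set.toFinite _)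
    ⟨X, subset_rfl, (key X).2 hX⟩
  refine ⟨Subtype.val '' Y, Set.image_mono hYX, (key Y).1 hY, ?_⟩
  rw [Set.ncard_image_of_injective _ Subtype.val_injective]
  refine h Y ⟨hY, fun Z hZ hZb => ?_⟩
  exact (Set.ncard_lt_ncard hZ).not_ge (hmin Z ⟨hZ.subset.trans hYX, hZb⟩)

end Regions

/-! ### Correctness of the deletion of components -/

section Components

variable {V : Type} {d b : ℕ} {G : SimpleGraph V} {M : Set V}

/-- The vertices that have a neighbor in the list `f`. -/
def nbhd (G : SimpleGraph V) (f : List V) : Set V := {w | ∃ v ∈ f, G.Adj v w}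

theorem ncard_inter_components [Finite V] (K : Finset (del G M).ConnectedComponent) (A : Set V) :
    (A ∩ ⋃ c ∈ K, compSet c).ncard = ∑ c ∈ K, (A ∩ compSet c).ncard := by
  classical
  induction K using Finset.induction_on with
  | empty => simp
  | insert c K hc ih =>
    rw [Finset.sum_insert hc, ← ih, Finset.set_biUnion_insert, Set.inter_union_distrib_left,
      Set.ncard_union_eq]
    rw [Set.disjoint_left]
    rintro x ⟨_, hx⟩ ⟨_, hx'⟩
    simp only [Set.mem_iUnion] at hx'
    obtain ⟨c', hc', hx'⟩ := hx'
    exact hc (eq_of_mem_compSet hx hx' ▸ hc')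

theorem cocOn_compl_iff {S : Set V} :
    CocOn d G Mᶜ S ↔ ∀ c : (del G M).ConnectedComponent, CocOn d G (compSet c) S := by
  constructor
  · exact fun h c => h.mono (Set.sdiff_subset_sdiff_left (compSet_subset c))
  · intro h P hP hconn
    obtain rfl | ⟨v, hv⟩ := P.eq_empty_or_nonempty
    · simp
    · have hPM : P ⊆ Mᶜ := fun x hx => (hP hx).1
      have := hconn.subset_compSet (c := (del G M).connectedComponentMk ⟨v, hPM hv⟩) hPM hv
        (mem_compSet.2 ⟨_, rfl⟩)
      exact h _ P (fun x hx => ⟨this hx, (hP hx).2⟩) hconn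

/-- A minimum solution is minimum in each component, and minimum solutions of a component can be
completed to minimum solutions. -/
theorem MinCocOn.component [Finite V] {S T : Set V} (hS : MinCocOn d G Mᶜ S)
    (c : (del G M).ConnectedComponent) (hT : CocOn d G (compSet c) T) :
    (S ∩ compSet c).ncard ≤ (T ∩ compSet c).ncard ∧
      ((T ∩ compSet c).ncard ≤ (S ∩ compSet c).ncard → Extendable d G Mᶜ (T ∩ compSet c)) := by
  let R := (S \ compSet c) ∪ (T ∩ compSet c)
  have hRM : R ⊆ Mᶜ := Set.union_subset (Set.sdiff_subset.trans hS.1)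
    (Set.inter_subset_right.trans (compSet_subset c))
  have hR : CocOn d G Mᶜ R := by
    rw [cocOn_compl_iff]
    intro c'
    by_cases hc : c' = c
    · subst hc
      refine hT.mono ?_
      rintro x ⟨hx, hxR⟩
      exact ⟨hx, fun hxT => hxR (Or.inr ⟨hxT, hx⟩)⟩
    · refine (cocOn_compl_iff.1 hS.2.1 c').mono ?_
      rintro x ⟨hx, hxR⟩
      exact ⟨hx, fun hxS => hxR (Or.inl ⟨hxS, fun h => hc (eq_of_mem_compSet hx h)⟩)⟩
  have h1 : R.ncard = (S \ compSet c).ncard + (T ∩ compSet c).ncard := by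
    refine Set.ncard_union_eq ?_
    exact Set.disjoint_left.2 fun x hx hx' => hx.2 hx'.2
  have h2 := Set.ncard_inter_add_ncard_sdiff_eq_ncard S (compSet c)
  have h3 := hS.2.2 R hRM hR
  refine ⟨by omega, fun h => ⟨R, ⟨hRM, hR, fun Q hQ hQ' => ?_⟩, Set.subset_union_right⟩⟩
  have := hS.2.2 Q hQ hQ'
  omega

/-- The pigeonhole step: if a chunk `f` avoids the solution `S` and touches `(d - 1) * b + 1`
disjoint sets, then `S` contains all its neighbors in one of them, as otherwise one of the at most
`b` vertices of `f` has `d` neighbors outside `S`. -/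
theorem exists_nbhd_subset [Finite V] {q : ℕ} (hd : 1 ≤ d) (hq : (d - 1) * b < q) {A S : Set V} (hS : CocOn d G A S)
    {f : List V} (hfb : f.length ≤ b) (hf : ∀ v ∈ f, v ∈ A \ S) (C : Fin q → Set V)
    (hCA : ∀ j, C j ⊆ A) (hdisj : Pairwise fun i j => Disjoint (C i) (C j))
    (hfC : ∀ j, ∀ v ∈ f, v ∉ C j) : ∃ j, nbhd G f ∩ C j ⊆ S := by
  classical
  by_contra! hcon
  simp only [Set.not_subset] at hcon
  choose y hy hyS using hcon
  choose g hg hgy using fun j => (hy j).1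
  have hyinj : Function.Injective y := by
    intro i j hij
    by_contra hne
    exact Set.disjoint_left.1 (hdisj hne) (hy i).2 (hij ▸ (hy j).2)
  obtain ⟨v, hv, hcard⟩ := Finset.exists_lt_card_fiber_of_mul_lt_card_of_maps_to
    (s := (Finset.univ : Finset (Fin q))) (t := f.toFinset) (f := g) (n := d - 1)
    (fun j _ => List.mem_toFinset.2 (hg j)) (by
      rw [Finset.card_univ, Fintype.card_fin]
      have := (List.toFinset_card_le f).trans hfb
      calc _ ≤ b * (d - 1) := Nat.mul_le_mul_right _ this
        _ < q := by rwa [mul_comm])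
  set I := Finset.univ.filter fun j => g j = v
  have hvf := List.mem_toFinset.1 hv
  let P : Set V := insert v (y '' (I : Set (Fin q)))
  have hP : P ⊆ A \ S := by
    rintro x (rfl | ⟨j, _, rfl⟩)
    · exact hf _ hvf
    · exact ⟨hCA j (hy j).2, hyS j⟩
  have hadj : ∀ j ∈ (I : Set (Fin q)), G.Adj v (y j) := by
    intro j hj
    have : g j = v := by simpa [I] using hj
    exact this ▸ hgy j
  have hconn : ConnOn G P := by
    rintro Q ⟨x, hx, hxQ⟩ hQ
    have hvQ : v ∈ Q := by
      rcases hx with rfl | ⟨j, hj, rfl⟩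
      · exact hxQ
      · exact hQ _ ⟨Or.inr ⟨j, hj, rfl⟩, hxQ⟩ v (Or.inl rfl) (hadj j hj).symm
    rintro _ (rfl | ⟨j, hj, rfl⟩)
    · exact hvQ
    · exact hQ v ⟨Or.inl rfl, hvQ⟩ _ (Or.inr ⟨j, hj, rfl⟩) (hadj j hj)
  have h1 := hS P hP hconn
  rw [Set.ncard_insert_of_notMem, Set.ncard_image_of_injective _ hyinj,
    Set.ncard_coe_finset] at h1
  · omega
  · rintro ⟨j, _, hj⟩
    exact hfC j v hvf (hj ▸ (hy j).2)

/-- A blocking set among the neighbors of `X` is seen by `b` vertices of `X`. -/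
theorem exists_chunk [Finite V] {X Y : Set V} (hY : ∀ y ∈ Y, ∃ v ∈ X, G.Adj v y) (hne : Y.Nonempty)
    (hYb : Y.ncard ≤ b) : ∃ f : List V, f.length = b ∧ (∀ v ∈ f, v ∈ X) ∧ Y ⊆ nbhd G f := by
  classical
  obtain ⟨x, hx⟩ := hne
  obtain ⟨v, hv, _⟩ := hY x hx
  choose! g hgX hg using hY
  let l := Y.toFinite.toFinset.toList.map g
  have hl : l.length = Y.ncard := by
    simp [l, Set.ncard_eq_toFinset_card Y Y.toFinite]
  refine ⟨l ++ List.replicate (b - l.length) v, by simp; omega, ?_, ?_⟩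
  · intro w hw
    rcases List.mem_append.1 hw with hw | hw
    · simp only [l, List.mem_map, Finset.mem_toList, Set.Finite.mem_toFinset] at hw
      obtain ⟨y, hy, rfl⟩ := hw
      exact hgX y hy
    · rw [List.eq_of_mem_replicate hw]
      exact hv
  · intro y hy
    refine ⟨g y, List.mem_append_left _ ?_, hg y hy⟩
    exact List.mem_map_of_mem (by simpa using hy)

/-- The reduction is correct: components `U` of `G - M` can be deleted if a family of chunks
contains all chunks that conflict with a component of `U`, if each chunk of the family has
`(d - 1) * b + 1` components of its own outside of `U` with which it conflicts, and if these
conflict with no chunk outside of the family. -/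
theorem cocOn_delete_iff [Finite V] (hd : 1 ≤ d)
    (hb : ∀ X : Set ↥(Mᶜ), IsMinimalBlocking d (del G M) X → X.ncard ≤ b) {S₀ : Set V}
    (hS₀ : MinCocOn d G Mᶜ S₀) (U : Finset (del G M).ConnectedComponent) {κ : Type} [Fintype κ]
    (chunk : κ → List V) (hchunk : ∀ f, (chunk f).length = b ∧ ∀ v ∈ chunk f, v ∈ M)
    (μ : κ → Fin ((d - 1) * b + 1) → (del G M).ConnectedComponent)
    (hμinj : ∀ f f' j j', μ f j = μ f' j' → f = f' ∧ j = j')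
    (hμU : ∀ f j, μ f j ∉ U)
    (hμ : ∀ f j, ¬ Extendable d G Mᶜ (nbhd G (chunk f) ∩ compSet (μ f j)))
    (hclosed : ∀ c, (c ∈ U ∨ ∃ f j, μ f j = c) → ∀ f : List V, f.length = b →
      (∀ v ∈ f, v ∈ M) → ¬ Extendable d G Mᶜ (nbhd G f ∩ compSet c) → ∃ i, chunk i = f) (k : ℤ) :
    (∃ S : Set V, CocOn d G Set.univ S ∧ (S.ncard : ℤ) ≤ k) ↔
      ∃ S ⊆ (⋃ c ∈ U, compSet c)ᶜ, CocOn d G (⋃ c ∈ U, compSet c)ᶜ S ∧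
        (S.ncard : ℤ) ≤ k - (S₀ ∩ ⋃ c ∈ U, compSet c).ncard := by
  classical
  set D : Set V := ⋃ c ∈ U, compSet c with hD
  constructor
  · rintro ⟨S, hS, hk⟩
    refine ⟨S \ D, fun x hx => hx.2, hS.mono ?_, ?_⟩
    · rintro x ⟨hx, hxS⟩
      exact ⟨trivial, fun h => hxS ⟨h, hx⟩⟩
    · have h1 : (S₀ ∩ D).ncard ≤ (S ∩ D).ncard := by
        rw [hD, ncard_inter_components, ncard_inter_components]
        refine Finset.sum_le_sum fun c _ => (hS₀.component c (hS.mono ?_)).1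
        exact Set.sdiff_subset_sdiff_left (Set.subset_univ _)
      have h2 := Set.ncard_inter_add_ncard_sdiff_eq_ncard S D
      omega
  · rintro ⟨S, hSD, hS, hk⟩
    let K : Finset (del G M).ConnectedComponent := Finset.univ.image fun x : κ × Fin _ => μ x.1 x.2
    have hK : ∀ c, c ∈ K ↔ ∃ f j, μ f j = c := by
      intro c; simp [K]
    have hUK : Disjoint U K := by
      rw [Finset.disjoint_right]
      intro c hc
      obtain ⟨f, j, rfl⟩ := (hK c).1 hc
      exact hμU f j
    have hMD : M ⊆ Dᶜ := by
      intro x hx hxD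
      simp only [hD, Set.mem_iUnion] at hxD
      obtain ⟨c, _, hxc⟩ := hxD
      exact compSet_subset c hxc hx
    have hKD : ∀ c ∈ K, compSet c ⊆ Dᶜ := by
      intro c hc x hx hxD
      simp only [hD, Set.mem_iUnion] at hxD
      obtain ⟨c', hc', hxc⟩ := hxD
      exact Finset.disjoint_left.1 hUK hc' (eq_of_mem_compSet hx hxc ▸ hc)
    have hSc : ∀ c ∈ K, CocOn d G (compSet c) S := fun c hc =>
      hS.mono (Set.sdiff_subset_sdiff_left (hKD c hc))
    -- the chunks of the family that avoid the solution
    let F' : Finset κ := Finset.univ.filter fun f => ∀ v ∈ chunk f, v ∉ S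
    have hF' : ∀ f, f ∈ F' ↔ ∀ v ∈ chunk f, v ∉ S := by intro f; simp [F']
    have hj : ∀ f ∈ F', ∃ j, nbhd G (chunk f) ∩ compSet (μ f j) ⊆ S := by
      intro f hf
      rw [hF'] at hf
      refine exists_nbhd_subset hd (Nat.lt_succ_self _) hS (hchunk f).1.le
        (fun v hv => ⟨hMD ((hchunk f).2 v hv), hf v hv⟩) (fun j => compSet (μ f j))
        (fun j => hKD _ ((hK _).2 ⟨f, j, rfl⟩)) ?_ ?_
      · intro i j hij
        rw [Set.disjoint_left]
        intro x hx hx'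
        exact hij (hμinj f f i j (eq_of_mem_compSet hx hx')).2
      · exact fun j v hv hvc => compSet_subset _ hvc ((hchunk f).2 v hv)
    choose! j hj using hj
    have hv : ∀ f, ∃ v, v ∈ chunk f := by
      intro f
      refine List.exists_mem_of_ne_nil _ fun h => ?_
      refine hμ f 0 ⟨S₀, hS₀, ?_⟩
      simp [nbhd, h]
    choose v hv using hv
    -- the solution is extended by a vertex of each of these chunks
    let T : Set V := (S ∩ M) ∪ v '' (F' : Set κ)
    have hTcard : T.ncard ≤ (S ∩ M).ncard + F'.card := by
      refine (Set.ncard_union_le _ _).trans (Nat.add_le_add_left ?_ _)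
      exact (Set.ncard_image_le (Set.toFinite _)).trans (Set.ncard_coe_finset _).le
    have hZ : ∀ c ∈ U ∪ K, Extendable d G Mᶜ ({w | ∃ x ∈ M \ T, G.Adj x w} ∩ compSet c) := by
      intro c hc
      by_contra hcon
      obtain ⟨Y, hY, hYb, hYcard⟩ := exists_small_blocking hb
        (Set.inter_subset_right.trans (compSet_subset c)) hcon
      have hYne : Y.Nonempty := by
        rw [Set.nonempty_iff_ne_empty]
        rintro rfl
        exact hYb ⟨S₀, hS₀, by simp⟩
      obtain ⟨f, hfb, hfX, hYf⟩ := exists_chunk (G := G) (fun y hy => (hY hy).1) hYne hYcard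
      obtain ⟨i, rfl⟩ : ∃ i, chunk i = f := by
        refine hclosed c ?_ f hfb (fun x hx => (hfX x hx).1) fun h => hYb (h.mono ?_)
        · rw [← hK]; exact Finset.mem_union.1 hc
        · exact fun y hy => ⟨hYf hy, (hY hy).2⟩
      have hiF' : i ∈ F' := (hF' i).2 fun x hx hxS =>
        (hfX x hx).2 (Or.inl ⟨hxS, (hfX x hx).1⟩)
      exact (hfX _ (hv i)).2 (Or.inr ⟨i, hiF', rfl⟩)
    choose! Z hZmin hZ using hZ
    let B : Set V := ⋃ c ∈ U ∪ K, compSet c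
    have hB : ∀ x, x ∈ B ↔ ∃ c ∈ U ∪ K, x ∈ compSet c := by
      intro x
      simp only [B, Set.mem_iUnion, exists_prop]
    let ZB : Set V := {w | ∃ c ∈ U ∪ K, w ∈ compSet c ∧ w ∈ Z c}
    refine ⟨T ∪ ZB ∪ (S \ (M ∪ B)), ?_, ?_⟩
    · intro P hP hconn
      by_cases hPB : (P ∩ B).Nonempty
      · obtain ⟨x, hxP, hxB⟩ := hPB
        obtain ⟨c, hc, hxc⟩ := (hB x).1 hxB
        have hPc : P ⊆ compSet c := by
          refine hconn _ ⟨x, hxP, hxc⟩ ?_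
          rintro u ⟨huP, huc⟩ w hwP huw
          by_cases hwM : w ∈ M
          · exfalso
            have hwT : w ∉ T := fun h => (hP hwP).2 (Or.inl (Or.inl h))
            have huZ : u ∈ Z c := hZ c hc ⟨⟨w, ⟨hwM, hwT⟩, huw.symm⟩, huc⟩
            exact (hP huP).2 (Or.inl (Or.inr ⟨c, hc, huc, huZ⟩))
          · exact compSet_closed huc hwM huw
        refine (hZmin c hc).2.1 P (fun u hu => ⟨compSet_subset c (hPc hu), fun huZ => ?_⟩) hconn
        exact (hP hu).2 (Or.inl (Or.inr ⟨c, hc, hPc hu, huZ⟩))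
      · have hPB' : ∀ x ∈ P, x ∉ B := fun x hx hxB => hPB ⟨x, hx, hxB⟩
        refine hS P (fun x hx => ⟨fun hxD => hPB' x hx ?_, fun hxS => (hP hx).2 ?_⟩) hconn
        · simp only [hD, Set.mem_iUnion, exists_prop] at hxD
          obtain ⟨c, hc, hxc⟩ := hxD
          exact (hB x).2 ⟨c, Finset.mem_union_left _ hc, hxc⟩
        · by_cases hxM : x ∈ M
          · exact Or.inl (Or.inl (Or.inl ⟨hxS, hxM⟩))
          · exact Or.inr ⟨hxS, fun h => h.elim hxM (hPB' x hx)⟩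
    · -- the extension is paid for by the components of the chunks
      have h1 : ZB.ncard = ∑ c ∈ U ∪ K, (S₀ ∩ compSet c).ncard := by
        have : ZB = ZB ∩ B := by
          refine (Set.inter_eq_left.2 ?_).symm
          rintro x ⟨c, hc, hx, _⟩
          exact (hB x).2 ⟨c, hc, hx⟩
        rw [this, ncard_inter_components]
        refine Finset.sum_congr rfl fun c hc => ?_
        have h2 : ZB ∩ compSet c = Z c ∩ compSet c := by
          ext x
          constructor
          · rintro ⟨⟨c', hc', hx', hxZ⟩, hx⟩
            obtain rfl := eq_of_mem_compSet hx hx'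
            exact ⟨hxZ, hx⟩
          · rintro ⟨hxZ, hx⟩
            exact ⟨⟨c, hc, hx, hxZ⟩, hx⟩
        rw [h2]
        exact le_antisymm
          ((hZmin c hc).component c (cocOn_compl_iff.1 hS₀.2.1 c)).1
          (hS₀.component c (cocOn_compl_iff.1 (hZmin c hc).2.1 c)).1
      have h2 : ∑ c ∈ K, (S₀ ∩ compSet c).ncard + F'.card ≤
          ∑ c ∈ K, (S ∩ compSet c).ncard := by
        let I := F'.image fun f => μ f (j f)
        have hI : I.card = F'.card := by
          refine Finset.card_image_of_injOn fun f hf f' hf' he => ?_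
          exact (hμinj f f' _ _ he).1
        have hIK : I ⊆ K := by
          intro c hc
          obtain ⟨f, hf, rfl⟩ := Finset.mem_image.1 hc
          exact (hK _).2 ⟨f, _, rfl⟩
        have h3 : F'.card = ∑ c ∈ K, if c ∈ I then 1 else 0 := by
          rw [← hI, Finset.card_eq_sum_ones, ← Finset.sum_filter]
          congr 1
          ext c
          simpa using @hIK c
        rw [h3, ← Finset.sum_add_distrib]
        refine Finset.sum_le_sum fun c hc => ?_
        have h4 := hS₀.component c (hSc c hc)
        split_ifs with hcI
        · by_contra hlt
          obtain ⟨f, hf, rfl⟩ := Finset.mem_image.1 hcI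
          refine hμ f (j f) ((h4.2 (by omega)).mono ?_)
          exact fun x hx => ⟨hj f hf hx, hx.2⟩
        · exact h4.1
      have h3 : (S ∩ M).ncard + (S \ (M ∪ B)).ncard + ∑ c ∈ K, (S ∩ compSet c).ncard ≤ S.ncard := by
        rw [← ncard_inter_components, ← Set.ncard_union_eq, ← Set.ncard_union_eq]
        · refine Set.ncard_le_ncard ?_
          rintro x ((hx | hx) | hx) <;> exact hx.1
        · rw [Set.disjoint_left]
          rintro x hx ⟨_, hxK⟩
          simp only [Set.mem_iUnion] at hxK
          obtain ⟨c, hc, hxc⟩ := hxK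
          rcases hx with hx | hx
          · exact compSet_subset c hxc hx.2
          · exact hx.2 (Or.inr ((hB x).2 ⟨c, Finset.mem_union_right _ hc, hxc⟩))
        · exact Set.disjoint_left.2 fun x hx hx' => hx'.2 (Or.inl hx.2)
      have h4 : (S₀ ∩ D).ncard = ∑ c ∈ U, (S₀ ∩ compSet c).ncard := ncard_inter_components _ _
      rw [Finset.sum_union hUK] at h1
      have h5 := Set.ncard_union_le (T ∪ ZB) (S \ (M ∪ B))
      have h6 := Set.ncard_union_le T ZB
      omega

end Components

/-! ### Vertex sets and graphs as lists of truth values -/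

open Classical in
/-- The characteristic vector of a vertex set. -/
noncomputable def mask {n : ℕ} (A : Set (Fin n)) : List Bool := List.ofFn fun i => decide (i ∈ A)

/-- The adjacency matrix of a graph. -/
noncomputable def rows {n : ℕ} (G : SimpleGraph (Fin n)) : List (List Bool) :=
  List.ofFn fun i => mask (G.neighborSet i)

theorem enc_mask {n : ℕ} (A : Set (Fin n)) : enc (mask A) = ofVertexSet A := by
  change ofList _ = ofList _
  rw [mask, List.map_ofFn]
  rfl

theorem enc_rows {n : ℕ} (G : SimpleGraph (Fin n)) : enc (rows G) = ofGraph G := by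
  change ofList _ = ofList _
  rw [rows, List.map_ofFn]
  congr 2
  funext i
  exact enc_mask _

@[simp] theorem length_mask {n : ℕ} (A : Set (Fin n)) : (mask A).length = n := by simp [mask]

@[simp] theorem length_rows {n : ℕ} (G : SimpleGraph (Fin n)) : (rows G).length = n := by
  simp [rows]

@[simp] theorem getElem_mask {n : ℕ} (A : Set (Fin n)) (i : ℕ) (h : i < (mask A).length) :
    (mask A)[i] = true ↔ (⟨i, by simpa using h⟩ : Fin n) ∈ A := by simp [mask]

theorem eq_mask {n : ℕ} {l : List Bool} (hl : l.length = n) {A : Set (Fin n)}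
    (h : ∀ i : Fin n, l[i] = true ↔ i ∈ A) : l = mask A := by
  refine List.ext_getElem (by simpa) fun i h1 h2 => ?_
  rw [Bool.eq_iff_iff, getElem_mask]
  exact h ⟨i, by omega⟩

theorem mask_injective {n : ℕ} {A B : Set (Fin n)} (h : mask A = mask B) : A = B := by
  classical
  ext i
  have := congrFun (List.ofFn_injective h) i
  simpa using this

theorem count_mask {n : ℕ} (A : Set (Fin n)) : (mask A).count true = A.ncard := by
  classical
  rw [mask, List.ofFn_eq_map, List.count_eq_countP, List.countP_map, List.countP_eq_length_filter,
    ← List.toFinset_card_of_nodup ((List.nodup_finRange n).filter _), ← Set.ncard_coe_finset]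
  congr 1
  ext i
  simp

/-- The union of two vertex sets. -/
def maskOr (a b : List Bool) : List Bool := (a.zip b).map fun p => p.1 || p.2

/-- The intersection of two vertex sets. -/
def maskAnd (a b : List Bool) : List Bool := (a.zip b).map fun p => p.1 && p.2

/-- The complement of a vertex set. -/
def maskNot (a : List Bool) : List Bool := a.map fun x => !x

/-- Whether the sets have a common element. -/
def meets (a b : List Bool) : Bool := (a.zip b).any fun p => p.1 && p.2

/-- The entries of a list at the places that are marked by a vertex set. -/
def select (a : List Bool) (l : List δ) : List δ :=
  (a.zip l).flatMap fun p => bif p.1 then [p.2] else []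

/-- The matrix of an induced subgraph. -/
def selectMatrix (a : List Bool) (r : List (List Bool)) : List (List Bool) :=
  (select a r).map (select a)

theorem maskOr_mask {n : ℕ} (A B : Set (Fin n)) : maskOr (mask A) (mask B) = mask (A ∪ B) := by
  refine eq_mask (by simp [maskOr]) fun i => ?_
  simp [maskOr]

theorem maskAnd_mask {n : ℕ} (A B : Set (Fin n)) : maskAnd (mask A) (mask B) = mask (A ∩ B) := by
  refine eq_mask (by simp [maskAnd]) fun i => ?_
  simp [maskAnd]

theorem maskNot_mask {n : ℕ} (A : Set (Fin n)) : maskNot (mask A) = mask Aᶜ := by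
  refine eq_mask (by simp [maskNot]) fun i => ?_
  simp only [maskNot, Fin.getElem_fin, List.getElem_map, Bool.not_eq_true', Set.mem_compl_iff]
  rw [← Bool.not_eq_true, getElem_mask]

theorem meets_mask {n : ℕ} (A B : Set (Fin n)) :
    meets (mask A) (mask B) = true ↔ (A ∩ B).Nonempty := by
  simp only [meets, List.any_eq_true, Prod.exists, Bool.and_eq_true]
  constructor
  · rintro ⟨a, b, h, rfl, rfl⟩
    obtain ⟨i, hi, h⟩ := List.mem_iff_getElem.1 h
    simp only [List.length_zip, length_mask, min_self] at hi
    simp only [List.getElem_zip, Prod.mk.injEq, getElem_mask] at h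
    exact ⟨⟨i, hi⟩, h.1, h.2⟩
  · rintro ⟨i, hA, hB⟩
    refine ⟨true, true, List.mem_iff_getElem.2 ⟨i, by simp, ?_⟩, rfl, rfl⟩
    simp [hA, hB]

/-- The marked entries of a list, as entries along an order embedding. -/
theorem exists_select {n : ℕ} (A : Set (Fin n)) : ∃ (n' : ℕ) (φ : Fin n' ↪o Fin n),
    Set.range φ = A ∧
      ∀ {δ : Type} (f : Fin n → δ), select (mask A) (List.ofFn f) = List.ofFn (f ∘ φ) := by
  classical
  let L := (List.finRange n).filter fun i => decide (i ∈ A)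
  have hL : L.SortedLT := ((List.pairwise_lt_finRange n).filter _).sortedLT
  refine ⟨L.length, OrderEmbedding.ofStrictMono L.get hL.strictMono_get, ?_, ?_⟩
  · ext i
    simp only [OrderEmbedding.coe_ofStrictMono, Set.mem_range]
    rw [← List.mem_iff_get]
    simp [L]
  · intro δ f
    have h1 : List.ofFn (f ∘ (OrderEmbedding.ofStrictMono L.get hL.strictMono_get)) = L.map f := by
      rw [← List.map_ofFn]
      congr 1
      exact List.ofFn_get L
    rw [h1, select, mask, List.ofFn_eq_map, List.ofFn_eq_map, List.zip_map']
    simp only [L]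
    generalize List.finRange n = l
    induction l with
    | nil => rfl
    | cons i l ih =>
      by_cases hi : i ∈ A <;> simp [hi] <;> simpa using ih

theorem select_mask {n n' : ℕ} {A : Set (Fin n)} {φ : Fin n' ↪o Fin n}
    (h : ∀ {δ : Type} (f : Fin n → δ), select (mask A) (List.ofFn f) = List.ofFn (f ∘ φ))
    (B : Set (Fin n)) : select (mask A) (mask B) = mask (φ ⁻¹' B) := by
  rw [mask, mask, mask]
  exact h _

theorem selectMatrix_rows {n n' : ℕ} {A : Set (Fin n)} {φ : Fin n' ↪o Fin n}
    (h : ∀ {δ : Type} (f : Fin n → δ), select (mask A) (List.ofFn f) = List.ofFn (f ∘ φ))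
    (G : SimpleGraph (Fin n)) : selectMatrix (mask A) (rows G) = rows (G.comap φ) := by
  rw [selectMatrix, rows, h, List.map_ofFn]
  rw [rows]
  congr 1
  funext i
  exact select_mask h _

/-- The unit vectors of the length of a given list. -/
def units : List δ → List (List Bool)
  | [] => []
  | _ :: l => (true :: l.map fun _ => false) :: (units l).map fun u => false :: u

theorem length_units {ε : Type} (l : List ε) : (units l).length = l.length := by
  induction l with
  | nil => rfl
  | cons a l ih => simp [units, ih]

theorem length_of_mem_units {ε : Type} {l : List ε} {u : List Bool} (h : u ∈ units l) :
    u.length = l.length := by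
  induction l generalizing u with
  | nil => simp [units] at h
  | cons a l ih =>
    simp only [units, List.mem_cons, List.mem_map] at h
    rcases h with rfl | ⟨u, hu, rfl⟩
    · simp
    · simp [ih hu]

theorem units_eq {ε : Type} {n : ℕ} {l : List ε} (h : l.length = n) :
    units l = List.ofFn fun i : Fin n => mask {i} := by
  induction l generalizing n with
  | nil => subst h; rfl
  | cons a l ih =>
    obtain _ | n := n
    · simp at h
    have h : l.length = n := by simpa using h
    rw [units, ih h, List.ofFn_succ, List.map_ofFn]
    congr 1
    · refine eq_mask (by simpa) fun i => ?_
      refine Fin.cases ?_ (fun i => ?_) i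
      · simp
      · simp
    · congr 1
      funext i
      refine eq_mask (by simp) fun j => ?_
      refine Fin.cases ?_ (fun j => ?_) j
      · simp [eq_comm, Fin.succ_ne_zero]
      · simp [Fin.ext_iff]

/-- A list of truth values as a subset of the complement of the given set: it is cut or padded to
the right length, and the elements of the set are removed. -/
def fit (m y : List Bool) : List Bool := maskAnd (maskNot m) (y ++ m.map fun _ => false)

theorem exists_fit {n : ℕ} (M : Set (Fin n)) (y : List Bool) :
    ∃ A ⊆ Mᶜ, fit (mask M) y = mask A := by
  refine ⟨{i | i ∈ Mᶜ ∧ (y ++ (mask M).map fun _ => false)[(i : ℕ)]'(by simp; omega) = true},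
    fun i hi => hi.1, ?_⟩
  refine eq_mask (by simp [fit, maskAnd, maskNot]) fun i => ?_
  simp only [fit, maskNot_mask]
  simp [maskAnd]

theorem fit_mask {n : ℕ} {M A : Set (Fin n)} (hA : A ⊆ Mᶜ) : fit (mask M) (mask A) = mask A := by
  refine eq_mask (by simp [fit, maskAnd, maskNot]) fun i => ?_
  simp only [fit, maskNot_mask]
  have h : (mask A ++ (mask M).map fun _ => false)[(i : ℕ)]'(by simp; omega) = true ↔ i ∈ A := by
    rw [List.getElem_append_left (by simp)]
    simp
  simp only [maskAnd, Fin.getElem_fin, List.getElem_map, List.getElem_zip, Bool.and_eq_true,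
    getElem_mask, h, and_iff_right_iff_imp]
  exact fun hi => hA hi

namespace PolyTime

@[fun_prop]
theorem maskOr {f g : α → List Bool} (hf : PolyTime f) (hg : PolyTime g) :
    PolyTime fun a => maskOr (f a) (g a) := by unfold COC.maskOr; fun_prop

@[fun_prop]
theorem maskAnd {f g : α → List Bool} (hf : PolyTime f) (hg : PolyTime g) :
    PolyTime fun a => maskAnd (f a) (g a) := by unfold COC.maskAnd; fun_prop

@[fun_prop]
theorem maskNot {f : α → List Bool} (hf : PolyTime f) : PolyTime fun a => maskNot (f a) := by
  unfold COC.maskNot; fun_prop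

@[fun_prop]
theorem meets {f g : α → List Bool} (hf : PolyTime f) (hg : PolyTime g) :
    PolyTime fun a => meets (f a) (g a) := by unfold COC.meets; fun_prop

@[fun_prop]
theorem select {f : α → List Bool} {g : α → List β} (hf : PolyTime f) (hg : PolyTime g) :
    PolyTime fun a => select (f a) (g a) := by unfold COC.select; fun_prop

@[fun_prop]
theorem selectMatrix {f : α → List Bool} {g : α → List (List Bool)} (hf : PolyTime f)
    (hg : PolyTime g) : PolyTime fun a => selectMatrix (f a) (g a) := by
  unfold COC.selectMatrix; fun_prop

@[fun_prop]
theorem fit {f g : α → List Bool} (hf : PolyTime f) (hg : PolyTime g) :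
    PolyTime fun a => fit (f a) (g a) := by unfold COC.fit; fun_prop

theorem units' : PolyTime (units : List δ → List (List Bool)) := by
  have key : ∀ l : List δ, l.foldr (fun _ (s : List (List Bool) × List Bool) =>
      ((true :: s.2) :: s.1.map (fun u => false :: u), false :: s.2)) ([], [])
        = (units l, l.map fun _ => false) := by
    intro l
    induction l with
    | nil => rfl
    | cons a l ih => rw [List.foldr_cons, ih]; rfl
  have h := foldr_of_drop (f := fun l : List δ => l) (init := fun _ => ([], []))
    (step := fun _ _ (s : List (List Bool) × List Bool) =>
      ((true :: s.2) :: s.1.map (fun u => false :: u), false :: s.2))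
    id' (const _) (by fun_prop) (.X * (4 * .X + 2) + (4 * .X + 1) + 2) ?_
  · exact (fst'.comp h).congr_enc fun l => by rw [key]
  · intro l l' hl
    rw [key, sz_pair]
    have h1 : l'.length ≤ sz l := hl.length_le.trans (length_lt_sz l).le
    have h2 : ∀ (L : List (List Bool)) (B : ℕ), (∀ u ∈ L, sz u + 1 ≤ B) →
        sz L ≤ L.length * B + 1 := by
      intro L B
      induction L with
      | nil => simp
      | cons u L ih =>
        intro h
        have h4 := h u List.mem_cons_self
        have h5 := ih fun u hu => h u (List.mem_cons_of_mem _ hu)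
        simp only [sz_cons, List.length_cons, Nat.succ_mul]
        omega
    have h3 := h2 (units l') (4 * sz l + 2) fun u hu => by
      have h4 := sz_bools_le u
      have h5 := (length_of_mem_units hu).trans_le h1
      omega
    rw [length_units] at h3
    have h4 := sz_bools_le (l'.map fun _ => false)
    rw [List.length_map] at h4
    have h5 := Nat.mul_le_mul_right (4 * sz l + 2) h1
    simp only [Polynomial.eval_add, Polynomial.eval_mul, Polynomial.eval_X,
      Polynomial.eval_ofNat, Polynomial.eval_one]
    omega

@[fun_prop]
theorem units {f : α → List δ} (hf : PolyTime f) : PolyTime fun a => units (f a) := units'.comp hf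

end PolyTime

/-! ### The decision procedure for extendable sets -/

section Gadget

variable {V W : Type}

/-- `H` consists of a copy of `G` and a clique of `d` further vertices, each of which is adjacent to
exactly the vertices in `A` of the copy. -/
structure IsJoin (d : ℕ) (G : SimpleGraph V) (A : Set V) (H : SimpleGraph W) (ψ : V → W) :
    Prop where
  inj : ψ.Injective
  comap : H.comap ψ = G
  card : (Set.range ψ)ᶜ.ncard = d
  clique : ∀ x ∉ Set.range ψ, ∀ y ∉ Set.range ψ, x ≠ y → H.Adj x y
  adj : ∀ x ∉ Set.range ψ, ∀ v, H.Adj x (ψ v) ↔ v ∈ A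

/-- Solutions that contain `A` separate the clique from the rest. -/
theorem IsJoin.isYes [Finite V] [Finite W] {d : ℕ} {G : SimpleGraph V} {A : Set V}
    {H : SimpleGraph W} {ψ : V → W} (h : IsJoin d G A H ψ) {S : Set V}
    (hS : CocOn d G Set.univ S) (hA : A ⊆ S) : IsYes d H S.ncard := by
  refine ⟨ψ '' S, isCocSet_iff.2 fun P hP hconn => ?_, ?_⟩
  · by_cases hK : (P ∩ (Set.range ψ)ᶜ).Nonempty
    · have : P ⊆ (Set.range ψ)ᶜ := by
        refine hconn _ hK ?_
        rintro x ⟨_, hx⟩ y hy hadj ⟨v, rfl⟩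
        exact (hP hy).2 ⟨v, hA ((h.adj x hx v).1 hadj), rfl⟩
      exact (Set.ncard_le_ncard this).trans h.card.le
    · have hPψ : P ⊆ Set.range ψ := fun x hx => by
        by_contra hxψ
        exact hK ⟨x, hx, hxψ⟩
      have hS' := hS
      rw [← h.comap, cocOn_comap h.inj, Set.image_univ] at hS'
      exact hS' P (fun x hx => ⟨hPψ hx, (hP hx).2⟩) hconn
  · rw [Set.ncard_image_of_injective _ h.inj]

/-- A solution that avoids the clique contains `A`, as the clique with a vertex of `A` is connected
and has `d + 1` vertices. -/
theorem IsJoin.exists_of_isYes [Finite V] [Finite W] {d : ℕ} {G : SimpleGraph V} {A : Set V}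
    {H : SimpleGraph W} {ψ : V → W} (h : IsJoin d G A H ψ) {k : ℤ} (hk : IsYes d H k) :
    ∃ S, CocOn d G Set.univ S ∧ (S.ncard : ℤ) ≤ k ∧ (A ⊆ S ∨ (S.ncard : ℤ) + 1 ≤ k) := by
  obtain ⟨T, hT, hTk⟩ := hk
  rw [isCocSet_iff] at hT
  have hS : ψ '' (ψ ⁻¹' T) ⊆ T := Set.image_preimage_subset _ _
  have h1 := Set.ncard_le_ncard hS
  rw [Set.ncard_image_of_injective _ h.inj] at h1
  refine ⟨ψ ⁻¹' T, ?_, by omega, ?_⟩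
  · rw [← h.comap, cocOn_comap h.inj]
    refine hT.mono ?_
    rintro _ ⟨⟨v, _, rfl⟩, hv⟩
    exact ⟨trivial, fun hvT => hv ⟨v, hvT, rfl⟩⟩
  · by_cases hK : ∃ x ∉ Set.range ψ, x ∈ T
    · right
      obtain ⟨x, hx, hxT⟩ := hK
      have h2 : (ψ '' (ψ ⁻¹' T)).ncard < T.ncard := by
        refine Set.ncard_lt_ncard ⟨hS, fun hTS => ?_⟩
        obtain ⟨v, _, rfl⟩ := hTS hxT
        exact hx ⟨v, rfl⟩
      rw [Set.ncard_image_of_injective _ h.inj] at h2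
      omega
    · left
      push Not at hK
      intro a ha
      by_contra haT
      have h2 := hT (insert (ψ a) (Set.range ψ)ᶜ) ?_ ?_
      · rw [Set.ncard_insert_of_notMem (by simp), h.card] at h2
        omega
      · rintro x (rfl | hx)
        · exact ⟨trivial, haT⟩
        · exact ⟨trivial, hK x hx⟩
      · rintro Q ⟨x, hx, hxQ⟩ hQ y hy
        by_cases hxy : x = y
        · exact hxy ▸ hxQ
        refine hQ x ⟨hx, hxQ⟩ y hy ?_
        rcases hx with rfl | hx <;> rcases hy with rfl | hy
        · exact absurd rfl hxy
        · exact ((h.adj y hy a).2 ha).symm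
        · exact (h.adj x hx a).2 ha
        · exact h.clique x hx y hy hxy

/-- A new vertex `0` that is adjacent to the vertices in `A`. -/
def coneGraph {n : ℕ} (G : SimpleGraph (Fin n)) (A : Set (Fin n)) : SimpleGraph (Fin (n + 1)) where
  Adj i j := Fin.cases (Fin.cases False (· ∈ A) j) (fun i => Fin.cases (i ∈ A) (G.Adj i) j) i
  symm := ⟨fun i j => by
    refine Fin.cases ?_ (fun i => ?_) i <;> refine Fin.cases ?_ (fun j => ?_) j
    · exact id
    · exact id
    · exact id
    · exact fun h => G.adj_symm h⟩
  loopless := ⟨fun i => by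
    refine Fin.cases ?_ (fun i => ?_) i
    · exact id
    · exact G.loopless.irrefl i⟩

/-- The new vertex on the level of matrices; the vertex set is extended by the new vertex. -/
def cone (x : List (List Bool) × List Bool) : List (List Bool) × List Bool :=
  ((false :: x.2) :: (x.2.zip x.1).map (fun p => p.1 :: p.2), true :: x.2)

theorem cone_rows {n : ℕ} (G : SimpleGraph (Fin n)) (A : Set (Fin n)) :
    cone (rows G, mask A) = (rows (coneGraph G A), mask (insert 0 (Fin.succ '' A))) := by
  have h1 : (true :: mask A) = mask (insert 0 (Fin.succ '' A)) := by
    refine eq_mask (by simp) fun i => ?_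
    refine Fin.cases ?_ (fun i => ?_) i
    · simp
    · simp [Fin.succ_ne_zero]
  have h2 : (false :: mask A) = mask ((coneGraph G A).neighborSet 0) := by
    refine eq_mask (by simp) fun i => ?_
    refine Fin.cases ?_ (fun i => ?_) i
    · simp
    · simp [coneGraph]
  rw [cone, h1]
  congr 1
  conv_rhs => rw [rows, List.ofFn_succ, ← h2]
  congr 1
  refine List.ext_getElem (by simp) fun i hi hi' => ?_
  have hin : i < n := by simpa using hi'
  simp only [List.getElem_map, List.getElem_zip, List.getElem_ofFn]
  refine eq_mask (by simp [rows]) fun j => ?_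
  refine Fin.cases ?_ (fun j => ?_) j
  · simp [coneGraph]
  · simp [coneGraph, rows]

theorem IsJoin.cone {n n' d : ℕ} {G : SimpleGraph (Fin n)} {A : Set (Fin n)}
    {H : SimpleGraph (Fin n')} {ψ : Fin n → Fin n'} (h : IsJoin d G A H ψ) :
    IsJoin (d + 1) G A (coneGraph H ((Set.range ψ)ᶜ ∪ ψ '' A)) (Fin.succ ∘ ψ) := by
  have hr : (Set.range (Fin.succ ∘ ψ))ᶜ = insert 0 (Fin.succ '' (Set.range ψ)ᶜ) := by
    ext i
    refine Fin.cases ?_ (fun i => ?_) i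
    · simp [Fin.succ_ne_zero]
    · simp [Fin.succ_ne_zero]
  constructor
  · exact (Fin.succ_injective _).comp h.inj
  · rw [← h.comap]
    rfl
  · rw [hr, Set.ncard_insert_of_notMem, Set.ncard_image_of_injective _ (Fin.succ_injective _),
      h.card]
    rintro ⟨i, _, hi⟩
    exact Fin.succ_ne_zero i hi
  · intro x hx y hy hxy
    rw [← Set.mem_compl_iff, hr] at hx hy
    rcases hx with rfl | ⟨x, hx, rfl⟩ <;> rcases hy with rfl | ⟨y, hy, rfl⟩
    · exact absurd rfl hxy
    · exact Or.inl hy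
    · exact Or.inl hx
    · exact h.clique x hx y hy fun he => hxy (he ▸ rfl)
  · intro x hx v
    rw [← Set.mem_compl_iff, hr] at hx
    rcases hx with rfl | ⟨x, hx, rfl⟩
    · change ψ v ∈ (Set.range ψ)ᶜ ∪ ψ '' A ↔ _
      simp [h.inj.eq_iff]
    · exact h.adj x hx v

theorem exists_join {n : ℕ} (d : ℕ) (G : SimpleGraph (Fin n)) (A : Set (Fin n)) :
    ∃ (n' : ℕ) (H : SimpleGraph (Fin n')) (ψ : Fin n → Fin n'), IsJoin d G A H ψ ∧
      COC.cone^[d] (rows G, mask A) = (rows H, mask ((Set.range ψ)ᶜ ∪ ψ '' A)) := by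
  induction d with
  | zero =>
    refine ⟨n, G, id, ⟨Function.injective_id, rfl, by simp, by simp, by simp⟩, by simp⟩
  | succ d ih =>
    obtain ⟨n', H, ψ, h, he⟩ := ih
    refine ⟨n' + 1, _, _, h.cone, ?_⟩
    rw [Function.iterate_succ_apply', he, cone_rows]
    congr 2
    ext i
    refine Fin.cases ?_ (fun i => ?_) i
    · simp [Fin.succ_ne_zero]
    · simp [Fin.succ_ne_zero]

end Gadget

/-- An instance `(G, k)` with `G` in the class. -/
structure ClassInstance (𝒢 : GraphClass) where
  n : ℕ
  G : SimpleGraph (Fin n)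
  k : ℤ
  mem : 𝒢.Mem G

noncomputable instance (𝒢 : GraphClass) : Enc (ClassInstance 𝒢) := ⟨fun x => ofInstance x.G x.k⟩

/-- An instance `(G, k, M)` with `G - M` in the class. -/
structure ModInstance (𝒢 : GraphClass) where
  n : ℕ
  G : SimpleGraph (Fin n)
  k : ℤ
  M : Set (Fin n)
  mem : 𝒢.Mem (del G M)

noncomputable instance (𝒢 : GraphClass) : Enc (ModInstance 𝒢) :=
  ⟨fun x => ofModInstance x.G x.k x.M⟩

variable {𝒢 : GraphClass}

namespace PolyTime

theorem modInstance_data : PolyTime fun x : ModInstance 𝒢 => (rows x.G, x.k, mask x.M) :=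
  congr_enc id' fun x => by
    rw [enc_pair, enc_pair]
    dsimp only
    rw [enc_rows, enc_mask]
    rfl

@[fun_prop]
theorem modInstance_rows {f : α → ModInstance 𝒢} (hf : PolyTime f) :
    PolyTime fun a => rows (f a).G := (fst modInstance_data).comp hf

@[fun_prop]
theorem modInstance_k {f : α → ModInstance 𝒢} (hf : PolyTime f) :
    PolyTime fun a => (f a).k := (fst (snd modInstance_data)).comp hf

@[fun_prop]
theorem modInstance_mask {f : α → ModInstance 𝒢} (hf : PolyTime f) :
    PolyTime fun a => mask (f a).M := (snd (snd modInstance_data)).comp hf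

@[fun_prop]
theorem cone {f : α → List (List Bool) × List Bool} (hf : PolyTime f) :
    PolyTime fun a => cone (f a) := by
  unfold COC.cone; fun_prop

theorem iterate {f : α → α} (hf : PolyTime f) (n : ℕ) : PolyTime f^[n] := by
  induction n with
  | zero => exact id'
  | succ n ih => exact ih.comp hf

end PolyTime

theorem GraphClass.PolyTimeSolvable.exists_polyTime {d : ℕ} (h : 𝒢.PolyTimeSolvable d) :
    ∃ f : ClassInstance 𝒢 → Bool, PolyTime f ∧ ∀ x, f x = true ↔ IsYes d x.G x.k := by
  obtain ⟨p, T, h⟩ := h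
  choose f t ht hT hf using fun x : ClassInstance 𝒢 => h x.n x.G x.k x.mem
  exact ⟨f, ⟨p, T, fun x => ⟨t x, ht x, hT x⟩⟩, hf⟩

/-- Graphs induced by the same set of vertices are isomorphic. -/
noncomputable def comapIso {V W : Type} (G : SimpleGraph V) {φ : W → V} (hφ : φ.Injective)
    {A : Set V} (hA : Set.range φ = A) : G.comap φ ≃g G.induce A where
  toEquiv := (Equiv.ofInjective φ hφ).trans (Equiv.setCongr hA)
  map_rel_iff' := Iff.rfl

/-- The requirement on a decision procedure `Q x A j`, for `A` a set of vertices of `H = G - M`: if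
it says yes, then `H` has a solution of size at most `j` that contains `A` or is smaller than `j`,
and it says yes if `H` has a solution of size at most `j` that contains `A`. -/
def IsOracle (𝒢 : GraphClass) (d : ℕ) (Q : ModInstance 𝒢 → List Bool → ℤ → Bool) : Prop :=
  ∀ (x : ModInstance 𝒢) (A : Set (Fin x.n)) (j : ℤ), A ⊆ x.Mᶜ →
    ((∃ S ⊆ x.Mᶜ, CocOn d x.G x.Mᶜ S ∧ (S.ncard : ℤ) ≤ j ∧ A ⊆ S) → Q x (mask A) j = true) ∧
    (Q x (mask A) j = true → ∃ S ⊆ x.Mᶜ, CocOn d x.G x.Mᶜ S ∧ (S.ncard : ℤ) ≤ j ∧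
      (A ⊆ S ∨ (S.ncard : ℤ) + 1 ≤ j))

theorem isYes_mono {V : Type} {d : ℕ} {G : SimpleGraph V} {k k' : ℤ} (h : IsYes d G k)
    (hk : k ≤ k') : IsYes d G k' := by
  obtain ⟨S, hS, h⟩ := h
  exact ⟨S, hS, h.trans hk⟩

/-- In `𝒢 + d`, a clique of `d` new vertices forces `A` into a solution unless it contains one of the
new vertices. -/
theorem exists_oracle_of_plus {d : ℕ} (h : (𝒢.plus d).PolyTimeSolvable d) :
    ∃ Q : ModInstance 𝒢 → List Bool → ℤ → Bool,
      (PolyTime fun z : ModInstance 𝒢 × List Bool × ℤ => Q z.1 z.2.1 z.2.2) ∧ IsOracle 𝒢 d Q := by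
  obtain ⟨f, hf, hfd⟩ := h.exists_polyTime
  let g : ModInstance 𝒢 × List Bool × ℤ → List (List Bool) × ℤ := fun z =>
    ((COC.cone^[d] (selectMatrix (maskNot (mask z.1.M)) (rows z.1.G),
      select (maskNot (mask z.1.M)) (fit (mask z.1.M) z.2.1))).1, z.2.2)
  have hg : PolyTime g := by
    have h1 : PolyTime COC.cone^[d] := PolyTime.iterate (by fun_prop) d
    unfold g
    fun_prop
  have key : ∀ z : ModInstance 𝒢 × List Bool × ℤ, ∃ I : ClassInstance (𝒢.plus d),
      enc I = enc (g z) ∧ ∀ A ⊆ z.1.Mᶜ, z.2.1 = mask A →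
        ((∃ S ⊆ z.1.Mᶜ, CocOn d z.1.G z.1.Mᶜ S ∧ (S.ncard : ℤ) ≤ z.2.2 ∧ A ⊆ S) →
          IsYes d I.G I.k) ∧
        (IsYes d I.G I.k → ∃ S ⊆ z.1.Mᶜ, CocOn d z.1.G z.1.Mᶜ S ∧ (S.ncard : ℤ) ≤ z.2.2 ∧
          (A ⊆ S ∨ (S.ncard : ℤ) + 1 ≤ z.2.2)) := by
    rintro ⟨x, y, j⟩
    obtain ⟨B, hBM, hB⟩ := exists_fit x.M y
    obtain ⟨n₁, φ, hφ, hsel⟩ := exists_select x.Mᶜ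
    obtain ⟨n₂, H, ψ, hH, he⟩ := exists_join d (x.G.comap φ) (φ ⁻¹' B)
    refine ⟨⟨n₂, H, j, (Set.range ψ)ᶜ, hH.card, ?_⟩, ?_, ?_⟩
    · have e₁ := comapIso H hH.inj (compl_compl (Set.range ψ)).symm
      rw [hH.comap] at e₁
      exact 𝒢.iso (((comapIso x.G φ.injective hφ).symm).trans e₁) x.mem
    · change ofInstance H j = enc (g (x, y, j))
      simp only [g]
      rw [hB, maskNot_mask, selectMatrix_rows hsel, select_mask hsel, he, enc_pair]
      dsimp only
      rw [enc_rows]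
      rfl
    · rintro A hA (hy : y = mask A)
      obtain rfl : A = B := by
        apply mask_injective
        rw [← hB, hy]
        exact (fit_mask hA).symm
      dsimp only
      constructor
      · rintro ⟨S, hSM, hS, hj, hAS⟩
        obtain ⟨S, rfl⟩ := Set.subset_range_iff_exists_image_eq.1 (hφ ▸ hSM)
        rw [Set.ncard_image_of_injective _ φ.injective] at hj
        refine isYes_mono (hH.isYes (S := S) ?_ ?_) hj
        · rwa [cocOn_comap φ.injective, Set.image_univ, hφ]
        · intro v hv
          obtain ⟨w, hw, hwv⟩ := hAS hv
          rwa [← φ.injective hwv]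
      · intro hyes
        obtain ⟨S, hS, hj, h⟩ := hH.exists_of_isYes hyes
        refine ⟨φ '' S, hφ ▸ Set.image_subset_range _ _, ?_, ?_, ?_⟩
        · rwa [cocOn_comap φ.injective, Set.image_univ, hφ] at hS
        · rwa [Set.ncard_image_of_injective _ φ.injective]
        · rw [Set.ncard_image_of_injective _ φ.injective]
          refine h.imp_left fun hAS a ha => ?_
          have : a ∈ Set.range φ := hφ ▸ hA ha
          obtain ⟨v, rfl⟩ := this
          exact ⟨v, hAS ha, rfl⟩
  choose I hI hspec using key
  refine ⟨fun x y j => f (I (x, y, j)), hf.comp (hg.congr_enc hI), fun x A j hA => ?_⟩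
  rw [hfd]
  exact hspec (x, mask A, j) A hA rfl

/-- If `𝒢` is hereditary, then `A` is deleted and subtracted from the budget. -/
theorem exists_oracle_of_hereditary {d : ℕ} (h : 𝒢.PolyTimeSolvable d) (her : 𝒢.Hereditary) :
    ∃ Q : ModInstance 𝒢 → List Bool → ℤ → Bool,
      (PolyTime fun z : ModInstance 𝒢 × List Bool × ℤ => Q z.1 z.2.1 z.2.2) ∧ IsOracle 𝒢 d Q := by
  obtain ⟨f, hf, hfd⟩ := h.exists_polyTime
  let g : ModInstance 𝒢 × List Bool × ℤ → List (List Bool) × ℤ := fun z =>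
    (selectMatrix (maskNot (maskOr (mask z.1.M) (fit (mask z.1.M) z.2.1))) (rows z.1.G),
      z.2.2 - (fit (mask z.1.M) z.2.1).count true)
  have hg : PolyTime g := by
    unfold g
    fun_prop
  have key : ∀ z : ModInstance 𝒢 × List Bool × ℤ, ∃ I : ClassInstance 𝒢,
      enc I = enc (g z) ∧ ∀ A ⊆ z.1.Mᶜ, z.2.1 = mask A →
        (IsYes d I.G I.k ↔
          ∃ S ⊆ z.1.Mᶜ, CocOn d z.1.G z.1.Mᶜ S ∧ (S.ncard : ℤ) ≤ z.2.2 ∧ A ⊆ S) := by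
    rintro ⟨x, y, j⟩
    obtain ⟨B, hBM, hB⟩ := exists_fit x.M y
    obtain ⟨n₁, φ, hφ, hsel⟩ := exists_select (x.M ∪ B)ᶜ
    refine ⟨⟨n₁, x.G.comap φ, j - B.ncard, ?_⟩, ?_, ?_⟩
    · have h1 := her _ _ x.mem (Subtype.val ⁻¹' (Set.range φ))
      have hφM : ∀ i, φ i ∈ x.Mᶜ := fun i hi => by
        have h2 : φ i ∈ (x.M ∪ B)ᶜ := hφ ▸ Set.mem_range_self i
        exact h2 (Or.inl hi)
      have e := comapIso (del x.G x.M) (φ := fun i => (⟨φ i, hφM i⟩ : ↥(x.Mᶜ)))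
        (fun i i' hii => φ.injective (congrArg Subtype.val hii))
        (A := Subtype.val ⁻¹' (Set.range φ)) (by
          ext ⟨v, hv⟩
          simp [Subtype.ext_iff])
      exact 𝒢.iso e.symm h1
    · change ofInstance _ _ = enc (g (x, y, j))
      simp only [g]
      rw [hB, maskOr_mask, maskNot_mask, selectMatrix_rows hsel, count_mask, enc_pair]
      dsimp only
      rw [enc_rows]
      rfl
    · rintro A hA (hy : y = mask A)
      obtain rfl : A = B := by
        apply mask_injective
        rw [← hB, hy]
        exact (fit_mask hA).symm
      dsimp only
      rw [isYes_comap φ.injective, hφ]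
      constructor
      · rintro ⟨S, hS, hSc, hj⟩
        refine ⟨S ∪ A, Set.union_subset (fun v hv hvM => hS hv (Or.inl hvM)) hA, hSc.mono ?_, ?_,
          Set.subset_union_right⟩
        · rintro v ⟨hvM, hv⟩
          exact ⟨fun h => h.elim hvM fun hvA => hv (Or.inr hvA), fun hvS => hv (Or.inl hvS)⟩
        · have := Set.ncard_union_le S A
          omega
      · rintro ⟨S, hS, hSc, hj, hAS⟩
        refine ⟨S \ A, ?_, hSc.mono ?_, ?_⟩
        · rintro v ⟨hvS, hvA⟩ (h | h)
          · exact hS hvS h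
          · exact hvA h
        · rintro v ⟨hv, hv'⟩
          exact ⟨fun h => hv (Or.inl h), fun hvS => hv' ⟨hvS, fun hvA => hv (Or.inr hvA)⟩⟩
        · have := Set.ncard_sdiff_add_ncard_of_subset hAS
          omega
  choose I hI hspec using key
  refine ⟨fun x y j => f (I (x, y, j)), hf.comp (hg.congr_enc hI), fun x A j hA => ?_⟩
  have h1 := hspec (x, mask A, j) A hA rfl
  rw [hfd, h1]
  exact ⟨id, fun ⟨S, h2, h3, h4, h5⟩ => ⟨S, h2, h3, h4, Or.inl h5⟩⟩

/-! ### The auction -/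

section Auction

variable {ρ : Type}

/-- Whether a number in unary is smaller than another. -/
def shorter (a b : List Unit) : Bool := !(a.foldl (fun s _ => s.tail) b).isEmpty

theorem shorter_iff {a b : List Unit} : shorter a b = true ↔ a.length < b.length := by
  have : a.foldl (fun s _ => s.tail) b = b.drop a.length := by
    induction a generalizing b with
    | nil => simp
    | cons x a ih => simp [ih]
  simp [shorter, this]

theorem shorter_eq_false_iff {a b : List Unit} : shorter a b = false ↔ b.length ≤ a.length := by
  rw [← Bool.not_eq_true, shorter_iff, not_lt]

/-- A bidder: its name and for each slot, whether it is interested in the slot. -/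
abbrev Bidder (ρ : Type) := ρ × List Bool

/-- A slot: its price in unary and its holder, if there is one. -/
abbrev Slot (ρ : Type) := List Unit × List (Bidder ρ)

/-- The lowest price of the marked slots, cut at `L`. -/
def minPrice (L : List Unit) (zs : List (Bool × Slot ρ)) : List Unit :=
  zs.foldr (fun z m => bif z.1 && shorter z.2.1 m then z.2.1 else m) L

/-- One marked slot of price `m` is given to `C`, for a price that is larger by one. The result
consists of `C`, if there is no such slot, the new slots and the old holder of the slot. -/
def place (m : List Unit) (C : Bidder ρ) (zs : List (Bool × Slot ρ)) :
    List (Bidder ρ) × List (Slot ρ) × List (Bidder ρ) :=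
  zs.foldr (fun z s =>
    bif z.1 && (!shorter z.2.1 m) && (!shorter m z.2.1) && !s.1.isEmpty then
      ([], (() :: z.2.1, s.1) :: s.2.1, z.2.2)
    else (s.1, z.2 :: s.2.1, s.2.2)) ([C], [], [])

/-- One step of the auction, on the bidders that wait, the slots, and the bidders that have given
up: the first waiting bidder takes a cheapest slot it is interested in, whose holder has to wait
again, and gives up if the price of all these slots exceeds the number of slots. -/
def auctionStep (s : List (Bidder ρ) × List (Slot ρ) × List (Bidder ρ)) :
    List (Bidder ρ) × List (Slot ρ) × List (Bidder ρ) :=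
  match s.1 with
  | [] => s
  | C :: rest =>
    let p := place (minPrice (s.2.1.map fun _ => ()) (C.2.zip s.2.1)) C (C.2.zip s.2.1)
    (p.2.2 ++ rest, p.2.1, p.1 ++ s.2.2)

/-- The auction of as many slots as the given list has elements. -/
def auction {ε : Type} (bidders : List (Bidder ρ)) (l : List ε) :
    List (Bidder ρ) × List (Slot ρ) × List (Bidder ρ) :=
  ((bidders.map fun _ => ()) ++ (() :: l.map fun _ => ()).flatMap fun _ => l.map fun _ => ()).foldl
    (fun s _ => auctionStep s) (bidders, l.map fun _ => ([], []), [])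

theorem minPrice_spec (L : List Unit) (zs : List (Bool × Slot ρ)) :
    (minPrice L zs).length ≤ L.length ∧
      (∀ z ∈ zs, z.1 = true → (minPrice L zs).length ≤ z.2.1.length) ∧
      ((minPrice L zs).length = L.length ∨
        ∃ z ∈ zs, z.1 = true ∧ z.2.1.length = (minPrice L zs).length) := by
  induction zs with
  | nil => simp [minPrice]
  | cons z zs ih =>
    obtain ⟨h1, h2, h3⟩ := ih
    have he : minPrice L (z :: zs) =
      bif z.1 && shorter z.2.1 (minPrice L zs) then z.2.1 else minPrice L zs := rfl
    rw [he]
    cases h : z.1 && shorter z.2.1 (minPrice L zs)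
    · simp only [cond_false]
      refine ⟨h1, ?_, h3.imp_right ?_⟩
      · intro z' hz' hz'1
        rcases List.mem_cons.1 hz' with rfl | hz'
        · rw [hz'1, Bool.true_and, shorter_eq_false_iff] at h
          exact h
        · exact h2 z' hz' hz'1
      · rintro ⟨z', hz', h⟩
        exact ⟨z', List.mem_cons_of_mem _ hz', h⟩
    · simp only [cond_true]
      rw [Bool.and_eq_true, shorter_iff] at h
      refine ⟨by omega, ?_, Or.inr ⟨z, List.mem_cons_self, h.1, rfl⟩⟩
      intro z' hz' hz'1
      rcases List.mem_cons.1 hz' with rfl | hz'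
      · exact le_rfl
      · have := h2 z' hz' hz'1
        omega

theorem place_spec (m : List Unit) (C : Bidder ρ) (zs : List (Bool × Slot ρ)) :
    (place m C zs = ([C], zs.map Prod.snd, []) ∧
      ∀ z ∈ zs, z.1 = true → z.2.1.length ≠ m.length) ∨
    ∃ (i : ℕ) (p : List Unit) (h : List (Bidder ρ)), zs[i]? = some (true, p, h) ∧
      p.length = m.length ∧ place m C zs = ([], (zs.map Prod.snd).set i (() :: p, [C]), h) := by
  induction zs with
  | nil => left; simp [place]
  | cons z zs ih =>
    have he : place m C (z :: zs) =
      bif z.1 && (!shorter z.2.1 m) && (!shorter m z.2.1) && !(place m C zs).1.isEmpty then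
        ([], (() :: z.2.1, (place m C zs).1) :: (place m C zs).2.1, z.2.2)
      else ((place m C zs).1, z.2 :: (place m C zs).2.1, (place m C zs).2.2) := rfl
    rcases ih with ⟨h1, h2⟩ | ⟨i, p, h, h1, h2, h3⟩
    · rw [h1] at he
      cases hz : z.1 && (!shorter z.2.1 m) && (!shorter m z.2.1)
      · left
        simp only [hz, Bool.false_and, cond_false] at he
        refine ⟨by simpa using he, ?_⟩
        intro z' hz' hz'1
        rcases List.mem_cons.1 hz' with rfl | hz'
        · intro h
          have h4 : shorter z'.2.1 m = false := shorter_eq_false_iff.2 h.ge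
          have h5 : shorter m z'.2.1 = false := shorter_eq_false_iff.2 h.le
          simp [hz'1, h4, h5] at hz
        · exact h2 z' hz' hz'1
      · right
        simp only [hz, List.isEmpty_cons, Bool.not_false, Bool.and_true, cond_true] at he
        simp only [Bool.and_eq_true, Bool.not_eq_true', shorter_eq_false_iff] at hz
        refine ⟨0, z.2.1, z.2.2, ?_, by omega, by simpa using he⟩
        rw [List.getElem?_cons_zero, ← hz.1.1]
    · right
      rw [h3] at he
      exact ⟨i + 1, p, h, by simpa using h1, h2, by simpa using he⟩

/-- What holds during the auction. -/
structure AuctionInv (bidders : List (Bidder ρ)) (n : ℕ)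
    (s : List (Bidder ρ) × List (Slot ρ) × List (Bidder ρ)) : Prop where
  length : s.2.1.length = n
  perm : List.Perm (s.1 ++ s.2.1.flatMap Prod.snd ++ s.2.2) bidders
  price_le : ∀ x ∈ s.2.1, x.1.length ≤ n + 1
  holder_le : ∀ x ∈ s.2.1, x.2.length ≤ 1
  holder_ne : ∀ x ∈ s.2.1, x.1 ≠ [] → x.2 ≠ []
  holder : ∀ (i : ℕ) (p : List Unit) (h : List (Bidder ρ)), s.2.1[i]? = some (p, h) →
    ∀ r ∈ h, r.2[i]? = some true ∧
    ∀ (j : ℕ) (p' : List Unit) (h' : List (Bidder ρ)), s.2.1[j]? = some (p', h') → r.2[j]? = some true → p.length ≤ p'.length + 1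
  given_up : ∀ r ∈ s.2.2, ∀ (j : ℕ) (p' : List Unit) (h' : List (Bidder ρ)), s.2.1[j]? = some (p', h') → r.2[j]? = some true →
    n < p'.length

theorem perm_flatMap_set {X : List (Slot ρ)} {i : ℕ} {p : List Unit} {h : List (Bidder ρ)}
    (hi : X[i]? = some (p, h)) (p' : List Unit) (h' : List (Bidder ρ)) :
    List.Perm (h ++ (X.set i (p', h')).flatMap Prod.snd) (h' ++ X.flatMap Prod.snd) := by
  induction X generalizing i with
  | nil => simp at hi
  | cons x X ih =>
    cases i with
    | zero =>
      simp only [List.getElem?_cons_zero, Option.some.injEq] at hi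
      subst hi
      simp only [List.set_cons_zero, List.flatMap_cons]
      exact List.perm_append_comm_assoc _ _ _
    | succ i =>
      simp only [List.getElem?_cons_succ] at hi
      simp only [List.set_cons_succ, List.flatMap_cons]
      refine (List.perm_append_comm_assoc _ _ _).trans ?_
      refine ((ih hi).append_left _).trans ?_
      exact List.perm_append_comm_assoc _ _ _

/-- The price that is still left until all bidders give up, and the number of waiting bidders. -/
def potential (n : ℕ) (s : List (Bidder ρ) × List (Slot ρ) × List (Bidder ρ)) : ℕ :=
  s.1.length + (s.2.1.map fun x => n + 1 - x.1.length).sum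

theorem sum_map_set {τ : Type} (f : τ → ℕ) {X : List τ} {i : ℕ} {x : τ} (hi : X[i]? = some x) (y : τ) :
    ((X.set i y).map f).sum + f x = (X.map f).sum + f y := by
  induction X generalizing i with
  | nil => simp at hi
  | cons z X ih =>
    cases i with
    | zero =>
      simp only [List.getElem?_cons_zero, Option.some.injEq] at hi
      subst hi
      simp; omega
    | succ i =>
      have := ih (by simpa using hi)
      simp only [List.set_cons_succ, List.map_cons, List.sum_cons]
      omega

theorem AuctionInv.step {bidders : List (Bidder ρ)} {n : ℕ} (hn : ∀ r ∈ bidders, r.2.length = n)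
    {s : List (Bidder ρ) × List (Slot ρ) × List (Bidder ρ)} (h : AuctionInv bidders n s) :
    AuctionInv bidders n (auctionStep s) ∧
      (s.1 ≠ [] → potential n (auctionStep s) < potential n s) := by
  obtain ⟨queue, X, D⟩ := s
  cases queue with
  | nil => exact ⟨h, fun h => absurd rfl h⟩
  | cons C rest =>
    obtain ⟨hlen, hperm, hprice, hone, hne, hhold, hup⟩ := h
    dsimp only at *
    have hC : C.2.length = X.length := by
      rw [hn C (hperm.subset (by simp)), hlen]
    set m := minPrice (X.map fun _ => ()) (C.2.zip X) with hm
    have hstep : auctionStep (C :: rest, X, D) =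
      ((place m C (C.2.zip X)).2.2 ++ rest, (place m C (C.2.zip X)).2.1,
        (place m C (C.2.zip X)).1 ++ D) := rfl
    obtain ⟨hm1, hm2, hm3⟩ := minPrice_spec (X.map fun _ => ()) (C.2.zip X)
    rw [← hm, List.length_map, hlen] at hm1
    rw [← hm, List.length_map, hlen] at hm3
    rw [← hm] at hm2
    have hzip : (C.2.zip X).map Prod.snd = X := List.map_snd_zip hC.ge
    have hmin : ∀ (j : ℕ) (p' : List Unit) (h' : List (Bidder ρ)), X[j]? = some (p', h') → C.2[j]? = some true → m.length ≤ p'.length := by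
      intro j p' h' hj hCj
      refine hm2 (true, p', h') ?_ rfl
      refine List.mem_of_getElem? (i := j) ?_
      rw [List.getElem?_zip_eq_some]
      exact ⟨hCj, hj⟩
    rcases place_spec m C (C.2.zip X) with ⟨h1, h2⟩ | ⟨i, p, h, h1, h2, h3⟩
    · rw [hstep, h1]
      dsimp only
      rw [hzip]
      refine ⟨⟨hlen, ?_, hprice, hone, hne, hhold, ?_⟩, fun _ => ?_⟩
      · refine List.Perm.trans ?_ hperm
        dsimp only
        simp only [List.nil_append, List.cons_append]
        exact List.perm_middle
      · intro r hr j p' h' hj hrj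
        rcases List.mem_cons.1 hr with rfl | hr
        · have h4 := hmin j p' h' hj hrj
          have h5 : p'.length ≠ m.length := by
            refine h2 (true, p', h') ?_ rfl
            refine List.mem_of_getElem? (i := j) ?_
            rw [List.getElem?_zip_eq_some]
            exact ⟨hrj, hj⟩
          rcases hm3 with h6 | ⟨z, hz, hz1, hz2⟩
          · omega
          · exact absurd hz2 (h2 z hz hz1)
        · exact hup r hr j p' h' hj hrj
      · simp [potential]
    · rw [List.getElem?_zip_eq_some] at h1
      obtain ⟨hCi, hXi⟩ := h1
      have hmem := List.mem_of_getElem? hXi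
      have hi : i < X.length := (List.getElem?_eq_some_iff.1 hXi).1
      rw [hstep, h3]
      dsimp only
      rw [hzip]
      -- prices only rise
      have hmono : ∀ (j : ℕ) (p' : List Unit) (h' : List (Bidder ρ)),
          (X.set i (() :: p, [C]))[j]? = some (p', h') →
          ∃ p'' h'', X[j]? = some (p'', h'') ∧ p''.length ≤ p'.length := by
        intro j p' h' hj
        rw [List.getElem?_set] at hj
        split_ifs at hj with hij
        · subst hij
          simp only [Option.some.injEq, Prod.mk.injEq] at hj
          exact ⟨p, h, hXi, by simp [← hj.1]⟩
        · exact ⟨p', h', hj, le_rfl⟩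
      have hset : ∀ x ∈ X.set i (() :: p, [C]), x = (() :: p, [C]) ∨ x ∈ X := fun x hx =>
        (List.mem_or_eq_of_mem_set hx).symm
      refine ⟨⟨by simpa using hlen, ?_, ?_, ?_, ?_, ?_, ?_⟩, fun _ => ?_⟩
      · refine List.Perm.trans ?_ hperm
        dsimp only
        rw [List.nil_append]
        refine List.Perm.append_right D ?_
        have := perm_flatMap_set hXi (() :: p) [C]
        calc List.Perm (h ++ rest ++ (X.set i (() :: p, [C])).flatMap Prod.snd)
              (rest ++ (h ++ (X.set i (() :: p, [C])).flatMap Prod.snd)) := by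
              rw [List.append_assoc]
              exact List.perm_append_comm_assoc _ _ _
          _ |>.Perm (rest ++ ([C] ++ X.flatMap Prod.snd)) := this.append_left _
          _ |>.Perm (C :: rest ++ X.flatMap Prod.snd) := by
              rw [← List.append_assoc]
              exact List.Perm.append_right _ List.perm_append_comm
      · intro x hx
        rcases hset x hx with rfl | hx
        · simp; omega
        · exact hprice x hx
      · intro x hx
        rcases hset x hx with rfl | hx
        · simp
        · exact hone x hx
      · intro x hx
        rcases hset x hx with rfl | hx
        · simp
        · exact hne x hx
      · intro k p₁ h₁ hk r hr
        dsimp only at hk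
        have hk' := hk
        rw [List.getElem?_set] at hk
        split_ifs at hk with hik
        · subst hik
          simp only [Option.some.injEq, Prod.mk.injEq] at hk
          obtain ⟨rfl, rfl⟩ := hk
          rw [List.mem_singleton] at hr
          subst hr
          refine ⟨hCi, fun j p' h' hj hrj => ?_⟩
          obtain ⟨p'', h'', hj', hle⟩ := hmono j p' h' hj
          have := hmin j p'' h'' hj' hrj
          simp; omega
        · obtain ⟨h4, h5⟩ := hhold k p₁ h₁ hk r hr
          refine ⟨h4, fun j p' h' hj hrj => ?_⟩
          obtain ⟨p'', h'', hj', hle⟩ := hmono j p' h' hj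
          have := h5 j p'' h'' hj' hrj
          omega
      · intro r hr j p' h' hj hrj
        obtain ⟨p'', h'', hj', hle⟩ := hmono j p' h' hj
        have := hup r hr j p'' h'' hj' hrj
        omega
      · have h4 := sum_map_set (fun x : Slot ρ => n + 1 - x.1.length) hXi (() :: p, [C])
        have h5 := hone _ hmem
        simp only [potential, List.length_append, List.length_cons] at *
        omega

/-- When the auction has ended, there is a set `R` of slots, those above a gap in the prices, such
that the bidders who have given up are interested in slots of `R` only, and each slot of `R` has a
holder of its own, who is interested in this slot and otherwise in slots of `R` only. -/
theorem auction_spec {ε : Type} {bidders : List (Bidder ρ)} (hnd : bidders.Nodup) (l : List ε)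
    (hn : ∀ r ∈ bidders, r.2.length = l.length) :
    ∃ (H : List (Bidder ρ)) (R : Set ℕ) (ν : R → Bidder ρ),
      List.Perm (H ++ (auction bidders l).2.2) bidders ∧ H.length ≤ l.length ∧
      (∀ r ∈ (auction bidders l).2.2, ∀ j, r.2[j]? = some true → j ∈ R) ∧
      (∀ j, ν j ∈ H ∧ (ν j).2[j.1]? = some true ∧ ∀ j', (ν j).2[j']? = some true → j' ∈ R) ∧
      ν.Injective := by
  set n := l.length with hnl
  -- the potential bounds the number of steps until no bidder waits
  have hend : AuctionInv bidders n (auction bidders l) ∧ (auction bidders l).1 = [] := by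
    have key : ∀ (t : List Unit) s, AuctionInv bidders n s → (s.1 ≠ [] → potential n s ≤ t.length) →
        AuctionInv bidders n (t.foldl (fun s _ => auctionStep s) s) ∧
          (t.foldl (fun s _ => auctionStep s) s).1 = [] := by
      intro t
      induction t with
      | nil =>
        intro s hs h
        refine ⟨hs, ?_⟩
        by_contra hq
        have := h hq
        simp only [potential, List.length_nil, Nat.le_zero, Nat.add_eq_zero_iff] at this
        exact hq (List.eq_nil_of_length_eq_zero this.1)
      | cons u t ih =>
        intro s hs h
        obtain ⟨h1, h2⟩ := hs.step hn
        refine ih _ h1 fun hq' => ?_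
        by_cases hq : s.1 = []
        · have : auctionStep s = s := by
            unfold auctionStep
            rw [hq]
          change (auctionStep s).1 ≠ [] at hq'
          exact absurd hq (this ▸ hq')
        · have h3 := h2 hq
          have h4 := h hq
          simp only [List.length_cons] at h4
          change potential n (auctionStep s) ≤ t.length
          omega
    have hinit : ∀ x ∈ l.map fun _ => (([], []) : Slot ρ), x = ([], []) := by simp
    refine key _ _ ⟨by simp [hnl], ?_, ?_, ?_, ?_, ?_, ?_⟩ fun _ => ?_
    · have : (l.map fun _ => (([], []) : Slot ρ)).flatMap Prod.snd = [] := by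
        rw [List.flatMap_eq_nil_iff]
        intro x hx
        rw [hinit x hx]
      simp only [this, List.append_nil]
      exact List.Perm.refl _
    · intro x hx
      simp [hinit x hx]
    · intro x hx
      simp [hinit x hx]
    · intro x hx
      simp [hinit x hx]
    · intro i p h hi r hr
      have := hinit _ (List.mem_of_getElem? hi)
      simp only [Prod.mk.injEq] at this
      simp [this.2] at hr
    · simp
    · simp only [potential, List.length_append, List.length_flatMap, List.map_const',
        List.map_replicate, List.sum_replicate, List.length_replicate, List.map_cons,
        List.sum_cons, List.length_nil, Nat.sub_zero, smul_eq_mul, ← hnl]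
      rw [Nat.mul_succ]
      omega
  obtain ⟨⟨hlen, hperm, hprice, hone, hne, hhold, hup⟩, hq⟩ := hend
  set X := (auction bidders l).2.1
  set D := (auction bidders l).2.2
  rw [hq, List.nil_append] at hperm
  have hHnd : (X.flatMap Prod.snd).Nodup :=
    ((List.nodup_append.1 ((List.Perm.nodup_iff hperm).2 hnd))).1
  -- `n` slots leave one of the prices `0, …, n` unused
  obtain ⟨g, hg, hgX⟩ : ∃ g ∈ Finset.range (n + 1), g ∉ (X.map fun x => x.1.length).toFinset := by
    refine Finset.exists_mem_notMem_of_card_lt_card ?_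
    refine (List.toFinset_card_le _).trans_lt ?_
    simp [hlen]
  rw [Finset.mem_range] at hg
  have hgap : ∀ x ∈ X, x.1.length ≠ g := fun x hx he =>
    hgX (List.mem_toFinset.2 (List.mem_map.2 ⟨x, hx, he⟩))
  let R : Set ℕ := {j | ∃ p h, X[j]? = some (p, h) ∧ g < p.length}
  -- a bidder who is interested in a slot of price at least `g` only, is interested in `R` only
  have hR : ∀ r ∈ bidders, (∀ (j : ℕ) (p : List Unit) (h : List (Bidder ρ)), X[j]? = some (p, h) →
      r.2[j]? = some true → g ≤ p.length) → ∀ j, r.2[j]? = some true → j ∈ R := by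
    intro r hr h j hrj
    have hj : j < X.length := by
      rw [hlen, ← hn r hr]
      exact (List.getElem?_eq_some_iff.1 hrj).1
    have hXj : X[j]? = some (X[j].1, X[j].2) := by simp [hj]
    refine ⟨_, _, hXj, lt_of_le_of_ne (h j _ _ hXj hrj) (hgap _ (List.getElem_mem hj)).symm⟩
  have hν : ∀ j : R, ∃ r : Bidder ρ, ∃ p h, X[j.1]? = some (p, h) ∧ g < p.length ∧ r ∈ h := by
    rintro ⟨j, p, h, hj, hp⟩
    have hne := hne _ (List.mem_of_getElem? hj) (by rintro rfl; simp at hp)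
    obtain ⟨r, hr⟩ := List.exists_mem_of_ne_nil _ hne
    exact ⟨r, p, h, hj, hp, hr⟩
  choose ν p h hX hp hh using hν
  have hνmem : ∀ j, ν j ∈ X.flatMap Prod.snd := fun j =>
    List.mem_flatMap.2 ⟨_, List.mem_of_getElem? (hX j), hh j⟩
  refine ⟨X.flatMap Prod.snd, R, ν, hperm, ?_, ?_, ?_, ?_⟩
  · rw [List.length_flatMap, ← hlen]
    refine (List.sum_le_card_nsmul _ 1 ?_).trans (by simp)
    intro m hm
    obtain ⟨x, hx, rfl⟩ := List.mem_map.1 hm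
    exact hone x hx
  · intro r hr
    refine hR r (hperm.subset (List.mem_append_right _ hr)) fun j p h hj hrj => ?_
    have := hup r hr j p h hj hrj
    omega
  · intro j
    obtain ⟨h1, h2⟩ := hhold _ _ _ (hX j) _ (hh j)
    refine ⟨hνmem j, h1, hR _ (hperm.subset (List.mem_append_left _ (hνmem j))) ?_⟩
    intro j' p' h' hj' hrj'
    have h3 := h2 j' p' h' hj' hrj'
    have h4 := hp j
    omega
  · intro i j hij
    by_contra hne
    have h1 := (List.nodup_flatMap.1 hHnd).2
    rw [List.pairwise_iff_getElem] at h1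
    have key : ∀ i j : R, ν i = ν j → ¬ i.1 < j.1 := by
      intro i j hij hlt
      obtain ⟨hi', hi⟩ := List.getElem?_eq_some_iff.1 (hX i)
      obtain ⟨hj', hj⟩ := List.getElem?_eq_some_iff.1 (hX j)
      have h2 := h1 i.1 j.1 hi' hj' hlt
      simp only [Function.onFun, hi, hj] at h2
      exact h2 (hh i) (hij ▸ hh j)
    exact hne (Subtype.ext (le_antisymm (not_lt.1 (key j i hij.symm)) (not_lt.1 (key i j hij))))

end Auction

theorem sz_place_le (m : List Unit) (C : Bidder α) (zs : List (Bool × Slot α)) :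
    sz (place m C zs).1 + sz (place m C zs).2.1 + sz (place m C zs).2.2 ≤
      sz C + sz (zs.map Prod.snd) + 10 := by
  -- the bonus pays for the single step at which the slot is found
  suffices sz (place m C zs).1 + sz (place m C zs).2.1 + sz (place m C zs).2.2 +
      (bif (place m C zs).1.isEmpty then 0 else 5) ≤ sz C + sz (zs.map Prod.snd) + 10 by omega
  induction zs with
  | nil => simp [place]
  | cons z zs ih =>
    have he : place m C (z :: zs) =
      bif z.1 && (!shorter z.2.1 m) && (!shorter m z.2.1) && !(place m C zs).1.isEmpty then
        ([], (() :: z.2.1, (place m C zs).1) :: (place m C zs).2.1, z.2.2)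
      else ((place m C zs).1, z.2 :: (place m C zs).2.1, (place m C zs).2.2) := rfl
    have h1 := sz_pos (place m C zs).2.2
    have h2 : sz () = 1 := rfl
    cases h : z.1 && (!shorter z.2.1 m) && (!shorter m z.2.1) && !(place m C zs).1.isEmpty
    · rw [he, h]
      simp only [cond_false, List.map_cons, sz_cons]
      omega
    · rw [he, h]
      rw [Bool.and_eq_true, Bool.not_eq_true'] at h
      rw [h.2] at ih
      simp only [cond_true, cond_false, List.map_cons, sz_cons, sz_pair, sz_nil, List.isEmpty_nil] at *
      omega

namespace PolyTime

@[fun_prop]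
theorem shorter {f g : α → List Unit} (hf : PolyTime f) (hg : PolyTime g) :
    PolyTime fun a => shorter (f a) (g a) := by
  have := foldl (step := fun _ s _ => s.tail) hf hg (by fun_prop) 0 (by
    intro a s c
    cases s <;> simp
    omega)
  unfold COC.shorter
  fun_prop

@[fun_prop]
theorem minPrice {f : α → List Unit} {g : α → List (Bool × Slot β)} (hf : PolyTime f)
    (hg : PolyTime g) : PolyTime fun a => minPrice (f a) (g a) := by
  refine foldr (step := fun _ z m => bif z.1 && COC.shorter z.2.1 m then z.2.1 else m) hg hf
    (by fun_prop) .X ?_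
  intro a z m
  cases z.1 && COC.shorter z.2.1 m
  · simp
  · have : sz z = sz z.1 + sz z.2 + 1 := rfl
    have : sz z.2 = sz z.2.1 + sz z.2.2 + 1 := rfl
    simp
    omega

@[fun_prop]
theorem place {f : α → List Unit} {C : α → Bidder β} {g : α → List (Bool × Slot β)}
    (hf : PolyTime f) (hC : PolyTime C) (hg : PolyTime g) :
    PolyTime fun a => place (f a) (C a) (g a) := by
  refine foldr (init := fun a => ([C a], [], [])) (step := fun a z s =>
    bif z.1 && (!COC.shorter z.2.1 (f a)) && (!COC.shorter (f a) z.2.1) && !s.1.isEmpty then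
      ([], (() :: z.2.1, s.1) :: s.2.1, z.2.2)
    else (s.1, z.2 :: s.2.1, s.2.2)) hg (by fun_prop) (by fun_prop) (.X + 10) ?_
  intro a z s
  have h1 : sz z = sz z.1 + sz z.2 + 1 := rfl
  have h2 : sz z.2 = sz z.2.1 + sz z.2.2 + 1 := rfl
  have h3 : sz s = sz s.1 + sz s.2 + 1 := rfl
  have h4 : sz s.2 = sz s.2.1 + sz s.2.2 + 1 := rfl
  have h5 : sz () = 1 := rfl
  cases z.1 && (!COC.shorter z.2.1 (f a)) && (!COC.shorter (f a) z.2.1) && !s.1.isEmpty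
  · simp only [cond_false, sz_pair, sz_cons, Polynomial.eval_add, Polynomial.eval_X,
      Polynomial.eval_ofNat] at *
    omega
  · simp only [cond_true, sz_pair, sz_cons, sz_nil, Polynomial.eval_add, Polynomial.eval_X,
      Polynomial.eval_ofNat] at *
    omega

theorem auctionStep' :
    PolyTime (auctionStep : List (Bidder β) × List (Slot β) × List (Bidder β) → _) := by
  have h := list_cases (f := fun s : List (Bidder β) × List (Slot β) × List (Bidder β) => s.1)
    (g := fun s => s) (h := fun s C rest =>
      ((COC.place (COC.minPrice (s.2.1.map fun _ => ()) (C.2.zip s.2.1)) C (C.2.zip s.2.1)).2.2 ++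
        rest,
      (COC.place (COC.minPrice (s.2.1.map fun _ => ()) (C.2.zip s.2.1)) C (C.2.zip s.2.1)).2.1,
      (COC.place (COC.minPrice (s.2.1.map fun _ => ()) (C.2.zip s.2.1)) C (C.2.zip s.2.1)).1 ++
        s.2.2)) (by fun_prop) (by fun_prop) (by fun_prop)
  refine h.congr_enc fun s => ?_
  obtain ⟨_ | ⟨C, rest⟩, X, D⟩ := s <;> rfl

@[fun_prop]
theorem auction {f : α → List (Bidder β)} {g : α → List γ} (hf : PolyTime f) (hg : PolyTime g) :
    PolyTime fun a => auction (f a) (g a) := by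
  have hstep : PolyTime fun x : α × (List (Bidder β) × List (Slot β) × List (Bidder β)) × Unit =>
      auctionStep x.2.1 := auctionStep'.comp (by fun_prop)
  refine foldl (init := fun a => (f a, (g a).map fun _ => ([], []), []))
    (step := fun _ s _ => auctionStep s) (by fun_prop) (by fun_prop) hstep 20 ?_
  rintro a ⟨_ | ⟨C, rest⟩, X, D⟩ -
  · simp [auctionStep]
  · have h2 : ∀ (row : List Bool) (X : List (Slot β)), sz ((row.zip X).map Prod.snd) ≤ sz X := by
      intro row
      induction row with
      | nil => exact fun X => by simpa using sz_pos X
      | cons b row ih =>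
        rintro (_ | ⟨x, X⟩)
        · simp
        · simpa using ih X
    have h1 := sz_place_le (COC.minPrice (X.map fun _ => ()) (C.2.zip X)) C (C.2.zip X)
    have h3 := h2 C.2 X
    change sz ((COC.place (COC.minPrice (X.map fun _ => ()) (C.2.zip X)) C (C.2.zip X)).2.2 ++ rest,
      (COC.place (COC.minPrice (X.map fun _ => ()) (C.2.zip X)) C (C.2.zip X)).2.1,
      (COC.place (COC.minPrice (X.map fun _ => ()) (C.2.zip X)) C (C.2.zip X)).1 ++ D) ≤ _
    generalize COC.place (COC.minPrice (X.map fun _ => ()) (C.2.zip X)) C (C.2.zip X) = P at *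
    have h4 := sz_append P.2.2 rest
    have h5 := sz_append P.1 D
    simp only [sz_pair, sz_cons, Polynomial.eval_ofNat] at *
    omega

end PolyTime

/-! ### The connected components -/

/-- The vertices that can be reached from `u` in the subgraph that is induced by `free`: neighbors
are added as often as there are vertices. -/
def spread (r : List (List Bool)) (free u : List Bool) : List Bool :=
  r.foldl (fun C _ => maskAnd free (maskOr C (r.map (meets C)))) u

/-- The components of `G - M`; a vertex starts a new component if it lies in none of the previous
ones. -/
def componentMasks (r : List (List Bool)) (m : List Bool) : List (List Bool) :=
  (units m).foldl
    (fun L u => bif meets u m || L.any (meets u) then L else spread r (maskNot m) u :: L) []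

theorem length_maskAnd_maskOr_le (a b c : List Bool) :
    (maskAnd a (maskOr b c)).length ≤ b.length := by
  simp [maskAnd, maskOr]

namespace PolyTime

@[fun_prop]
theorem spread {f : α → List (List Bool)} {g h : α → List Bool} (hf : PolyTime f) (hg : PolyTime g)
    (hh : PolyTime h) : PolyTime fun a => spread (f a) (g a) (h a) :=
  foldl_bools (step := fun a C _ => COC.maskAnd (g a) (COC.maskOr C ((f a).map (COC.meets C))))
    hf hh (by fun_prop) fun _ _ _ => length_maskAnd_maskOr_le _ _ _

@[fun_prop]
theorem componentMasks {f : α → List (List Bool)} {g : α → List Bool} (hf : PolyTime f)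
    (hg : PolyTime g) : PolyTime fun a => componentMasks (f a) (g a) := by
  have h1 : PolyTime fun x : List (List Bool) × List Bool × List Bool =>
    COC.spread x.1 x.2.1 x.2.2 := by fun_prop
  obtain ⟨T, hT⟩ := (h1.comp (f := fun x : α × List Bool => (f x.1, COC.maskNot (g x.1), x.2))
    (by fun_prop)).size_le
  refine foldl (init := fun _ => []) (step := fun a L u =>
    bif COC.meets u (g a) || L.any (COC.meets u) then L else
      COC.spread (f a) (COC.maskNot (g a)) u :: L) (by fun_prop) (const _) (by fun_prop)
    (T.comp (.X + 1) + 1) ?_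
  intro a L u
  have := hT (a, u)
  cases COC.meets u (g a) || L.any (COC.meets u)
  · simp at *; omega
  · simp

end PolyTime

theorem map_meets_rows {n : ℕ} (G : SimpleGraph (Fin n)) (C : Set (Fin n)) :
    (rows G).map (meets (mask C)) = mask {w | ∃ v ∈ C, G.Adj v w} := by
  refine eq_mask (by simp) fun i => ?_
  simp only [rows, Fin.getElem_fin, List.getElem_map, List.getElem_ofFn, meets_mask]
  exact exists_congr fun v => and_congr_right fun _ => G.adj_comm i v

theorem spread_spec {n : ℕ} (G : SimpleGraph (Fin n)) (M : Set (Fin n)) (v : ↥(Mᶜ)) :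
    spread (rows G) (mask Mᶜ) (mask {v.1}) =
      mask (compSet ((del G M).connectedComponentMk v)) := by
  set c := (del G M).connectedComponentMk v with hc
  have hv : v.1 ∈ compSet c := mem_compSet.2 ⟨v.2, rfl⟩
  let f : Set (Fin n) → Set (Fin n) := fun C => Mᶜ ∩ (C ∪ {w | ∃ v ∈ C, G.Adj v w})
  have h1 : ∀ (l : List (List Bool)) (C : Set (Fin n)),
      l.foldl (fun C _ => maskAnd (mask Mᶜ) (maskOr C ((rows G).map (meets C)))) (mask C) =
        mask (f^[l.length] C) := by
    intro l
    induction l with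
    | nil => simp
    | cons r l ih =>
      intro C
      rw [List.foldl_cons, map_meets_rows, maskOr_mask, maskAnd_mask, ih]
      rfl
  rw [spread, h1, length_rows]
  congr 1
  have hsub : ∀ i, f^[i] {v.1} ⊆ compSet c := by
    intro i
    induction i with
    | zero => simpa using hv
    | succ i ih =>
      rw [Function.iterate_succ_apply']
      rintro w ⟨hwM, hw | ⟨u, hu, huw⟩⟩
      · exact ih hw
      · exact compSet_closed (ih hu) hwM huw
  have hmono : ∀ C ⊆ compSet c, C ⊆ f C := fun C hC w hw => ⟨compSet_subset c (hC hw), Or.inl hw⟩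
  -- the sets grow until they are closed under adjacency
  have hgrow : ∀ i, f (f^[i] {v.1}) = f^[i] {v.1} ∨ i + 1 ≤ (f^[i] {v.1}).ncard := by
    intro i
    induction i with
    | zero => right; simp
    | succ i ih =>
      rw [Function.iterate_succ_apply']
      by_cases he : f (f^[i] {v.1}) = f^[i] {v.1}
      · left; rw [he, he]
      · right
        have h2 := ih.resolve_left he
        have h3 := Set.ncard_lt_ncard ((hmono _ (hsub i)).ssubset_of_ne (Ne.symm he))
        omega
  have hfix : f (f^[n] {v.1}) = f^[n] {v.1} := by
    refine (hgrow n).resolve_right fun h => ?_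
    have h2 := Set.ncard_le_card (f^[n] {v.1})
    simp only [Nat.card_eq_fintype_card, Fintype.card_fin] at h2
    omega
  have hmem : v.1 ∈ f^[n] {v.1} := by
    have : ∀ i, v.1 ∈ f^[i] {v.1} := by
      intro i
      induction i with
      | zero => simp
      | succ i ih =>
        rw [Function.iterate_succ_apply']
        exact hmono _ (hsub i) ih
    exact this n
  refine (hsub n).antisymm (connOn_compSet c _ ⟨v, hv, hmem⟩ ?_)
  intro u hu w hw huw
  rw [← hfix]
  exact ⟨compSet_subset c hw, Or.inr ⟨u, hu.2, huw⟩⟩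

theorem componentMasks_spec {n : ℕ} (G : SimpleGraph (Fin n)) (M : Set (Fin n)) :
    ∃ cs : List (del G M).ConnectedComponent, cs.Nodup ∧ (∀ c, c ∈ cs) ∧
      componentMasks (rows G) (mask M) = cs.map fun c => mask (compSet c) := by
  have key : ∀ (l : List (Fin n)) (cs : List (del G M).ConnectedComponent), cs.Nodup →
      ∃ cs' : List (del G M).ConnectedComponent, cs'.Nodup ∧ cs ⊆ cs' ∧
        (∀ v : ↥(Mᶜ), v.1 ∈ l → (del G M).connectedComponentMk v ∈ cs') ∧
        (l.map fun i => mask {i}).foldl (fun L u =>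
          bif meets u (mask M) || L.any (meets u) then L else
            spread (rows G) (maskNot (mask M)) u :: L) (cs.map fun c => mask (compSet c)) =
          cs'.map fun c => mask (compSet c) := by
    intro l
    induction l with
    | nil => exact fun cs hcs => ⟨cs, hcs, List.Subset.refl _, by simp, rfl⟩
    | cons i l ih =>
      intro cs hcs
      rw [List.map_cons, List.foldl_cons]
      have hcond : (meets (mask {i}) (mask M) ||
          (cs.map fun c => mask (compSet c)).any (meets (mask {i}))) = true ↔
            i ∈ M ∨ ∃ c ∈ cs, i ∈ compSet c := by
        simp only [Bool.or_eq_true, meets_mask, List.any_map, List.any_eq_true,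
          Function.comp_apply, Set.singleton_inter_nonempty]
      cases hb : meets (mask {i}) (mask M) ||
          (cs.map fun c => mask (compSet c)).any (meets (mask {i}))
      · have hnot : ¬ (i ∈ M ∨ ∃ c ∈ cs, i ∈ compSet c) := by
          rw [← hcond, hb]; simp
        push Not at hnot
        obtain ⟨hiM, hics⟩ := hnot
        have hs := spread_spec G M ⟨i, hiM⟩
        obtain ⟨cs', h1, h2, h3, h4⟩ := ih ((del G M).connectedComponentMk ⟨i, hiM⟩ :: cs)
          (List.nodup_cons.2 ⟨fun h => hics _ h (mem_compSet.2 ⟨hiM, rfl⟩), hcs⟩)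
        refine ⟨cs', h1, fun c hc => h2 (List.mem_cons_of_mem _ hc), ?_, ?_⟩
        · intro v hv
          rcases List.mem_cons.1 hv with hv | hv
          · exact h2 (by rw [← show v = ⟨i, hiM⟩ from Subtype.ext hv]; exact List.mem_cons_self)
          · exact h3 v hv
        · rw [← h4, cond_false, maskNot_mask, hs]
          rfl
      · obtain ⟨cs', h1, h2, h3, h4⟩ := ih cs hcs
        refine ⟨cs', h1, h2, ?_, by rw [← h4]; rfl⟩
        intro v hv
        rcases List.mem_cons.1 hv with hv | hv
        · rcases hcond.1 hb with h | ⟨c, hc, hic⟩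
          · exact absurd h (hv ▸ v.2)
          · obtain ⟨_, rfl⟩ := mem_compSet.1 hic
            have : v = ⟨i, compSet_subset _ hic⟩ := Subtype.ext hv
            exact this ▸ h2 hc
        · exact h3 v hv
  obtain ⟨cs, h1, -, h2, h3⟩ := key (List.finRange n) [] List.nodup_nil
  refine ⟨cs, h1, fun c => ?_, ?_⟩
  · induction c using SimpleGraph.ConnectedComponent.ind with
    | h v => exact h2 v (List.mem_finRange _)
  · rw [componentMasks, units_eq (length_mask M), List.ofFn_eq_map]
    exact h3

/-! ### A minimum solution of `G - M` -/

section Solution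

variable {𝒢 : GraphClass} {d : ℕ} (Q : ModInstance 𝒢 → List Bool → ℤ → Bool)

/-- The size of a minimum solution of `G - M`, found by counting up. -/
noncomputable def optimum (x : ModInstance 𝒢) : ℕ :=
  (mask x.M).foldl (fun j _ => bif Q x ((mask x.M).map fun _ => false) j then j else j + 1) 0

/-- A minimum solution of `G - M`, to which vertices are added greedily. -/
noncomputable def greedy (x : ModInstance 𝒢) : List Bool :=
  (units (mask x.M)).foldl (fun Y u =>
    bif meets u (mask x.M) then Y else
      bif Q x (maskOr Y u) (optimum Q x) then maskOr Y u else Y) ((mask x.M).map fun _ => false)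

variable {Q}

theorem map_false_mask {n : ℕ} (M : Set (Fin n)) : (mask M).map (fun _ => false) = mask (∅ : Set (Fin n)) :=
  eq_mask (by simp) fun i => by simp

theorem IsOracle.optimum_eq (hQ : IsOracle 𝒢 d Q) {x : ModInstance 𝒢} {S : Set (Fin x.n)}
    (hS : MinCocOn d x.G x.Mᶜ S) : optimum Q x = S.ncard := by
  have h1 : ∀ j : ℕ, Q x (mask (∅ : Set (Fin x.n))) j = true ↔ S.ncard ≤ j := by
    intro j
    obtain ⟨h1, h2⟩ := hQ x ∅ j (Set.empty_subset _)
    constructor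
    · intro h
      obtain ⟨T, hT, hTc, hTj, -⟩ := h2 h
      have := hS.2.2 T hT hTc
      omega
    · intro h
      exact h1 ⟨S, hS.1, hS.2.1, by omega, Set.empty_subset _⟩
  have h2 : ∀ (l : List Bool) (j : ℕ), j ≤ S.ncard →
      l.foldl (fun (j : ℕ) _ => bif Q x (mask (∅ : Set (Fin x.n))) j then j else j + 1) j =
        min S.ncard (j + l.length) := by
    intro l
    induction l with
    | nil => intro j hj; simp [hj]
    | cons b l ih =>
      intro j hj
      rw [List.foldl_cons]
      cases hb : Q x (mask ∅) j
      · have : ¬ S.ncard ≤ j := by rw [← h1, hb]; simp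
        rw [cond_false, ih _ (by omega)]
        simp; omega
      · have := (h1 j).1 hb
        rw [cond_true, ih _ hj]
        simp; omega
  rw [optimum, map_false_mask, h2 _ 0 (Nat.zero_le _), length_mask, zero_add]
  have h3 := Set.ncard_le_card S
  simp only [Nat.card_eq_fintype_card, Fintype.card_fin] at h3
  omega

theorem IsOracle.extendable_iff (hQ : IsOracle 𝒢 d Q) {x : ModInstance 𝒢} {A : Set (Fin x.n)}
    (hA : A ⊆ x.Mᶜ) : Q x (mask A) (optimum Q x) = true ↔ Extendable d x.G x.Mᶜ A := by
  obtain ⟨S, hS⟩ := exists_minCocOn (d := d) (G := x.G) x.Mᶜ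
  rw [hQ.optimum_eq hS]
  obtain ⟨h1, h2⟩ := hQ x A S.ncard hA
  constructor
  · intro h
    obtain ⟨T, hT, hTc, hTj, h3⟩ := h2 h
    have h4 := hS.2.2 T hT hTc
    refine ⟨T, ⟨hT, hTc, fun R hR hRc => ?_⟩, h3.resolve_right (by omega)⟩
    have := hS.2.2 R hR hRc
    omega
  · rintro ⟨T, hT, hAT⟩
    refine h1 ⟨T, hT.1, hT.2.1, ?_, hAT⟩
    have := hT.2.2 S hS.1 hS.2.1
    omega

theorem IsOracle.greedy_spec (hQ : IsOracle 𝒢 d Q) (x : ModInstance 𝒢) :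
    ∃ S, MinCocOn d x.G x.Mᶜ S ∧ greedy Q x = mask S := by
  have key : ∀ (l : List (Fin x.n)) (A : Set (Fin x.n)), A ⊆ x.Mᶜ → Extendable d x.G x.Mᶜ A →
      ∃ B, A ⊆ B ∧ B ⊆ x.Mᶜ ∧ Extendable d x.G x.Mᶜ B ∧
        (∀ i ∈ l, i ∉ x.M → i ∉ B → ¬ Extendable d x.G x.Mᶜ (B ∪ {i})) ∧
        (l.map fun i => mask {i}).foldl (fun Y u =>
          bif meets u (mask x.M) then Y else
            bif Q x (maskOr Y u) (optimum Q x) then maskOr Y u else Y) (mask A) = mask B := by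
    intro l
    induction l with
    | nil => exact fun A hA hAe => ⟨A, subset_rfl, hA, hAe, by simp, rfl⟩
    | cons i l ih =>
      intro A hA hAe
      rw [List.map_cons, List.foldl_cons]
      cases hb : meets (mask {i}) (mask x.M)
      · have hiM : i ∉ x.M := by
          rw [← Set.singleton_inter_nonempty, ← meets_mask, hb]; simp
        have hAi : A ∪ {i} ⊆ x.Mᶜ := Set.union_subset hA (by simpa using hiM)
        rw [cond_false, maskOr_mask]
        cases hq : Q x (mask (A ∪ {i})) (optimum Q x)
        · obtain ⟨B, h1, h2, h3, h4, h5⟩ := ih A hA hAe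
          refine ⟨B, h1, h2, h3, ?_, h5⟩
          intro j hj hjM hjB
          rcases List.mem_cons.1 hj with rfl | hj
          · intro he
            have := (hQ.extendable_iff hAi).2 (he.mono (Set.union_subset_union_left _ h1))
            rw [hq] at this
            simp at this
          · exact h4 j hj hjM hjB
        · obtain ⟨B, h1, h2, h3, h4, h5⟩ := ih _ hAi ((hQ.extendable_iff hAi).1 hq)
          refine ⟨B, Set.subset_union_left.trans h1, h2, h3, ?_, h5⟩
          intro j hj hjM hjB
          rcases List.mem_cons.1 hj with rfl | hj
          · exact absurd (h1 (Or.inr rfl)) hjB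
          · exact h4 j hj hjM hjB
      · have hiM : i ∈ x.M := by
          rwa [meets_mask, Set.singleton_inter_nonempty] at hb
        obtain ⟨B, h1, h2, h3, h4, h5⟩ := ih A hA hAe
        refine ⟨B, h1, h2, h3, ?_, h5⟩
        intro j hj hjM hjB
        rcases List.mem_cons.1 hj with rfl | hj
        · exact absurd hiM hjM
        · exact h4 j hj hjM hjB
  obtain ⟨S, hS⟩ := exists_minCocOn (d := d) (G := x.G) x.Mᶜ
  obtain ⟨B, -, h2, ⟨T, hT, hBT⟩, h4, h5⟩ := key (List.finRange x.n) ∅ (Set.empty_subset _)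
    ⟨S, hS, Set.empty_subset _⟩
  refine ⟨T, hT, ?_⟩
  rw [greedy, map_false_mask, units_eq (length_mask x.M), List.ofFn_eq_map]
  refine h5.trans ?_
  congr 1
  refine hBT.antisymm fun i hi => ?_
  by_contra hiB
  exact h4 i (List.mem_finRange _) (hT.1 hi) hiB
    ⟨T, hT, Set.union_subset hBT (Set.singleton_subset_iff.2 hi)⟩

namespace PolyTime

theorem oracle (hQ : PolyTime fun z : ModInstance 𝒢 × List Bool × ℤ => Q z.1 z.2.1 z.2.2)
    {f : α → ModInstance 𝒢} {g : α → List Bool} {j : α → ℤ} (hf : PolyTime f)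
    (hg : PolyTime g) (hj : PolyTime j) : PolyTime fun a => Q (f a) (g a) (j a) :=
  hQ.comp (f := fun a => (f a, g a, j a)) (by fun_prop)

theorem optimum' (hQ : PolyTime fun z : ModInstance 𝒢 × List Bool × ℤ => Q z.1 z.2.1 z.2.2) :
    PolyTime (optimum Q) := by
  have h1 : PolyTime fun z : ModInstance 𝒢 × ℕ × Bool =>
      Q z.1 ((mask z.1.M).map fun _ => false) z.2.1 :=
    oracle hQ (by fun_prop) (by fun_prop) (by fun_prop)
  refine foldl_of_measure (f := fun x : ModInstance 𝒢 => mask x.M) (init := fun _ => 0)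
    (step := fun x (j : ℕ) _ =>
    bif Q x ((mask x.M).map fun _ => false) (j : ℤ) then j else j + 1)
    (fun j => j.bits.length) 4 ?_ ?_ (by fun_prop) (const _) (by fun_prop) 1 ?_
  · intro j
    have h2 : sz j = sz j.bits := rfl
    have := sz_bools_le j.bits
    omega
  · intro j
    have h2 : sz j = sz j.bits := rfl
    have := length_lt_sz j.bits
    omega
  · intro x j _
    cases Q x ((mask x.M).map fun _ => false) (j : ℤ)
    · simpa using length_bits_succ_le j
    · simp

theorem greedy' (hQ : PolyTime fun z : ModInstance 𝒢 × List Bool × ℤ => Q z.1 z.2.1 z.2.2) :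
    PolyTime (greedy Q) := by
  have h0 := optimum' hQ
  have h1 : PolyTime fun z : ModInstance 𝒢 × List Bool × List Bool =>
      Q z.1 (COC.maskOr z.2.1 z.2.2) (optimum Q z.1) :=
    oracle hQ (by fun_prop) (by fun_prop) (by fun_prop)
  refine foldl_bools (f := fun x : ModInstance 𝒢 => COC.units (mask x.M))
    (init := fun x => (mask x.M).map fun _ => false) (step := fun x Y u =>
    bif COC.meets u (mask x.M) then Y else
      bif Q x (COC.maskOr Y u) (optimum Q x) then COC.maskOr Y u else Y)
    (by fun_prop) (by fun_prop) (by fun_prop) ?_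
  intro x Y u
  cases COC.meets u (mask x.M) <;> cases Q x (COC.maskOr Y u) (optimum Q x) <;>
    simp [COC.maskOr]

end PolyTime

end Solution

/-! ### Chunks -/

section Chunks

variable {ε ζ : Type}

/-- The lists of length `b` of elements of a list. -/
def chunkList (vs : List ε) : ℕ → List (List ε)
  | 0 => [[]]
  | b + 1 => (chunkList vs b).flatMap fun f => vs.map fun v => v :: f

/-- Each chunk of `b` vertices, `q` times. -/
def slotList (vs : List ε) (q b : ℕ) : List (List ε) :=
  (chunkList vs b).flatMap fun f => List.replicate q f

theorem mem_chunkList {vs : List ε} {b : ℕ} {f : List ε} :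
    f ∈ chunkList vs b ↔ f.length = b ∧ ∀ v ∈ f, v ∈ vs := by
  induction b generalizing f with
  | zero =>
    simp only [chunkList, List.mem_singleton, List.length_eq_zero_iff]
    exact ⟨by rintro rfl; simp, fun h => h.1⟩
  | succ b ih =>
    simp only [chunkList, List.mem_flatMap, List.mem_map, ih]
    constructor
    · rintro ⟨g, ⟨hg, hgv⟩, v, hv, rfl⟩
      simpa [hg, hv] using hgv
    · rintro ⟨h1, h2⟩
      cases f with
      | nil => simp at h1
      | cons v f => exact ⟨f, ⟨by simpa using h1, fun w hw => h2 w (List.mem_cons_of_mem _ hw)⟩,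
          v, h2 v List.mem_cons_self, rfl⟩

theorem length_chunkList (vs : List ε) (b : ℕ) : (chunkList vs b).length = vs.length ^ b := by
  induction b with
  | zero => rfl
  | succ b ih => simp [chunkList, List.length_flatMap, ih, pow_succ]

theorem length_slotList (vs : List ε) (q b : ℕ) :
    (slotList vs q b).length = q * vs.length ^ b := by
  simp [slotList, List.length_flatMap, length_chunkList, mul_comm]

theorem chunkList_map (e : ε → ζ) (vs : List ε) (b : ℕ) :
    chunkList (vs.map e) b = (chunkList vs b).map (List.map e) := by
  induction b with
  | zero => rfl
  | succ b ih =>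
    simp [chunkList, ih, List.flatMap_map, List.map_flatMap, Function.comp_def]

theorem slotList_map (e : ε → ζ) (vs : List ε) (q b : ℕ) :
    slotList (vs.map e) q b = (slotList vs q b).map (List.map e) := by
  simp [slotList, chunkList_map, List.flatMap_map, List.map_flatMap]

theorem mem_chunkList_of_getElem? {vs : List ε} {q b j : ℕ} {f : List ε}
    (h : (slotList vs q b)[j]? = some f) : f ∈ chunkList vs b := by
  obtain ⟨g, hg, hf⟩ := List.mem_flatMap.1 (List.mem_of_getElem? h)
  rwa [List.eq_of_mem_replicate hf]

theorem exists_positions {vs : List ε} {b : ℕ} {f : List ε} (hf : f ∈ chunkList vs b) (q : ℕ) :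
    ∃ p : Fin q → ℕ, p.Injective ∧ ∀ j, (slotList vs q b)[p j]? = some f := by
  have h : (List.replicate q f).Sublist (slotList vs q b) := by
    rw [slotList, List.flatMap_def]
    exact List.sublist_flatten_of_mem (List.mem_map.2 ⟨f, hf, rfl⟩)
  obtain ⟨p, hp⟩ := List.sublist_iff_exists_orderEmbedding_getElem?_eq.1 h
  refine ⟨fun j => p j, fun i j hij => Fin.ext (p.injective hij), fun j => ?_⟩
  rw [← hp, List.getElem?_replicate, if_pos j.2]

end Chunks

namespace PolyTime

theorem replicate {f : α → β} (hf : PolyTime f) (q : ℕ) :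
    PolyTime fun a => List.replicate q (f a) := by
  induction q with
  | zero => exact const []
  | succ q ih => exact list_cons hf ih

theorem chunkList {f : α → List β} (hf : PolyTime f) (b : ℕ) :
    PolyTime fun a => chunkList (f a) b := by
  induction b with
  | zero => exact const [[]]
  | succ b ih => unfold COC.chunkList; fun_prop

theorem slotList {f : α → List β} (hf : PolyTime f) (q b : ℕ) :
    PolyTime fun a => slotList (f a) q b := by
  have h1 := chunkList hf b
  have h2 : PolyTime fun x : α × List β => List.replicate q x.2 := replicate (by fun_prop) q
  unfold COC.slotList
  fun_prop

end PolyTime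

theorem select_units {n : ℕ} (M : Set (Fin n)) : ∃ vs : List (Fin n),
    select (mask M) (units (mask M)) = vs.map (fun v => mask {v}) ∧ (∀ v, v ∈ vs ↔ v ∈ M) ∧
      vs.length = M.ncard := by
  obtain ⟨n', φ, hφ, h⟩ := exists_select M
  refine ⟨List.ofFn φ, ?_, fun v => ?_, ?_⟩
  · rw [units_eq (length_mask M), h, List.map_ofFn]
  · rw [List.mem_ofFn, ← hφ]
    exact Iff.rfl
  · rw [List.length_ofFn, ← hφ, ← Set.image_univ, Set.ncard_image_of_injective _ φ.injective,
      Set.ncard_univ]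
    simp

/-! ### The reduction -/

section Reduction

variable {𝒢 : GraphClass} {d : ℕ} (Q : ModInstance 𝒢 → List Bool → ℤ → Bool)

/-- Whether the neighbors of the chunk `f` in the component `C` are a blocking set. -/
noncomputable def conflict (x : ModInstance 𝒢) (f : List (List Bool)) (C : List Bool) : Bool :=
  !Q x (maskAnd C ((rows x.G).map fun r => f.any (meets r))) (optimum Q x)

/-- The slots of the auction: the chunks of `b` vertices of the modulator, each of them `q` times. -/
noncomputable def slots (q b : ℕ) (x : ModInstance 𝒢) : List (List (List Bool)) :=
  slotList (select (mask x.M) (units (mask x.M))) q b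

/-- The bidders of the auction: the components of `G - M`, interested in their conflicts. -/
noncomputable def componentBidders (q b : ℕ) (x : ModInstance 𝒢) : List (Bidder (List Bool)) :=
  (componentMasks (rows x.G) (mask x.M)).map fun C =>
    (C, (slots q b x).map fun f => conflict Q x f C)

/-- The vertices of the components that give up in the auction. -/
noncomputable def removed (q b : ℕ) (x : ModInstance 𝒢) : List Bool :=
  (auction (componentBidders Q q b x) (slots q b x)).2.2.foldl (fun D r => maskOr D r.1)
    ((mask x.M).map fun _ => false)

/-- The reduced instance. -/
noncomputable def reduce (q b : ℕ) (x : ModInstance 𝒢) : List (List Bool) × ℤ :=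
  (selectMatrix (maskNot (removed Q q b x)) (rows x.G),
    x.k - (maskAnd (greedy Q x) (removed Q q b x)).count true)

variable {Q}

theorem PolyTime.reduce' (hQ : PolyTime fun z : ModInstance 𝒢 × List Bool × ℤ => Q z.1 z.2.1 z.2.2)
    (q b : ℕ) : PolyTime (reduce Q q b) := by
  have h1 := optimum' hQ
  have h2 := greedy' hQ
  have h3 : PolyTime (slots q b : ModInstance 𝒢 → _) := slotList (by fun_prop) q b
  have h4 : PolyTime fun z : (ModInstance 𝒢 × List Bool) × List (List Bool) =>
      conflict Q z.1.1 z.2 z.1.2 := by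
    unfold conflict
    exact not (oracle hQ (by fun_prop) (by fun_prop) (by fun_prop))
  have h5 : PolyTime (componentBidders Q q b) := by
    unfold componentBidders
    fun_prop
  have h6 : PolyTime (removed Q q b) := by
    refine foldl_bools (init := fun x : ModInstance 𝒢 => (mask x.M).map fun _ => false)
      (step := fun _ D (r : Bidder (List Bool)) => COC.maskOr D r.1)
      (f := fun x => (COC.auction (componentBidders Q q b x) (slots q b x)).2.2)
      (by fun_prop) (by fun_prop) (by fun_prop) ?_
    intro _ D r
    simp [COC.maskOr]
  unfold reduce
  fun_prop

theorem IsOracle.conflict_iff (hQ : IsOracle 𝒢 d Q) (x : ModInstance 𝒢) (f : List (Fin x.n))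
    (c : (del x.G x.M).ConnectedComponent) :
    conflict Q x (f.map fun v => mask {v}) (mask (compSet c)) = true ↔
      ¬ Extendable d x.G x.Mᶜ (nbhd x.G f ∩ compSet c) := by
  have h1 : (rows x.G).map (fun r => (f.map fun v => mask {v}).any (meets r)) =
      mask (nbhd x.G f) := by
    refine eq_mask (by simp) fun i => ?_
    simp only [rows, Fin.getElem_fin, List.getElem_map, List.getElem_ofFn, List.any_map,
      List.any_eq_true, Function.comp_apply, meets_mask, Set.inter_singleton_nonempty,
      SimpleGraph.mem_neighborSet, nbhd, Set.mem_ofPred_eq]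
    exact exists_congr fun v => and_congr_right fun _ => x.G.adj_comm i v
  rw [conflict, h1, maskAnd_mask, Bool.not_eq_true', ← Bool.not_eq_true, Set.inter_comm,
    hQ.extendable_iff (Set.inter_subset_right.trans (compSet_subset c))]

/-- The number of components that remain. -/
theorem card_components_le {V W : Type} [Finite V] [Finite W] {G : SimpleGraph V} {M : Set V} {φ : W → V}
    (hφ : φ.Injective) {K : Finset (del G M).ConnectedComponent}
    (hK : Set.range φ ∩ Mᶜ = ⋃ c ∈ K, compSet c) :
    Nat.card (del (G.comap φ) (φ ⁻¹' M)).ConnectedComponent ≤ K.card := by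
  classical
  let h : del (G.comap φ) (φ ⁻¹' M) →g del G M := ⟨fun v => ⟨φ v.1, v.2⟩, fun h => h⟩
  have hmem : ∀ v : ↥((φ ⁻¹' M)ᶜ), (del G M).connectedComponentMk ⟨φ v.1, v.2⟩ ∈ K := by
    intro v
    have h1 : φ v.1 ∈ Set.range φ ∩ Mᶜ := ⟨⟨v.1, rfl⟩, v.2⟩
    rw [hK] at h1
    simp only [Set.mem_iUnion] at h1
    obtain ⟨c, hc, hvc⟩ := h1
    obtain ⟨_, rfl⟩ := mem_compSet.1 hvc
    exact hc
  let Ψ : (del (G.comap φ) (φ ⁻¹' M)).ConnectedComponent → K := fun c => ⟨c.map h, by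
    induction c using SimpleGraph.ConnectedComponent.ind with
    | h v => exact hmem v⟩
  have hΨ : Ψ.Injective := by
    intro c c' hcc
    have hcc' : c.map h = c'.map h := congrArg Subtype.val hcc
    induction c using SimpleGraph.ConnectedComponent.ind with
    | h v =>
    induction c' using SimpleGraph.ConnectedComponent.ind with
    | h w =>
    set C := (del G M).connectedComponentMk ⟨φ v.1, v.2⟩ with hC
    have hw : φ w.1 ∈ compSet C := mem_compSet.2 ⟨w.2, hcc'.symm⟩
    have hv : φ v.1 ∈ compSet C := mem_compSet.2 ⟨v.2, rfl⟩
    have hv' : v.1 ∈ compSet ((del (G.comap φ) (φ ⁻¹' M)).connectedComponentMk v) :=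
      mem_compSet.2 ⟨v.2, rfl⟩
    have hsub := connOn_compSet C
      (φ '' compSet ((del (G.comap φ) (φ ⁻¹' M)).connectedComponentMk v))
      ⟨φ v.1, hv, v.1, hv', rfl⟩ ?_ hw
    · obtain ⟨u, hu, huw⟩ := hsub
      rw [hφ huw] at hu
      obtain ⟨_, h1⟩ := mem_compSet.1 hu
      exact h1.symm
    · rintro _ ⟨_, u, hu, rfl⟩ y hy huy
      have h1 : y ∈ Set.range φ ∩ Mᶜ := by
        rw [hK]
        simp only [Set.mem_iUnion]
        exact ⟨C, hmem v, hy⟩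
      obtain ⟨⟨y, rfl⟩, hyM⟩ := h1
      exact ⟨y, compSet_closed hu hyM huy, rfl⟩
  refine (Nat.card_le_card_of_injective Ψ hΨ).trans ?_
  simp

theorem IsOracle.reduce_spec (hQ : IsOracle 𝒢 d Q) (hd : 1 ≤ d) {b : ℕ}
    (hb : 𝒢.BlockingSetsBounded d b) (x : ModInstance 𝒢) :
    ∃ (n' : ℕ) (G' : SimpleGraph (Fin n')) (k' : ℤ) (φ : Fin n' ↪o Fin x.n),
      enc (reduce Q ((d - 1) * b + 1) b x) = ofInstance G' k' ∧
      (IsYes d x.G x.k ↔ IsYes d G' k') ∧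
      DeletesComponents x.G x.M G' φ ∧
      Nat.card (del G' (φ ⁻¹' x.M)).ConnectedComponent ≤ ((d - 1) * b + 1) * x.M.ncard ^ b ∧
      k' ≤ x.k := by
  classical
  set q := (d - 1) * b + 1 with hq
  obtain ⟨S₀, hS₀, hgreedy⟩ := hQ.greedy_spec x
  obtain ⟨cs, hcs, hall, hmasks⟩ := componentMasks_spec x.G x.M
  obtain ⟨vs, hvs, hvsM, hvslen⟩ := select_units x.M
  let SL : List (List (Fin x.n)) := slotList vs q b
  have hslots : slots q b x = SL.map (List.map fun v => mask {v}) := by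
    rw [slots, hvs, slotList_map]
  let bidder : (del x.G x.M).ConnectedComponent → Bidder (List Bool) := fun c =>
    (mask (compSet c), (slots q b x).map fun f => conflict Q x f (mask (compSet c)))
  have hbidders : componentBidders Q q b x = cs.map bidder := by
    rw [componentBidders, hmasks, List.map_map]
    rfl
  have hbinj : bidder.Injective := by
    intro c c' hcc
    have h1 : compSet c = compSet c' := mask_injective (congrArg Prod.fst hcc)
    obtain ⟨v, hv⟩ := compSet_nonempty c
    exact eq_of_mem_compSet hv (h1 ▸ hv)
  have hbid : ∀ (c) (j : ℕ), (bidder c).2[j]? = some true ↔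
      ∃ f, SL[j]? = some f ∧ ¬ Extendable d x.G x.Mᶜ (nbhd x.G f ∩ compSet c) := by
    intro c j
    simp only [bidder, hslots, List.map_map, List.getElem?_map, Option.map_eq_some_iff,
      Function.comp_apply, hQ.conflict_iff]
  obtain ⟨H, R, ν, hperm, hHlen, hD, hν, hνinj⟩ := auction_spec (bidders := cs.map bidder)
    ((List.nodup_map_iff hbinj).2 hcs) (slots q b x) (by
      intro r hr
      obtain ⟨c, _, rfl⟩ := List.mem_map.1 hr
      simp [bidder])
  set D := (auction (cs.map bidder) (slots q b x)).2.2 with hDdef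
  have hHD := List.nodup_append'.1 (hperm.nodup_iff.2 ((List.nodup_map_iff hbinj).2 hcs))
  let U : Finset (del x.G x.M).ConnectedComponent := cs.toFinset.filter fun c => bidder c ∈ D
  have hU : ∀ c, c ∈ U ↔ bidder c ∈ D := by
    intro c; simp [U, hall]
  -- the removed vertices
  have hremoved : removed Q q b x = mask (⋃ c ∈ U, compSet c) := by
    have key : ∀ (L : List (Bidder (List Bool))) (A : Set (Fin x.n)),
        (∀ r ∈ L, ∃ c, bidder c = r) → L.foldl (fun D r => maskOr D r.1) (mask A) =
          mask (A ∪ {v | ∃ c, bidder c ∈ L ∧ v ∈ compSet c}) := by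
      intro L
      induction L with
      | nil => intro A _; simp
      | cons r L ih =>
        intro A hL
        obtain ⟨c, rfl⟩ := hL r List.mem_cons_self
        rw [List.foldl_cons, maskOr_mask, ih _ fun r hr => hL r (List.mem_cons_of_mem _ hr)]
        congr 1
        ext v
        simp only [Set.mem_union, Set.mem_ofPred_eq, List.mem_cons, hbinj.eq_iff, or_and_right,
          exists_or, exists_eq_left, or_assoc]
    rw [removed, hbidders, map_false_mask, key]
    · congr 1
      ext v
      simp [hU, hDdef]
    · intro r hr
      obtain ⟨c, _, hc⟩ := List.mem_map.1 (hperm.subset (List.mem_append_right _ hr))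
      exact ⟨c, hc⟩
  -- the chunks in `R`, and their own components
  let κ : Type := {f : List (Fin x.n) // ∃ j ∈ R, SL[j]? = some f}
  have hκ : Finite κ := by
    refine Finite.of_injective (β := {f // f ∈ SL.toFinset})
      (fun f => ⟨f.1, ?_⟩) fun f f' h => Subtype.ext (Subtype.mk.inj h)
    obtain ⟨j, _, hf⟩ := f.2
    exact List.mem_toFinset.2 (List.mem_of_getElem? hf)
  have := Fintype.ofFinite κ
  have hchunk : ∀ f : κ, f.1 ∈ chunkList vs b := fun f => by
    obtain ⟨j, _, hj⟩ := f.2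
    exact mem_chunkList_of_getElem? hj
  choose p hpinj hp using fun f : κ => exists_positions (hchunk f) q
  have hcomp : ∀ j : R, ∃ c, bidder c = ν j := by
    intro j
    obtain ⟨c, _, hc⟩ := List.mem_map.1 (hperm.subset (List.mem_append_left _ (hν j).1))
    exact ⟨c, hc⟩
  choose comp hcomp using hcomp
  have hpR : ∀ f j, p f j ∈ R := by
    intro f j
    obtain ⟨j₀, hj₀, hf⟩ := f.2
    obtain ⟨-, h1, h2⟩ := hν ⟨j₀, hj₀⟩
    refine h2 _ ?_
    rw [← hcomp, hbid] at h1 ⊢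
    obtain ⟨f', hf', hconf⟩ := h1
    rw [hf, Option.some.injEq] at hf'
    subst hf'
    exact ⟨f.1, hp f j, hconf⟩
  have hμ : ∀ (f : κ) j, ¬ Extendable d x.G x.Mᶜ
      (nbhd x.G f.1 ∩ compSet (comp ⟨p f j, hpR f j⟩)) := by
    intro f j
    have h1 := (hν ⟨p f j, hpR f j⟩).2.1
    rw [← hcomp, hbid] at h1
    obtain ⟨f', hf', hconf⟩ := h1
    rw [hp f j, Option.some.injEq] at hf'
    rwa [hf']
  have hmain := cocOn_delete_iff hd (fun X hX => hb _ _ x.mem X hX) hS₀ U (κ := κ)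
    (fun f => f.1) (fun f => ⟨(mem_chunkList.1 (hchunk f)).1, fun v hv =>
      (hvsM v).1 ((mem_chunkList.1 (hchunk f)).2 v hv)⟩)
    (fun f j => comp ⟨p f j, hpR f j⟩) ?_ ?_ hμ ?_ x.k
  rotate_left
  · intro f f' j j' he
    have h1 : p f j = p f' j' := by
      have h2 : ν ⟨p f j, hpR f j⟩ = ν ⟨p f' j', hpR f' j'⟩ := by
        rw [← hcomp, ← hcomp]
        exact congrArg bidder he
      exact congrArg Subtype.val (hνinj h2)
    have h2 := hp f j
    rw [h1, hp f' j', Option.some.injEq] at h2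
    obtain rfl : f = f' := Subtype.ext h2.symm
    exact ⟨rfl, hpinj f h1⟩
  · intro f j hmem
    rw [hU, hcomp] at hmem
    exact hHD.2.2 (hν _).1 hmem
  · intro c hc f hfb hfM hconf
    have hf : f ∈ chunkList vs b := mem_chunkList.2 ⟨hfb, fun v hv => (hvsM v).2 (hfM v hv)⟩
    obtain ⟨p', _, hp'⟩ := exists_positions hf q
    have h1 : (bidder c).2[p' 0]? = some true := (hbid c _).2 ⟨f, hp' 0, hconf⟩
    refine ⟨⟨f, p' 0, ?_, hp' 0⟩, rfl⟩
    rcases hc with hc | ⟨f', j, rfl⟩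
    · exact hD _ ((hU c).1 hc) _ h1
    · rw [hcomp] at h1
      exact (hν _).2.2 _ h1
  obtain ⟨n', φ, hφ, hsel⟩ := exists_select (⋃ c ∈ U, compSet c)ᶜ
  refine ⟨n', x.G.comap φ, x.k - (S₀ ∩ ⋃ c ∈ U, compSet c).ncard, φ, ?_, ?_, ?_, ?_, ?_⟩
  · rw [reduce, hremoved, hgreedy, maskAnd_mask, maskNot_mask, selectMatrix_rows hsel, count_mask,
      enc_pair]
    dsimp only
    rw [enc_rows]
    rfl
  · rw [isYes_iff, hmain, isYes_comap φ.injective, hφ]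
  · refine ⟨φ.injective, rfl, ↑U, ?_⟩
    rw [hφ]
    ext v
    simp [compSet]
  · refine (card_components_le (K := cs.toFinset.filter fun c => bidder c ∉ D) φ.injective ?_).trans
      ?_
    · rw [hφ]
      ext v
      simp only [Set.mem_inter_iff, Set.mem_compl_iff, Set.mem_iUnion, exists_prop, hU,
        Finset.mem_filter, List.mem_toFinset, hall, true_and, not_exists, not_and]
      constructor
      · rintro ⟨h1, hvM⟩
        have hv : v ∈ compSet ((del x.G x.M).connectedComponentMk ⟨v, hvM⟩) :=
          mem_compSet.2 ⟨hvM, rfl⟩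
        exact ⟨_, fun h => h1 _ h hv, hv⟩
      · rintro ⟨c, hc, hvc⟩
        refine ⟨fun c' hc' hvc' => hc ?_, compSet_subset c hvc⟩
        rwa [eq_of_mem_compSet hvc hvc']
    · calc _ = ((cs.toFinset.filter fun c => bidder c ∉ D).image bidder).card :=
            (Finset.card_image_of_injective _ hbinj).symm
        _ ≤ H.toFinset.card := by
            refine Finset.card_le_card fun r hr => ?_
            obtain ⟨c, hc, rfl⟩ := Finset.mem_image.1 hr
            rw [Finset.mem_filter] at hc
            have h1 := hperm.symm.subset (List.mem_map_of_mem (f := bidder) (hall c))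
            rw [List.mem_toFinset]
            exact (List.mem_append.1 h1).resolve_right hc.2
        _ ≤ H.length := List.toFinset_card_le _
        _ ≤ (slots q b x).length := hHlen
        _ = q * x.M.ncard ^ b := by
            rw [hslots, List.length_map, length_slotList, hvslen]
  · omega

end Reduction

end COC

theorem mainTheorem3 (d : ℕ) (hd : 1 ≤ d) (𝒢 : COC.GraphClass) (b : ℕ)
    (hb : 𝒢.BlockingSetsBounded d b)
    (h : (𝒢.plus d).PolyTimeSolvable d ∨ (𝒢.PolyTimeSolvable d ∧ 𝒢.Hereditary)) :
    ∃ (p : COC.Code) (T : Polynomial ℕ),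
      ∀ (n : ℕ) (G : SimpleGraph (Fin n)) (k : ℤ) (M : Set (Fin n)), 𝒢.Mem (COC.del G M) →
        ∃ (n' : ℕ) (G' : SimpleGraph (Fin n')) (k' : ℤ) (φ : Fin n' ↪o Fin n) (t : ℕ),
          COC.Runs p (COC.Data.ofModInstance G k M) (COC.Data.ofInstance G' k') t ∧
          t ≤ T.eval (COC.Data.ofModInstance G k M).size ∧
          (COC.IsYes d G k ↔ COC.IsYes d G' k') ∧
          COC.DeletesComponents G M G' φ ∧
          Nat.card (COC.del G' (φ ⁻¹' M)).ConnectedComponent ≤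
            ((d - 1) * b + 1) * M.ncard ^ b ∧
          k' ≤ k := by
  obtain ⟨Q, hQt, hQ⟩ : ∃ Q : COC.ModInstance 𝒢 → List Bool → ℤ → Bool,
      (COC.PolyTime fun z : COC.ModInstance 𝒢 × List Bool × ℤ => Q z.1 z.2.1 z.2.2) ∧
        COC.IsOracle 𝒢 d Q := by
    rcases h with h | ⟨h, her⟩
    · exact COC.exists_oracle_of_plus h
    · exact COC.exists_oracle_of_hereditary h her
  obtain ⟨p, T, hp⟩ := COC.PolyTime.reduce' hQt ((d - 1) * b + 1) b
  refine ⟨p, T, fun n G k M hM => ?_⟩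
  obtain ⟨t, h1, h2⟩ := hp ⟨n, G, k, M, hM⟩
  obtain ⟨n', G', k', φ, h3, h4⟩ := hQ.reduce_spec hd hb ⟨n, G, k, M, hM⟩
  rw [h3] at h1
  exact ⟨n', G', k', φ, t, h1, h2, h4⟩
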